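/- **Setting.** A *graphon* is a bounded (Lebesgue) measurable function $W:[0,1]^2\to\mathbb R$ with $W(x,y)=W(y,x)$ for all $x,y$. For a finite simple graph $F$ let $$t(F,W)=\int_{[0,1]^{V(F)}}\prod_{ij\in E(F)}W(x_i,x_j)\,dx .$$ The cut distance of two graphons is $$\delta_\square(W,W')=\inf_{\mu}\ \sup_{S,T\subseteq[0,1]^2}\Bigl|\int_{(x,u)\in S,\ (y,v)\in T}\bigl(W(x,y)-W'(u,v)\bigr)\,d\mu(x,u)\,d\mu(y,v)\Bigr|,$$ where $\mu$ runs over the probability measures on $[0,1]^2$ both of whose marginals are Lebesgue measure, and $S,T$ over measurable sets. A *weighted graph* $G$ is a finite nonempty set of nodes with nodeweights $\alpha_i(G)>0$ and symmetric edgeweights $\beta_{ij}(G)\in\mathbb R$ (loops allowed, $\beta_{ij}=0$ for non-edges). Put $\alpha_G=\sum_i\alpha_i(G)$ and $$t(F,G)=\alpha_G^{-|V(F)|}\sum_{\phi:V(F)\to V(G)}\ \prod_{i\in V(F)}\alpha_{\phi(i)}(G)\prod_{ij\in E(F)}\beta_{\phi(i)\phi(j)}(G).$$ The cut distance of two weighted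 graphs is $$\delta_\square(G,G')=\min_X\ \max_{S,T\subseteq V(G)\times V(G')}\Bigl|\sum_{(i,u)\in S}\sum_{(j,v)\in T}X_{iu}X_{jv}\bigl(\beta_{ij}(G)-\beta_{uv}(G')\bigr)\Bigr|,$$ where $X$ runs over the nonnegative matrices indexed by $V(G)\times V(G')$ with $\sum_uX_{iu}=\alpha_i(G)/\alpha_G$ for all $i$ and $\sum_iX_{iu}=\alpha_u(G')/\alpha_{G'}$ for all $u$. **Theorem (graphons).** Let $W,W'$ be graphons and $C=\max\{1,\|W\|_\infty,\|W'\|_\infty\}$. (a) If $F$ is a finite simple graph with $m$ edges, then $|t(F,W)-t(F,W')|\le 4mC^{m-1}\,\delta_\square(W,W')$. (b) Let $k\ge 2$ be an integer. If $|t(F,W)-t(F,W')|\le 3^{-k^2}$ for every simple graph $F$ on $k$ nodes, then $\delta_\square(W,W')\le \dfrac{22\,C}{\sqrt{\log_2 k}}$. **Theorem (weighted graphs).** Let $G_1,G_2$ be weighted graphs with all edgeweights in $[-1,1]$. (a) For every finite simple graph $F$, $|t(F,G_1)-t(F,G_2)|\le 4|E(F)|\,\delta_\square(G_1,G_2)$.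 (b) Let $k\ge 2$ be an integer. If $|t(F,G_1)-t(F,G_2)|\le 3^{-k^2}$ for every simple graph $F$ on $k$ nodes, then $\delta_\square(G_1,G_2)\le \dfrac{22}{\sqrt{\log_2 k}}$. -/

import Mathlib

open MeasureTheory

noncomputable section

namespace DenseGraph

/-- A graphon: a bounded, symmetric, (Lebesgue) measurable function `[0,1]² → ℝ`.
`AEMeasurable` for Lebesgue measure on the square is the same as Lebesgue measurability. -/
structure Graphon where
  toFun : unitInterval → unitInterval → ℝ
  symm' : ∀ x y, toFun x y = toFun y x
  aemeasurable' : AEMeasurable (fun p : unitInterval × unitInterval => toFun p.1 p.2) volume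
  bounded' : ∃ B : ℝ, ∀ x y, |toFun x y| ≤ B

instance : CoeFun Graphon (fun _ => unitInterval → unitInterval → ℝ) := ⟨Graphon.toFun⟩

namespace Graphon

/-- `‖W‖_∞`, the `L_∞` norm with respect to Lebesgue measure on the unit square.
It is finite because `W` is bounded. -/
def supNorm (W : Graphon) : ℝ :=
  (eLpNorm (fun p : unitInterval × unitInterval => W p.1 p.2) ⊤ volume).toReal

open Classical in
/-- The homomorphism density `t(F,W) = ∫_{[0,1]^{V(F)}} ∏_{ij ∈ E(F)} W(x_i,x_j) dx`. -/
def t {V : Type*} [Fintype V] (F : SimpleGraph V) (W : Graphon) : ℝ :=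
  ∫ x : V → unitInterval,
    ∏ e ∈ F.edgeFinset,
      Sym2.lift ⟨fun i j => W (x i) (x j), fun i j => W.symm' (x i) (x j)⟩ e

/-- A coupling of the uniform distribution on `[0,1]` with itself: a measure on `[0,1]²`
(automatically a probability measure) both of whose marginals are Lebesgue measure. -/
def IsCoupling (μ : Measure (unitInterval × unitInterval)) : Prop :=
  μ.fst = volume ∧ μ.snd = volume

/-- The value
`sup_{S,T ⊆ [0,1]²} |∫_{(x,u) ∈ S, (y,v) ∈ T} (W(x,y) - W'(u,v)) dμ(x,u) dμ(y,v)|`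
of an overlay `μ`, the supremum being over measurable sets. -/
def overlayCut (W W' : Graphon) (μ : Measure (unitInterval × unitInterval)) : ℝ :=
  ⨆ ST : {S : Set (unitInterval × unitInterval) // MeasurableSet S} ×
      {T : Set (unitInterval × unitInterval) // MeasurableSet T},
    |∫ p in (ST.1 : Set (unitInterval × unitInterval)) ×ˢ
        (ST.2 : Set (unitInterval × unitInterval)),
      (W p.1.1 p.2.1 - W' p.1.2 p.2.2) ∂(μ.prod μ)|

/-- The cut distance `δ_□(W,W')`: the infimum of `overlayCut` over all couplings. -/
def cutDist (W W' : Graphon) : ℝ :=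
  ⨅ μ : {μ : Measure (unitInterval × unitInterval) // IsCoupling μ}, overlayCut W W' μ

end Graphon

/-- A weighted graph on the node set `V`: positive nodeweights `α` and symmetric real
edgeweights `β` (loops allowed; `β i j = 0` when `ij` is not an edge). -/
structure WeightedGraph (V : Type*) where
  α : V → ℝ
  β : V → V → ℝ
  α_pos : ∀ i, 0 < α i
  β_symm : ∀ i j, β i j = β j i

/-- `e(S,T) = ∑_{i ∈ S, j ∈ T} α_i α_j β_{ij}` for nodeweights `α` and edgeweights `β`. -/
def edgeWeight {V : Type*} (α : V → ℝ) (β : V → V → ℝ) (S T : Finset V) : ℝ :=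
  ∑ i ∈ S, ∑ j ∈ T, α i * α j * β i j

/-- The labeled cut distance
`d_□ = max_{S,T ⊆ V} (1/α_G²) |e_G(S,T) - e_{G'}(S,T)|` of two weighted graphs with the same
nodes, the same nodeweights `α`, and edgeweights `β`, `β'`. -/
def labeledCutDist {V : Type*} [Fintype V] (α : V → ℝ) (β β' : V → V → ℝ) : ℝ :=
  ⨆ ST : Finset V × Finset V,
    1 / (∑ i, α i) ^ 2 * |edgeWeight α β ST.1 ST.2 - edgeWeight α β' ST.1 ST.2|

namespace WeightedGraph

/-- The total nodeweight `α_G`. -/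
def totalWeight {V : Type*} [Fintype V] (G : WeightedGraph V) : ℝ := ∑ i, G.α i

/-- `hom(F,G) = ∑_{φ : V(F) → V(G)} ∏_{i ∈ V(F)} α_{φ(i)} ∏_{ij ∈ E(F)} β_{φ(i) φ(j)}`. -/
def hom {U V : Type*} [Fintype U] [Fintype V] (F : SimpleGraph U) (G : WeightedGraph V) : ℝ :=
  open Classical in
  ∑ φ : U → V, (∏ i, G.α (φ i)) *
    ∏ e ∈ F.edgeFinset,
      Sym2.lift ⟨fun i j => G.β (φ i) (φ j), fun i j => G.β_symm (φ i) (φ j)⟩ e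

/-- The homomorphism density `t(F,G) = hom(F,G) / α_G^{|V(F)|}`. -/
def t {U V : Type*} [Fintype U] [Fintype V] (F : SimpleGraph U) (G : WeightedGraph V) : ℝ :=
  hom F G / G.totalWeight ^ Fintype.card U

/-- Fractional overlays of `G` and `G'`: couplings `X` of the two nodeweight distributions
(nodeweights normalized to total weight `1`). -/
def IsOverlay {V V' : Type*} [Fintype V] [Fintype V'] (G : WeightedGraph V)
    (G' : WeightedGraph V') (X : V → V' → ℝ) : Prop :=
  (∀ i u, 0 ≤ X i u) ∧ (∀ i, ∑ u, X i u = G.α i / G.totalWeight) ∧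
    (∀ u, ∑ i, X i u = G'.α u / G'.totalWeight)

/-- The cut distance `δ_□(G,G') = min_X d_□(G[X], G'[Xᵀ])` over all fractional overlays: both
overlaid graphs have the nodes `(i,u)` with nodeweights `X i u`; the edge `(i,u)(j,v)` has
weight `β i j` in the first and `β' u v` in the second. -/
def cutDist {V V' : Type*} [Fintype V] [Fintype V'] (G : WeightedGraph V)
    (G' : WeightedGraph V') : ℝ :=
  ⨅ X : {X : V → V' → ℝ // IsOverlay G G' X},
    labeledCutDist (fun p : V × V' => X.1 p.1 p.2)
      (fun p q => G.β p.1 q.1) (fun p q => G'.β p.2 q.2)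

end WeightedGraph

end DenseGraph

end

/-!
Both halves compare homomorphism densities with the cut distance, once for weighted graphs and
once for graphons.

*Counting.* For kernels `U`, `U'` on one probability space whose difference has cut norm `κ`,
replace `U` by `U'` one edge at a time. In the integral for the edge `ij`, with all other
coordinates fixed, the remaining factors form a product `f (x i) * g (x j)`, and splitting `f` and
`g` into positive and negative parts bounds the change by `4 κ C ^ (m - 1)`
(`DenseGraph.abs_integral_prod_edgeVal_sub_le`). A coupling puts two graphons, or two weighted
graphs, on a common probability space without changing their densities.

*Inverse counting.* Let `A` be a kernel bounded by `1` on a finite probability space, and sample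
from it a random graph on `k` nodes: choose `k` random points `y i` and give the edge `ij` a
random sign of mean `A (y i) (y j)`. The distribution of this random graph is determined by the
densities of the graphs on `k` nodes, so the hypothesis makes the distributions for the two
kernels nearly equal (`DenseGraph.sum_abs_sampleProb_sub_le`). On the other hand a typical sample
is close in cut distance to the kernel (`DenseGraph.exists_overlay_error`): by weak regularity,
`A` is within `1/√n` of a step kernel `f` with `4 ^ n` steps
(`DenseGraph.exists_weak_regularity`), where `n` is about `log₂ k / 8`; matching points with
sample points in the same step identifies `f` with its sample
(`DenseGraph.exists_coupling_of_colors`, `DenseGraph.iidE_color_le`); the sample of `A - f` has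
almost the same cut norm as `A - f` itself, by decoupling, symmetrization and contraction
(`DenseGraph.iidE_offDiag_le`); and replacing the sampled values by random signs costs a term of
lower order, by exponential moments (`DenseGraph.sum_edgeProb_iSup_le`). Hence one and the same
graph on `k` nodes is close to both kernels, and the two overlays with it can be glued
(`DenseGraph.exists_glued_coupling`, `DenseGraph.exists_overlay_of_densities`).

Instead of the cut norm the finite part uses the `∞ → 1` norm, that is, sign functions in place of
indicator functions; this is larger, and convenient for symmetrization. Graphons reduce to the
finite case by approximating them in `L¹` by step kernels (`DenseGraph.exists_step_approx`) and
lifting the overlay of the step kernels to a coupling on the unit square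
(`DenseGraph.liftCoupling`).
-/

open MeasureTheory

noncomputable section

namespace DenseGraph

/-! ### Finite expectations, symmetrization and contraction -/

section FiniteExpectation

variable {V : Type*} [Fintype V]

/-- The expectation of `f` evaluated at `n` independent points of `V`, each with distribution
`p`. -/
def iidE (p : V → ℝ) (n : ℕ) (f : (Fin n → V) → ℝ) : ℝ :=
  ∑ y : Fin n → V, (∏ i, p (y i)) * f y

/-- Probability vectors on a finite set. -/
structure IsProbVec (p : V → ℝ) : Prop where
  nonneg : ∀ v, 0 ≤ p v
  sum_eq_one : ∑ v, p v = 1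

variable {p : V → ℝ}

theorem iidE_zero (f : (Fin 0 → V) → ℝ) : iidE p 0 f = f Fin.elim0 := by
  simp [iidE, Subsingleton.elim (default : Fin 0 → V) Fin.elim0]

theorem iidE_succ (n : ℕ) (f : (Fin (n + 1) → V) → ℝ) :
    iidE p (n + 1) f = ∑ v, p v * iidE p n (fun y => f (Fin.cons v y)) := by
  unfold iidE
  rw [← (Fin.consEquiv (fun _ : Fin (n + 1) => V)).sum_comp, Fintype.sum_prod_type]
  refine Finset.sum_congr rfl fun v _ => ?_
  rw [Finset.mul_sum]
  refine Finset.sum_congr rfl fun y _ => ?_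
  rw [Fin.prod_univ_succ]
  simp [Fin.consEquiv, mul_assoc]

theorem iidE_mono (hp : ∀ v, 0 ≤ p v) {n : ℕ} {f g : (Fin n → V) → ℝ} (h : ∀ y, f y ≤ g y) :
    iidE p n f ≤ iidE p n g :=
  Finset.sum_le_sum fun y _ =>
    mul_le_mul_of_nonneg_left (h y) (Finset.prod_nonneg fun i _ => hp (y i))

theorem iidE_add (n : ℕ) (f g : (Fin n → V) → ℝ) :
    iidE p n (fun y => f y + g y) = iidE p n f + iidE p n g := by
  simp [iidE, mul_add, Finset.sum_add_distrib]

theorem iidE_const_mul (n : ℕ) (c : ℝ) (f : (Fin n → V) → ℝ) :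
    iidE p n (fun y => c * f y) = c * iidE p n f := by
  simp [iidE, Finset.mul_sum, mul_left_comm]

theorem iidE_sum {ι : Type*} (s : Finset ι) (n : ℕ) (f : ι → (Fin n → V) → ℝ) :
    iidE p n (fun y => ∑ i ∈ s, f i y) = ∑ i ∈ s, iidE p n (f i) := by
  simp only [iidE, Finset.mul_sum]
  exact Finset.sum_comm

theorem iidE_const (hp : IsProbVec p) (n : ℕ) (c : ℝ) : iidE p n (fun _ => c) = c := by
  unfold iidE
  rw [← Finset.sum_mul, ← Fintype.piFinset_univ,
    ← Finset.prod_univ_sum (fun _ : Fin n => (Finset.univ : Finset V)) (fun _ v => p v)]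
  simp [hp.sum_eq_one]

/-- A sum of independent centred terms has second moment growing linearly. -/
theorem iidE_sq_sum_le (hp : IsProbVec p) (h : V → ℝ) (h0 : ∑ v, p v * h v = 0) {K : ℝ}
    (hK : ∑ v, p v * h v ^ 2 ≤ K) (n : ℕ) :
    iidE p n (fun y => (∑ j, h (y j)) ^ 2) ≤ n * K := by
  induction n with
  | zero => simp [iidE_zero]
  | succ n ih =>
    rw [iidE_succ]
    have key : ∀ v, iidE p n (fun y => (∑ j, h ((Fin.cons v y : Fin (n + 1) → V) j)) ^ 2) =
        h v ^ 2 + 2 * h v * iidE p n (fun y => ∑ j, h (y j)) +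
          iidE p n (fun y => (∑ j, h (y j)) ^ 2) := by
      intro v
      rw [← iidE_const hp n (h v ^ 2), ← iidE_const_mul, ← iidE_add, ← iidE_add]
      congr 1
      funext y
      rw [Fin.sum_univ_succ]
      simp only [Fin.cons_zero, Fin.cons_succ]
      ring
    simp only [key, mul_add, Finset.sum_add_distrib]
    rw [← Finset.sum_mul, hp.sum_eq_one]
    have : ∑ v, p v * (2 * h v * iidE p n (fun y => ∑ j, h (y j))) = 0 := by
      have : ∀ v, p v * (2 * h v * iidE p n (fun y => ∑ j, h (y j))) =
        2 * iidE p n (fun y => ∑ j, h (y j)) * (p v * h v) := fun v => by ring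
      simp only [this]
      rw [← Finset.mul_sum, h0, mul_zero]
    rw [this]
    push_cast
    linarith

/-- The inequality of arithmetic and geometric means, in the form that turns a second moment bound
into a first moment bound. -/
theorem abs_le_sq_div (x : ℝ) {l : ℝ} (hl : 0 < l) : |x| ≤ (x ^ 2 / l + l) / 2 := by
  have h : x ^ 2 / l + l - 2 * |x| = (|x| - l) ^ 2 / l := by
    rw [← sq_abs x]; field_simp; ring
  have : 0 ≤ (|x| - l) ^ 2 / l := by positivity
  linarith

/-- First moment bound `E|∑ h(y_j)| ≤ (nK/l + l)/2` with a free parameter `l`; the optimal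
choice is `l = √(nK)`. -/
theorem iidE_abs_sum_le (hp : IsProbVec p) (h : V → ℝ) (h0 : ∑ v, p v * h v = 0) {K : ℝ}
    (hK : ∑ v, p v * h v ^ 2 ≤ K) (n : ℕ) {l : ℝ} (hl : 0 < l) :
    iidE p n (fun y => |∑ j, h (y j)|) ≤ (n * K / l + l) / 2 := by
  calc iidE p n (fun y => |∑ j, h (y j)|)
      ≤ iidE p n (fun y => (1 / (2 * l)) * (∑ j, h (y j)) ^ 2 + l / 2) := by
        refine iidE_mono hp.nonneg fun y => (abs_le_sq_div _ hl).trans (le_of_eq ?_)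
        field_simp
    _ = (1 / (2 * l)) * iidE p n (fun y => (∑ j, h (y j)) ^ 2) + l / 2 := by
        rw [iidE_add, iidE_const_mul, iidE_const hp]
    _ ≤ (1 / (2 * l)) * (n * K) + l / 2 := by
        gcongr
        exact iidE_sq_sum_le hp h h0 hK n
    _ = _ := by field_simp

/-- The sign `±1` encoded by a Boolean. Sign vectors are Boolean functions, so that suprema over
them are finite. -/
def sg (b : Bool) : ℝ := if b then 1 else -1

@[simp] theorem sg_true : sg true = 1 := rfl
@[simp] theorem sg_false : sg false = -1 := rfl
theorem sg_mul_self (b : Bool) : sg b * sg b = 1 := by cases b <;> simp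
theorem abs_sg (b : Bool) : |sg b| = 1 := by cases b <;> simp

/-- The distribution `p` together with an independent uniform sign. -/
def withSign (p : V → ℝ) : V × Bool → ℝ := fun z => p z.1 / 2

theorem IsProbVec.withSign (hp : IsProbVec p) : IsProbVec (withSign p) := by
  refine ⟨fun z => div_nonneg (hp.nonneg _) zero_le_two, ?_⟩
  rw [Fintype.sum_prod_type, ← hp.sum_eq_one]
  exact Finset.sum_congr rfl fun v _ => by
    simp only [DenseGraph.withSign, Fintype.sum_bool, add_halves]

theorem le_ciSup_finite {G : Type*} [Finite G] (f : G → ℝ) (c : G) : f c ≤ ⨆ c, f c :=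
  le_ciSup (Set.finite_range f).bddAbove c

/-- Contraction: passing to absolute values does not increase the average of a supremum over
both signs. -/
theorem iSup_add_abs_add_iSup_sub_abs_le {G : Type*} [Finite G] [Nonempty G] (u g : G → ℝ) :
    (⨆ c, (u c + |g c|)) + (⨆ c, (u c - |g c|)) ≤ (⨆ c, (u c + g c)) + ⨆ c, (u c - g c) := by
  -- with `c` and `d` maximizing on the left, at least one of the pairs `(c, d)`, `(d, c)` does as
  -- well on the right
  obtain ⟨c, hc⟩ := exists_eq_ciSup_of_finite (f := fun c => u c + |g c|)
  obtain ⟨d, hd⟩ := exists_eq_ciSup_of_finite (f := fun c => u c - |g c|)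
  rw [← hc, ← hd]
  have h1 := le_ciSup_finite (fun c => u c + g c) c
  have h2 := le_ciSup_finite (fun c => u c - g c) d
  have h3 := le_ciSup_finite (fun c => u c + g c) d
  have h4 := le_ciSup_finite (fun c => u c - g c) c
  have h5 : |g c| - |g d| ≤ |g c - g d| := abs_sub_abs_le_abs_sub _ _
  rcases abs_cases (g c - g d) with h | h <;> linarith

/-- Symmetrization and contraction in one coordinate. The offset `u` carries the contribution of the
other coordinates in the induction of `iidE_iSup_abs_sub_le`. -/
theorem symmetrize_one (hp : IsProbVec p) {G : Type*} [Finite G] [Nonempty G]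
    (u : G → ℝ) (g : G → V → ℝ) :
    ∑ v, p v * (⨆ c, (u c + (|g c v| - ∑ w, p w * |g c w|))) ≤
      ∑ z, withSign p z * (⨆ c, (u c + 2 * (sg z.2 * g c z.1))) := by
  set a : V → ℝ := fun v => ⨆ c, (u c + |2 * g c v|)
  set b : V → ℝ := fun v => ⨆ c, (u c - |2 * g c v|)
  -- the mean is an average over a second, independent point `w`
  have h1 : ∀ v, (⨆ c, (u c + (|g c v| - ∑ w, p w * |g c w|))) ≤
      ∑ w, p w * ((a v + b w) / 2) := by
    intro v
    refine ciSup_le fun c => ?_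
    have : u c + (|g c v| - ∑ w, p w * |g c w|) = ∑ w, p w * (u c + |g c v| - |g c w|) := by
      simp only [mul_sub, Finset.sum_sub_distrib, ← Finset.sum_mul, hp.sum_eq_one]
      ring
    rw [this]
    refine Finset.sum_le_sum fun w _ => mul_le_mul_of_nonneg_left ?_ (hp.nonneg w)
    have ha : u c + |2 * g c v| ≤ a v := le_ciSup_finite (fun c => u c + |2 * g c v|) c
    have hb : u c - |2 * g c w| ≤ b w := le_ciSup_finite (fun c => u c - |2 * g c w|) c
    rw [abs_mul, abs_two] at ha hb
    linarith
  calc ∑ v, p v * (⨆ c, (u c + (|g c v| - ∑ w, p w * |g c w|)))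
      ≤ ∑ v, p v * ∑ w, p w * ((a v + b w) / 2) :=
        Finset.sum_le_sum fun v _ => mul_le_mul_of_nonneg_left (h1 v) (hp.nonneg v)
    _ = ∑ v, p v * ((a v + b v) / 2) := by
        simp only [mul_add, Finset.sum_add_distrib, ← Finset.sum_mul, hp.sum_eq_one,
          one_mul, add_div]
    _ ≤ ∑ v, p v * (((⨆ c, (u c + 2 * g c v)) + ⨆ c, (u c - 2 * g c v)) / 2) := by
        refine Finset.sum_le_sum fun v _ => mul_le_mul_of_nonneg_left ?_ (hp.nonneg v)
        have := iSup_add_abs_add_iSup_sub_abs_le u (fun c => 2 * g c v)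
        linarith
    _ = _ := by
        rw [Fintype.sum_prod_type]
        refine Finset.sum_congr rfl fun v _ => ?_
        simp only [Fintype.sum_bool, withSign, sg_true, sg_false, one_mul, neg_mul, mul_neg,
          ← sub_eq_add_neg]
        ring

/-- Symmetrization and contraction: the largest deviation of `∑ |g(y_j)|` from its mean over a
finite family of functions `g` is at most twice the Rademacher average of the family. -/
theorem iidE_iSup_abs_sub_le (hp : IsProbVec p) {G : Type*} [Finite G] [Nonempty G]
    (g : G → V → ℝ) (n : ℕ) (u : G → ℝ) :
    iidE p n (fun y => ⨆ c, (u c + ∑ j, (|g c (y j)| - ∑ w, p w * |g c w|))) ≤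
      iidE (withSign p) n (fun z => ⨆ c, (u c + ∑ j, 2 * (sg (z j).2 * g c (z j).1))) := by
  induction n generalizing u with
  | zero => simp [iidE_zero]
  | succ n ih =>
    rw [iidE_succ, iidE_succ]
    simp only [Fin.sum_univ_succ, Fin.cons_zero, Fin.cons_succ]
    calc _ = iidE p n (fun y => ∑ v, p v * ⨆ c, ((u c +
            ∑ j, (|g c (y j)| - ∑ w, p w * |g c w|)) + (|g c v| - ∑ w, p w * |g c w|))) := by
          rw [iidE_sum]
          refine Finset.sum_congr rfl fun v _ => ?_
          rw [iidE_const_mul]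
          simp only [add_comm, add_left_comm]
      _ ≤ iidE p n (fun y => ∑ z, withSign p z * ⨆ c, ((u c +
            ∑ j, (|g c (y j)| - ∑ w, p w * |g c w|)) + 2 * (sg z.2 * g c z.1))) :=
          iidE_mono hp.nonneg fun y => symmetrize_one hp _ g
      _ = ∑ z, withSign p z * iidE p n (fun y => ⨆ c, ((u c + 2 * (sg z.2 * g c z.1)) +
            ∑ j, (|g c (y j)| - ∑ w, p w * |g c w|))) := by
          rw [iidE_sum]
          refine Finset.sum_congr rfl fun v _ => ?_
          rw [iidE_const_mul]
          simp only [add_assoc, add_comm, add_left_comm]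
      _ ≤ ∑ z, withSign p z * iidE (withSign p) n (fun y => ⨆ c, ((u c +
            2 * (sg z.2 * g c z.1)) + ∑ j, 2 * (sg (y j).2 * g c (y j).1))) :=
          Finset.sum_le_sum fun z _ => mul_le_mul_of_nonneg_left (ih _) (hp.withSign.nonneg z)
      _ = _ := by simp only [add_assoc]

end FiniteExpectation

/-! ### Sampling with independent rows and columns -/

section Sampling

variable {V : Type*} [Fintype V] {p : V → ℝ}

theorem exists_sg_mul_eq_abs {ι : Type*} (f : ι → ℝ) :
    ∃ t : ι → Bool, ∀ v, sg (t v) * f v = |f v| := by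
  refine ⟨fun v => decide (0 ≤ f v), fun v => ?_⟩
  by_cases h : 0 ≤ f v
  · simp [h, abs_of_nonneg h]
  · simp [h, abs_of_neg (not_le.1 h)]

theorem sg_mul_le_abs (b : Bool) (x : ℝ) : sg b * x ≤ |x| := by
  cases b
  · simpa using neg_le_abs x
  · simpa using le_abs_self x

/-- The Rademacher average of a bounded function. -/
theorem iidE_rademacher_le (hp : IsProbVec p) (h : V → ℝ) {K : ℝ} (hK : 0 < K)
    (hb : ∀ v, |h v| ≤ K) (n : ℕ) :
    iidE (withSign p) n (fun z => |∑ j, sg (z j).2 * h (z j).1|) ≤ Real.sqrt n * K := by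
  rcases Nat.eq_zero_or_pos n with rfl | hn
  · simp [iidE_zero]
  have hn' : (0 : ℝ) < n := by exact_mod_cast hn
  refine (iidE_abs_sum_le hp.withSign (fun z : V × Bool => sg z.2 * h z.1) ?_ (K := K ^ 2) ?_ n
    (l := Real.sqrt n * K) (by positivity)).trans (le_of_eq ?_)
  · rw [Fintype.sum_prod_type]
    refine Finset.sum_eq_zero fun v _ => ?_
    simp [withSign]
  · calc _ ≤ ∑ z, withSign p z * K ^ 2 := by
          refine Finset.sum_le_sum fun z _ =>
            mul_le_mul_of_nonneg_left ?_ (hp.withSign.nonneg z)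
          rw [← sq_abs, abs_mul, abs_sg, one_mul]
          exact pow_le_pow_left₀ (abs_nonneg _) (hb _) 2
      _ = K ^ 2 := by rw [← Finset.sum_mul, hp.withSign.sum_eq_one, one_mul]
  · have h2 : Real.sqrt n * Real.sqrt n = n := Real.mul_self_sqrt hn'.le
    have h3 : 0 < Real.sqrt n := Real.sqrt_pos.2 hn'
    field_simp
    nlinarith

/-- The sampling lemma for independent rows and columns: the `∞ → 1` norm of a sampled matrix
exceeds that of the kernel only by a term of lower order. -/
theorem iidE_bipartite_le (hp : IsProbVec p) (D : V → V → ℝ) {K N : ℝ} (hK : 0 < K)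
    (hD : ∀ v w, |D v w| ≤ K)
    (hN : ∀ s t : V → Bool, ∑ v, ∑ w, p v * p w * (sg (s v) * sg (t w) * D v w) ≤ N)
    (a b : ℕ) :
    iidE p a (fun x => iidE p b (fun y =>
      ⨆ s : Fin a → Bool, ∑ j, |∑ i, sg (s i) * D (x i) (y j)|)) ≤
      a * b * N + 2 * b * Real.sqrt a * K + 2 * a * Real.sqrt b * K := by
  classical
  -- random columns, for fixed rows `x`: symmetrization over the family of sign vectors `s`
  have h1 : ∀ x : Fin a → V, iidE p b (fun y =>
      ⨆ s : Fin a → Bool, ∑ j, |∑ i, sg (s i) * D (x i) (y j)|) ≤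
      b * (⨆ s : Fin a → Bool, ∑ w, p w * |∑ i, sg (s i) * D (x i) w|) +
        2 * a * Real.sqrt b * K := by
    intro x
    set M := ⨆ s : Fin a → Bool, ∑ w, p w * |∑ i, sg (s i) * D (x i) w| with hM
    have h := iidE_iSup_abs_sub_le hp (fun (s : Fin a → Bool) v => ∑ i, sg (s i) * D (x i) v) b
      (fun _ => 0)
    have hl : iidE p b (fun y =>
        ⨆ s : Fin a → Bool, ∑ j, |∑ i, sg (s i) * D (x i) (y j)|) ≤
        b * M + iidE p b (fun y => ⨆ s : Fin a → Bool, (0 + ∑ j,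
          (|∑ i, sg (s i) * D (x i) (y j)| - ∑ w, p w * |∑ i, sg (s i) * D (x i) w|))) := by
      rw [← iidE_const hp b (b * M), ← iidE_add]
      refine iidE_mono hp.nonneg fun y => ciSup_le fun s => ?_
      have e1 := le_ciSup_finite (fun s : Fin a → Bool => (0 + ∑ j,
          (|∑ i, sg (s i) * D (x i) (y j)| - ∑ w, p w * |∑ i, sg (s i) * D (x i) w|))) s
      have e2 := le_ciSup_finite (fun s : Fin a → Bool =>
        ∑ w, p w * |∑ i, sg (s i) * D (x i) w|) s
      simp only [Finset.sum_sub_distrib, Finset.sum_const, Finset.card_univ, Fintype.card_fin,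
        nsmul_eq_mul] at e1 e2 ⊢
      have e3 := mul_le_mul_of_nonneg_left e2 (Nat.cast_nonneg (α := ℝ) b)
      rw [← hM] at e3
      linarith
    have hr : iidE (withSign p) b (fun z => ⨆ s : Fin a → Bool, (0 + ∑ j,
        2 * (sg (z j).2 * ∑ i, sg (s i) * D (x i) (z j).1))) ≤ 2 * a * Real.sqrt b * K := by
      calc _ ≤ iidE (withSign p) b (fun z => ∑ i, 2 * |∑ j, sg (z j).2 * D (x i) (z j).1|) := by
            refine iidE_mono hp.withSign.nonneg fun z => ciSup_le fun s => ?_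
            have : 0 + ∑ j, 2 * (sg (z j).2 * ∑ i, sg (s i) * D (x i) (z j).1) =
                ∑ i, 2 * (sg (s i) * ∑ j, sg (z j).2 * D (x i) (z j).1) := by
              simp only [Finset.mul_sum, zero_add]
              rw [Finset.sum_comm]
              refine Finset.sum_congr rfl fun i _ => Finset.sum_congr rfl fun j _ => ?_
              ring
            rw [this]
            exact Finset.sum_le_sum fun i _ =>
              mul_le_mul_of_nonneg_left (sg_mul_le_abs _ _) zero_le_two
        _ = ∑ i, 2 * iidE (withSign p) b (fun z => |∑ j, sg (z j).2 * D (x i) (z j).1|) := by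
            rw [iidE_sum]
            exact Finset.sum_congr rfl fun i _ => iidE_const_mul _ _ _
        _ ≤ ∑ i : Fin a, 2 * (Real.sqrt b * K) := Finset.sum_le_sum fun i _ =>
            mul_le_mul_of_nonneg_left (iidE_rademacher_le hp _ hK (hD _) b) zero_le_two
        _ = _ := by simp; ring
    linarith
  -- a maximizing sign vector on the sample is paid for by one on the whole of `V`
  have h2 : ∀ x : Fin a → V, (⨆ s : Fin a → Bool, ∑ w, p w * |∑ i, sg (s i) * D (x i) w|) ≤
      ⨆ t : V → Bool, ∑ i, |∑ w, p w * (sg (t w) * D (x i) w)| := by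
    intro x
    refine ciSup_le fun s => ?_
    obtain ⟨t, ht⟩ := exists_sg_mul_eq_abs (fun w => ∑ i, sg (s i) * D (x i) w)
    refine le_trans ?_ (le_ciSup_finite _ t)
    calc ∑ w, p w * |∑ i, sg (s i) * D (x i) w|
        = ∑ i, sg (s i) * ∑ w, p w * (sg (t w) * D (x i) w) := by
          simp only [← ht, Finset.mul_sum]
          rw [Finset.sum_comm]
          refine Finset.sum_congr rfl fun i _ => Finset.sum_congr rfl fun j _ => ?_
          ring
      _ ≤ _ := Finset.sum_le_sum fun i _ => sg_mul_le_abs _ _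
  -- random rows: symmetrization over the sign vectors `t` on `V`
  have h3 : iidE p a (fun x => ⨆ t : V → Bool, ∑ i, |∑ w, p w * (sg (t w) * D (x i) w)|) ≤
      a * N + 2 * Real.sqrt a * K := by
    have h := iidE_iSup_abs_sub_le hp (fun (t : V → Bool) v => ∑ w, p w * (sg (t w) * D v w)) a
      (fun _ => 0)
    have hl : iidE p a (fun x =>
        ⨆ t : V → Bool, ∑ i, |∑ w, p w * (sg (t w) * D (x i) w)|) ≤
        a * N + iidE p a (fun x => ⨆ t : V → Bool, (0 + ∑ i,
          (|∑ w, p w * (sg (t w) * D (x i) w)| -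
            ∑ v, p v * |∑ w, p w * (sg (t w) * D v w)|))) := by
      rw [← iidE_const hp a (a * N), ← iidE_add]
      refine iidE_mono hp.nonneg fun x => ciSup_le fun t => ?_
      have e1 := le_ciSup_finite (fun t : V → Bool => (0 + ∑ i,
          (|∑ w, p w * (sg (t w) * D (x i) w)| -
            ∑ v, p v * |∑ w, p w * (sg (t w) * D v w)|))) t
      have e2 : ∑ v, p v * |∑ w, p w * (sg (t w) * D v w)| ≤ N := by
        obtain ⟨s, hs⟩ := exists_sg_mul_eq_abs (fun v => ∑ w, p w * (sg (t w) * D v w))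
        refine le_trans (le_of_eq ?_) (hN s t)
        simp only [← hs, Finset.mul_sum]
        refine Finset.sum_congr rfl fun i _ => Finset.sum_congr rfl fun j _ => ?_
        ring
      simp only [Finset.sum_sub_distrib, Finset.sum_const, Finset.card_univ, Fintype.card_fin,
        nsmul_eq_mul] at e1 e2 ⊢
      have e3 := mul_le_mul_of_nonneg_left e2 (Nat.cast_nonneg (α := ℝ) a)
      linarith
    have hr : iidE (withSign p) a (fun z => ⨆ t : V → Bool, (0 + ∑ i,
        2 * (sg (z i).2 * ∑ w, p w * (sg (t w) * D (z i).1 w)))) ≤ 2 * Real.sqrt a * K := by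
      calc _ ≤ iidE (withSign p) a
              (fun z => ∑ w, 2 * p w * |∑ i, sg (z i).2 * D (z i).1 w|) := by
            refine iidE_mono hp.withSign.nonneg fun z => ciSup_le fun t => ?_
            have : 0 + ∑ i, 2 * (sg (z i).2 * ∑ w, p w * (sg (t w) * D (z i).1 w)) =
                ∑ w, 2 * p w * (sg (t w) * ∑ i, sg (z i).2 * D (z i).1 w) := by
              simp only [Finset.mul_sum, zero_add]
              rw [Finset.sum_comm]
              refine Finset.sum_congr rfl fun i _ => Finset.sum_congr rfl fun j _ => ?_
              ring
            rw [this]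
            exact Finset.sum_le_sum fun w _ =>
              mul_le_mul_of_nonneg_left (sg_mul_le_abs _ _)
                (mul_nonneg zero_le_two (hp.nonneg w))
        _ = ∑ w, 2 * p w * iidE (withSign p) a (fun z => |∑ i, sg (z i).2 * D (z i).1 w|) := by
            rw [iidE_sum]
            exact Finset.sum_congr rfl fun i _ => iidE_const_mul _ _ _
        _ ≤ ∑ w, 2 * p w * (Real.sqrt a * K) := Finset.sum_le_sum fun w _ =>
            mul_le_mul_of_nonneg_left
              (iidE_rademacher_le hp (fun v => D v w) hK (fun v => hD v w) a)
              (mul_nonneg zero_le_two (hp.nonneg w))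
        _ = _ := by rw [← Finset.sum_mul, ← Finset.mul_sum, hp.sum_eq_one]; ring
    linarith
  calc _ ≤ iidE p a (fun x => b * (⨆ t : V → Bool, ∑ i, |∑ w, p w * (sg (t w) * D (x i) w)|) +
        2 * a * Real.sqrt b * K) := by
        refine iidE_mono hp.nonneg fun x => (h1 x).trans ?_
        gcongr
        exact h2 x
    _ = b * iidE p a (fun x => ⨆ t : V → Bool, ∑ i, |∑ w, p w * (sg (t w) * D (x i) w)|) +
        2 * a * Real.sqrt b * K := by
        rw [iidE_add, iidE_const_mul, iidE_const hp]
    _ ≤ b * (a * N + 2 * Real.sqrt a * K) + 2 * a * Real.sqrt b * K := by gcongr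
    _ = _ := by ring

/-- Splitting a sample along a set `A` of indices and its complement. -/
theorem iidE_split {k : ℕ} (A : Finset (Fin k)) (f : (Fin k → V) → ℝ) :
    iidE p k f = iidE p A.card (fun x => iidE p Aᶜ.card (fun y =>
      f (Sum.elim x y ∘
        (finSumEquivOfFinset rfl rfl : Fin A.card ⊕ Fin Aᶜ.card ≃ Fin k).symm))) := by
  set e : Fin A.card ⊕ Fin Aᶜ.card ≃ Fin k := finSumEquivOfFinset rfl rfl
  unfold iidE
  rw [← (e.arrowCongr (Equiv.refl V)).sum_comp,
    ← (Equiv.sumArrowEquivProdArrow (Fin A.card) (Fin Aᶜ.card) V).symm.sum_comp,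
    Fintype.sum_prod_type]
  refine Finset.sum_congr rfl fun x _ => ?_
  rw [Finset.mul_sum]
  refine Finset.sum_congr rfl fun y _ => ?_
  rw [← e.prod_comp, Fintype.prod_sum_type]
  simp only [Equiv.arrowCongr_apply, Equiv.coe_refl, Function.comp_apply, id_eq,
    Equiv.symm_apply_apply, Equiv.sumArrowEquivProdArrow, Equiv.coe_fn_symm_mk, Sum.elim_inl,
    Sum.elim_inr, mul_assoc]
  rfl

end Sampling

/-! ### Decoupling and weak regularity -/

section Decoupling

variable {V : Type*} [Fintype V] {p : V → ℝ}

/-- The indicator of `i ∈ A`. -/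
def memInd {k : ℕ} (A : Finset (Fin k)) (i : Fin k) : ℝ := if i ∈ A then 1 else 0

/-- A uniformly random set contains `i` and misses `j` with probability `1/4`. -/
theorem sum_memInd_mul {k : ℕ} {i j : Fin k} (hij : i ≠ j) :
    ∑ A : Finset (Fin k), memInd A i * (1 - memInd A j) = 2 ^ k / 4 := by
  have flip_self : ∀ (A : Finset (Fin k)) (i : Fin k),
      memInd (symmDiff A {i}) i = 1 - memInd A i := by
    intro A i
    by_cases h : i ∈ A <;> simp [memInd, Finset.mem_symmDiff, h]
  have flip_ne : ∀ (A : Finset (Fin k)) {i j : Fin k}, i ≠ j →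
      memInd (symmDiff A {i}) j = memInd A j := by
    intro A i j h
    by_cases h' : j ∈ A <;> simp [memInd, Finset.mem_symmDiff, h', h.symm]
  have flip_sum : ∀ (i : Fin k) (f : Finset (Fin k) → ℝ),
      ∑ A, f (symmDiff A {i}) = ∑ A, f A := fun i f =>
    Equiv.sum_comp (Function.Involutive.toPerm (fun A : Finset (Fin k) => symmDiff A {i})
      (fun A => symmDiff_symmDiff_cancel_right {i} A)) f
  have h1 := flip_sum i (fun A => memInd A i * (1 - memInd A j))
  have h2 := flip_sum j (fun A => memInd A j)
  simp only [flip_self, flip_ne _ hij] at h1 h2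
  have h3 : ∑ A : Finset (Fin k), (1 : ℝ) = 2 ^ k := by simp
  have h4 : ∀ A : Finset (Fin k), (1 - memInd A i) * (1 - memInd A j) =
      1 - memInd A j - memInd A i * (1 - memInd A j) := fun A => by ring
  simp only [h4, Finset.sum_sub_distrib, h3] at h1 h2
  linarith

/-- Off-diagonal sums are averages of sums over `A × Aᶜ`. -/
theorem sum_offDiag_eq {k : ℕ} (B : Fin k → Fin k → ℝ) :
    ∑ i, ∑ j, (if i = j then 0 else B i j) =
      4 / 2 ^ k * ∑ A : Finset (Fin k), ∑ i, ∑ j, memInd A i * (1 - memInd A j) * B i j := by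
  rw [Finset.sum_comm (γ := Finset (Fin k)), Finset.mul_sum]
  refine Finset.sum_congr rfl fun i _ => ?_
  rw [Finset.sum_comm (γ := Finset (Fin k)), Finset.mul_sum]
  refine Finset.sum_congr rfl fun j _ => ?_
  rw [← Finset.sum_mul]
  split_ifs with h
  · subst h
    rw [Finset.sum_eq_zero, zero_mul, mul_zero]
    intro A _
    unfold memInd
    split_ifs <;> simp
  · rw [sum_memInd_mul h]
    field_simp

theorem sum_mask_eq {k : ℕ} (A : Finset (Fin k)) (B : Fin k → Fin k → ℝ) :
    ∑ i, ∑ j, memInd A i * (1 - memInd A j) * B i j =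
      ∑ j : Fin Aᶜ.card, ∑ i : Fin A.card,
        B (finSumEquivOfFinset (s := A) rfl rfl (Sum.inl i))
          (finSumEquivOfFinset (s := A) rfl rfl (Sum.inr j)) := by
  set e : Fin A.card ⊕ Fin Aᶜ.card ≃ Fin k := finSumEquivOfFinset rfl rfl with he
  have hl : ∀ i, memInd A (e (Sum.inl i)) = 1 := by
    intro i
    have : e (Sum.inl i) ∈ A := by
      rw [he, finSumEquivOfFinset_inl]; exact Finset.orderEmbOfFin_mem _ _ _
    simp [memInd, this]
  have hr : ∀ i, memInd A (e (Sum.inr i)) = 0 := by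
    intro i
    have : e (Sum.inr i) ∈ Aᶜ := by
      rw [he, finSumEquivOfFinset_inr]; exact Finset.orderEmbOfFin_mem _ _ _
    simp [memInd, Finset.mem_compl.1 this]
  rw [← e.sum_comp]
  simp only [← e.sum_comp (fun j => memInd A _ * (1 - memInd A j) * B _ j)]
  simp only [Fintype.sum_sum_type, hl, hr, sub_self, mul_zero, zero_mul, sub_zero, one_mul,
    Finset.sum_const_zero, zero_add, add_zero]
  exact Finset.sum_comm

/-- The sampling lemma: the `∞ → 1` norm of the matrix `D (y i) (y j)` (off the diagonal) of a
random sample exceeds `k²` times that of the kernel only by a term of lower order. Decoupling, that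
is averaging over the sets `A` of indices that serve as rows, reduces this to independent rows and
columns. -/
theorem iidE_offDiag_le (hp : IsProbVec p) (D : V → V → ℝ) {K N : ℝ} (hK : 0 < K)
    (hN0 : 0 ≤ N) (hD : ∀ v w, |D v w| ≤ K)
    (hN : ∀ s t : V → Bool, ∑ v, ∑ w, p v * p w * (sg (s v) * sg (t w) * D v w) ≤ N)
    (k : ℕ) :
    iidE p k (fun y => ⨆ st : (Fin k → Bool) × (Fin k → Bool),
      ∑ i, ∑ j, (if i = j then 0 else sg (st.1 i) * sg (st.2 j) * D (y i) (y j))) ≤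
      k ^ 2 * N + 16 * k * Real.sqrt k * K := by
  classical
  set Φ : Finset (Fin k) → (Fin k → V) → ℝ := fun A y =>
    ⨆ st : (Fin k → Bool) × (Fin k → Bool), ∑ i, ∑ j, memInd A i * (1 - memInd A j) *
      (sg (st.1 i) * sg (st.2 j) * D (y i) (y j)) with hΦ
  have hA : ∀ A, iidE p k (Φ A) ≤ k ^ 2 / 4 * N + 4 * k * Real.sqrt k * K := by
    intro A
    rw [iidE_split A]
    calc _ ≤ iidE p A.card (fun x => iidE p Aᶜ.card (fun y =>
          ⨆ s : Fin A.card → Bool, ∑ j, |∑ i, sg (s i) * D (x i) (y j)|)) := by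
          refine iidE_mono hp.nonneg fun x => iidE_mono hp.nonneg fun y => ciSup_le fun st => ?_
          set e : Fin A.card ⊕ Fin Aᶜ.card ≃ Fin k := finSumEquivOfFinset rfl rfl with he
          refine le_trans ?_ (le_ciSup_finite _ (fun i => st.1 (e (Sum.inl i))))
          rw [sum_mask_eq]
          refine Finset.sum_le_sum fun j _ => ?_
          rw [← he]
          simp only [Function.comp_apply, Equiv.symm_apply_apply, Sum.elim_inl, Sum.elim_inr]
          refine le_trans (le_of_eq ?_) (sg_mul_le_abs (st.2 (e (Sum.inr j))) _)
          rw [Finset.mul_sum]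
          exact Finset.sum_congr rfl fun i _ => by ring
      _ ≤ A.card * Aᶜ.card * N + 2 * Aᶜ.card * Real.sqrt A.card * K +
          2 * A.card * Real.sqrt Aᶜ.card * K := iidE_bipartite_le hp D hK hD hN _ _
      _ ≤ _ := by
          have hab : (A.card : ℝ) + Aᶜ.card = k := by
            have := A.card_add_card_compl
            rw [Fintype.card_fin] at this
            exact_mod_cast this
          have ha0 : (0 : ℝ) ≤ A.card := Nat.cast_nonneg _
          have hb0 : (0 : ℝ) ≤ Aᶜ.card := Nat.cast_nonneg _
          have h1 : Real.sqrt A.card ≤ Real.sqrt k := Real.sqrt_le_sqrt (by linarith)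
          have h2 : Real.sqrt Aᶜ.card ≤ Real.sqrt k := Real.sqrt_le_sqrt (by linarith)
          have h3 : (A.card * Aᶜ.card : ℝ) * N ≤ k ^ 2 / 4 * N := by
            refine mul_le_mul_of_nonneg_right ?_ hN0
            rw [← hab]
            nlinarith [sq_nonneg ((A.card : ℝ) - Aᶜ.card)]
          have h4 : 2 * (Aᶜ.card : ℝ) * Real.sqrt A.card * K ≤ 2 * k * Real.sqrt k * K := by
            gcongr
            exact_mod_cast (by linarith : (Aᶜ.card : ℝ) ≤ k)
          have h5 : 2 * (A.card : ℝ) * Real.sqrt Aᶜ.card * K ≤ 2 * k * Real.sqrt k * K := by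
            gcongr
            exact_mod_cast (by linarith : (A.card : ℝ) ≤ k)
          linarith
  calc _ ≤ iidE p k (fun y => 4 / 2 ^ k * ∑ A : Finset (Fin k), Φ A y) := by
        refine iidE_mono hp.nonneg fun y => ciSup_le fun st => ?_
        rw [sum_offDiag_eq]
        gcongr with A _
        exact le_ciSup_finite (fun st : (Fin k → Bool) × (Fin k → Bool) => ∑ i, ∑ j,
          memInd A i * (1 - memInd A j) * (sg (st.1 i) * sg (st.2 j) * D (y i) (y j))) st
    _ = 4 / 2 ^ k * ∑ A : Finset (Fin k), iidE p k (Φ A) := by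
        rw [iidE_const_mul, iidE_sum]
    _ ≤ 4 / 2 ^ k * ∑ A : Finset (Fin k), (k ^ 2 / 4 * N + 4 * k * Real.sqrt k * K) := by
        gcongr with A _
        exact hA A
    _ = _ := by
        simp only [Finset.sum_const, Finset.card_univ, Fintype.card_finset, Fintype.card_fin,
          nsmul_eq_mul, Nat.cast_pow, Nat.cast_ofNat]
        field_simp
        ring

end Decoupling

section WeakRegularity

variable {V : Type*} [Fintype V] {p : V → ℝ}

/-- Weak regularity: a kernel bounded by `1` is, up to `1/√n` in the `∞ → 1` norm,
a combination of `n` products of sign functions, with coefficients in `[-1,1]`. -/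
theorem exists_weak_regularity (hp : IsProbVec p) (A : V → V → ℝ) (hA : ∀ v w, |A v w| ≤ 1)
    (n : ℕ) (hn : 0 < n) :
    ∃ (c : Fin n → ℝ) (s t : Fin n → V → Bool), (∀ l, |c l| ≤ 1) ∧
      ∀ s' t' : V → Bool, ∑ v, ∑ w, p v * p w * (sg (s' v) * sg (t' w) *
        (A v w - ∑ l, c l * (sg (s l v) * sg (t l w)))) ≤ 1 / Real.sqrt n := by
  classical
  -- the pairing of a kernel with a product of two sign functions
  set B : (V → V → ℝ) → (V → Bool) → (V → Bool) → ℝ := fun D s t =>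
    ∑ v, ∑ w, p v * p w * (sg (s v) * sg (t w) * D v w) with hB
  -- the energy
  set Q : (V → V → ℝ) → ℝ := fun D => ∑ v, ∑ w, p v * p w * D v w ^ 2 with hQ
  have hpp : ∑ v, ∑ w, p v * p w = 1 := by
    simp only [← Finset.mul_sum, hp.sum_eq_one, mul_one]
  have hQ0 : ∀ D, 0 ≤ Q D := fun D => Finset.sum_nonneg fun v _ => Finset.sum_nonneg fun w _ =>
    mul_nonneg (mul_nonneg (hp.nonneg v) (hp.nonneg w)) (sq_nonneg _)
  have hstep : ∀ D s t c, Q (fun v w => D v w - c * (sg (s v) * sg (t w))) =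
      Q D - 2 * c * B D s t + c ^ 2 := by
    intro D s t c
    have : c ^ 2 = c ^ 2 * ∑ v, ∑ w, p v * p w := by rw [hpp, mul_one]
    rw [this]
    simp only [hQ, hB, Finset.mul_sum, ← Finset.sum_sub_distrib, ← Finset.sum_add_distrib]
    refine Finset.sum_congr rfl fun v _ => Finset.sum_congr rfl fun w _ => ?_
    have e1 := sg_mul_self (s v)
    have e2 := sg_mul_self (t w)
    have e3 : (sg (s v) * sg (t w)) ^ 2 = 1 := by
      rw [mul_pow, sq, sq, e1, e2, one_mul]
    linear_combination c ^ 2 * p v * p w * e3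
  have hBQ : ∀ D s t, B D s t ^ 2 ≤ Q D := by
    intro D s t
    have := hQ0 (fun v w => D v w - B D s t * (sg (s v) * sg (t w)))
    rw [hstep] at this
    nlinarith
  have hQA : Q A ≤ 1 := by
    rw [← hpp]
    refine Finset.sum_le_sum fun v _ => Finset.sum_le_sum fun w _ => ?_
    refine mul_le_of_le_one_right (mul_nonneg (hp.nonneg v) (hp.nonneg w)) ?_
    rw [← sq_abs]
    exact pow_le_one₀ (abs_nonneg _) (hA v w)
  have hn' : (0 : ℝ) < n := by exact_mod_cast hn
  -- as long as the bound fails, every greedy step lowers the energy by at least `1/n`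
  have key : ∀ r : ℕ, ∃ (c : Fin r → ℝ) (s t : Fin r → V → Bool), (∀ l, |c l| ≤ 1) ∧
      Q (fun v w => A v w - ∑ l, c l * (sg (s l v) * sg (t l w))) ≤ 1 ∧
      ((∀ s' t' : V → Bool,
        B (fun v w => A v w - ∑ l, c l * (sg (s l v) * sg (t l w))) s' t' ≤ 1 / Real.sqrt n) ∨
        Q (fun v w => A v w - ∑ l, c l * (sg (s l v) * sg (t l w))) ≤ 1 - r / n) := by
    intro r
    induction r with
    | zero => exact ⟨Fin.elim0, Fin.elim0, Fin.elim0, fun l => l.elim0, by simpa using hQA,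
        Or.inr (by simpa using hQA)⟩
    | succ r ih =>
      obtain ⟨c, s, t, hc, hQ1, h⟩ := ih
      set D : V → V → ℝ := fun v w => A v w - ∑ l, c l * (sg (s l v) * sg (t l w)) with hD
      have hsnoc : ∀ (c' : ℝ) (s' t' : V → Bool), (fun v w => A v w - ∑ l : Fin (r + 1),
          (Fin.snoc c c' : Fin (r + 1) → ℝ) l *
            (sg ((Fin.snoc s s' : Fin (r + 1) → V → Bool) l v) *
              sg ((Fin.snoc t t' : Fin (r + 1) → V → Bool) l w))) =
          fun v w => D v w - c' * (sg (s' v) * sg (t' w)) := by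
        intro c' s' t'
        funext v w
        rw [Fin.sum_univ_castSucc]
        simp only [Fin.snoc_castSucc, Fin.snoc_last, hD]
        ring
      by_cases hg : ∀ s' t' : V → Bool, B D s' t' ≤ 1 / Real.sqrt n
      · refine ⟨Fin.snoc c 0, Fin.snoc s (fun _ => true), Fin.snoc t (fun _ => true), ?_, ?_, ?_⟩
        · intro l
          refine Fin.lastCases ?_ (fun l => ?_) l
          · simp
          · simpa using hc l
        · rw [hsnoc]; simpa using hQ1
        · left; rw [hsnoc]; simpa using hg
      · have hQr := h.resolve_left hg
        push Not at hg
        obtain ⟨s', t', hst⟩ := hg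
        have hpos : 0 < 1 / Real.sqrt n := by positivity
        have hsq : 1 / (n : ℝ) ≤ B D s' t' ^ 2 := by
          have : (1 / Real.sqrt n) ^ 2 = 1 / (n : ℝ) := by
            rw [div_pow, one_pow, Real.sq_sqrt hn'.le]
          rw [← this]
          exact pow_le_pow_left₀ hpos.le hst.le 2
        have hQnew : Q (fun v w => D v w - B D s' t' * (sg (s' v) * sg (t' w))) ≤
            Q D - 1 / n := by
          rw [hstep]; nlinarith
        refine ⟨Fin.snoc c (B D s' t'), Fin.snoc s s', Fin.snoc t t', ?_, ?_, ?_⟩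
        · intro l
          refine Fin.lastCases ?_ (fun l => ?_) l
          · rw [Fin.snoc_last]
            exact abs_le_one_iff_mul_self_le_one.2 (by nlinarith [hBQ D s' t'])
          · simpa using hc l
        · rw [hsnoc]
          have : 0 < 1 / (n : ℝ) := by positivity
          linarith
        · right
          rw [hsnoc]
          refine hQnew.trans ?_
          push_cast
          rw [add_div]
          linarith
  obtain ⟨c, s, t, hc, -, h⟩ := key n
  refine ⟨c, s, t, hc, ?_⟩
  rcases h with h | h
  · exact h
  · intro s' t'
    have h1 := hBQ (fun v w => A v w - ∑ l, c l * (sg (s l v) * sg (t l w))) s' t'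
    rw [div_self hn'.ne', sub_self] at h
    have h2 : B (fun v w => A v w - ∑ l, c l * (sg (s l v) * sg (t l w))) s' t' = 0 := by
      have := hQ0 (fun v w => A v w - ∑ l, c l * (sg (s l v) * sg (t l w)))
      exact pow_eq_zero_iff (two_ne_zero) |>.1 (le_antisymm (h1.trans h) (sq_nonneg _))
    exact h2.le.trans (by positivity)

end WeakRegularity

/-! ### Cut norms and couplings on finite sets -/

section CutLE

/-- `CutLE ρ B η` says that the kernel `B` on a finite set with weights `ρ` has `∞ → 1` norm at
most `η`. The test functions are absorbed into the weights: `a` and `b` stand for `ρ s` and `ρ t`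
with `|s|, |t| ≤ 1`. -/
def CutLE {I : Type*} [Fintype I] (ρ : I → ℝ) (B : I → I → ℝ) (η : ℝ) : Prop :=
  ∀ a b : I → ℝ, (∀ z, |a z| ≤ ρ z) → (∀ z, |b z| ≤ ρ z) →
    |∑ z, ∑ w, a z * b w * B z w| ≤ η

variable {I J : Type*} [Fintype I] [Fintype J] {ρ : I → ℝ} {B B' : I → I → ℝ} {η η' : ℝ}

theorem CutLE.add (h : CutLE ρ B η) (h' : CutLE ρ B' η') :
    CutLE ρ (fun z w => B z w + B' z w) (η + η') := by
  intro a b ha hb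
  simp only [mul_add, Finset.sum_add_distrib]
  exact (abs_add_le _ _).trans (add_le_add (h a b ha hb) (h' a b ha hb))

theorem CutLE.neg (h : CutLE ρ B η) : CutLE ρ (fun z w => -B z w) η := by
  intro a b ha hb
  simpa only [mul_neg, Finset.sum_neg_distrib, abs_neg] using h a b ha hb

theorem CutLE.mono (h : CutLE ρ B η) (hη : η ≤ η') : CutLE ρ B η' :=
  fun a b ha hb => (h a b ha hb).trans hη

theorem cutLE_of_sum_abs_le (h : ∑ z, ∑ w, ρ z * ρ w * |B z w| ≤ η) : CutLE ρ B η := by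
  intro a b ha hb
  refine (Finset.abs_sum_le_sum_abs _ _).trans (le_trans ?_ h)
  refine Finset.sum_le_sum fun z _ => (Finset.abs_sum_le_sum_abs _ _).trans ?_
  refine Finset.sum_le_sum fun w _ => ?_
  rw [abs_mul, abs_mul]
  exact mul_le_mul_of_nonneg_right (mul_le_mul (ha z) (hb w) (abs_nonneg _)
    ((abs_nonneg _).trans (ha z))) (abs_nonneg _)

/-- It is enough to test with sign functions. -/
theorem cutLE_of_signs
    (h : ∀ s t : I → Bool, ∑ z, ∑ w, ρ z * ρ w * (sg (s z) * sg (t w) * B z w) ≤ η) :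
    CutLE ρ B η := by
  have bound : ∀ (a X : I → ℝ), (∀ z, |a z| ≤ ρ z) → ∑ z, a z * X z ≤ ∑ z, ρ z * |X z| := by
    intro a X ha
    refine Finset.sum_le_sum fun z _ => (le_abs_self _).trans ?_
    rw [abs_mul]
    exact mul_le_mul_of_nonneg_right (ha z) (abs_nonneg _)
  have key : ∀ a b : I → ℝ, (∀ z, |a z| ≤ ρ z) → (∀ z, |b z| ≤ ρ z) →
      ∑ z, ∑ w, a z * b w * B z w ≤ η := by
    intro a b ha hb
    obtain ⟨s, hs⟩ := exists_sg_mul_eq_abs (fun z => ∑ w, b w * B z w)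
    obtain ⟨t, ht⟩ := exists_sg_mul_eq_abs (fun w => ∑ z, ρ z * sg (s z) * B z w)
    calc ∑ z, ∑ w, a z * b w * B z w = ∑ z, a z * ∑ w, b w * B z w := by
          simp only [Finset.mul_sum, mul_assoc]
      _ ≤ ∑ z, ρ z * |∑ w, b w * B z w| := bound _ _ ha
      _ = ∑ w, b w * ∑ z, ρ z * sg (s z) * B z w := by
          simp only [← hs, Finset.mul_sum]
          rw [Finset.sum_comm]
          exact Finset.sum_congr rfl fun _ _ => Finset.sum_congr rfl fun _ _ => by ring
      _ ≤ ∑ w, ρ w * |∑ z, ρ z * sg (s z) * B z w| := bound _ _ hb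
      _ = ∑ z, ∑ w, ρ z * ρ w * (sg (s z) * sg (t w) * B z w) := by
          simp only [← ht, Finset.mul_sum]
          rw [Finset.sum_comm]
          exact Finset.sum_congr rfl fun _ _ => Finset.sum_congr rfl fun _ _ => by ring
      _ ≤ η := h s t
  intro a b ha hb
  rw [abs_le]
  refine ⟨?_, key a b ha hb⟩
  have := key (fun z => -a z) b (fun z => by rw [abs_neg]; exact ha z) hb
  simp only [neg_mul, Finset.sum_neg_distrib] at this
  linarith

theorem sum_fiberwise_mul [DecidableEq J] (π : I → J) (a : I → ℝ) (f : J → ℝ) :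
    ∑ z, a z * f (π z) = ∑ j, (∑ z with π z = j, a z) * f j := by
  rw [← Finset.sum_fiberwise Finset.univ π]
  refine Finset.sum_congr rfl fun j _ => ?_
  rw [Finset.sum_mul]
  refine Finset.sum_congr rfl fun z hz => ?_
  rw [(Finset.mem_filter.1 hz).2]

theorem sum_sum_fiberwise_mul [DecidableEq J] (π : I → J) (a b : I → ℝ) (B : J → J → ℝ) :
    ∑ z, ∑ w, a z * b w * B (π z) (π w) =
      ∑ i, ∑ j, (∑ z with π z = i, a z) * (∑ z with π z = j, b z) * B i j := by
  simp only [mul_assoc, ← Finset.mul_sum]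
  simp only [sum_fiberwise_mul π b]
  exact sum_fiberwise_mul π a (fun i => ∑ j, (∑ z with π z = j, b z) * B i j)

/-- Pulling a kernel back along a weight preserving map does not increase its norm. -/
theorem CutLE.comap [DecidableEq J] {B : J → J → ℝ} (π : I → J)
    (h : CutLE (fun j => ∑ z with π z = j, ρ z) B η) :
    CutLE ρ (fun z w => B (π z) (π w)) η := by
  intro a b ha hb
  rw [sum_sum_fiberwise_mul]
  exact h _ _ (fun j => (Finset.abs_sum_le_sum_abs _ _).trans (Finset.sum_le_sum fun z _ => ha z))
    (fun j => (Finset.abs_sum_le_sum_abs _ _).trans (Finset.sum_le_sum fun z _ => hb z))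

/-- Test functions for the image weights lift to the source, so a kernel on the image has at most
the norm of its pullback. -/
theorem CutLE.map [DecidableEq J] {B : J → J → ℝ} (π : I → J) (hρ : ∀ z, 0 ≤ ρ z)
    (h : CutLE ρ (fun z w => B (π z) (π w)) η) :
    CutLE (fun j => ∑ z with π z = j, ρ z) B η := by
  intro a b ha hb
  set m : J → ℝ := fun j => ∑ z with π z = j, ρ z with hm
  have hm0 : ∀ j, 0 ≤ m j := fun j => Finset.sum_nonneg fun z _ => hρ z
  have lift_le : ∀ a : J → ℝ, (∀ j, |a j| ≤ m j) → ∀ z, |ρ z * (a (π z) / m (π z))| ≤ ρ z := by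
    intro a ha z
    rw [abs_mul, abs_of_nonneg (hρ z), abs_div, abs_of_nonneg (hm0 _)]
    exact mul_le_of_le_one_right (hρ z) (div_le_one_of_le₀ (ha _) (hm0 _))
  have lift_sum : ∀ a : J → ℝ, (∀ j, |a j| ≤ m j) → ∀ j,
      ∑ z with π z = j, ρ z * (a (π z) / m (π z)) = a j := by
    intro a ha j
    have : ∀ z ∈ Finset.univ.filter (fun z => π z = j), ρ z * (a (π z) / m (π z)) =
        ρ z * (a j / m j) := fun z hz => by rw [(Finset.mem_filter.1 hz).2]
    rw [Finset.sum_congr rfl this, ← Finset.sum_mul]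
    change m j * (a j / m j) = a j
    rcases (hm0 j).eq_or_lt with h0 | h0
    · have : a j = 0 := abs_nonpos_iff.1 ((ha j).trans h0.symm.le)
      rw [this, zero_div, mul_zero]
    · field_simp
  have := h _ _ (lift_le a ha) (lift_le b hb)
  rw [sum_sum_fiberwise_mul] at this
  simpa only [lift_sum a ha, lift_sum b hb] using this

end CutLE

section Coupling

/-- `X` is a coupling of the weight vectors `p` and `q`. -/
structure IsWeightCoupling {V V' : Type*} [Fintype V] [Fintype V'] (p : V → ℝ) (q : V' → ℝ)
    (X : V × V' → ℝ) : Prop where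
  nonneg : ∀ z, 0 ≤ X z
  sum_right : ∀ v, ∑ u, X (v, u) = p v
  sum_left : ∀ u, ∑ v, X (v, u) = q u

variable {V V' : Type*} [Fintype V] [Fintype V'] {p : V → ℝ} {q : V' → ℝ} {X : V × V' → ℝ}

theorem IsWeightCoupling.map_fst [DecidableEq V] (h : IsWeightCoupling p q X) :
    (fun v => ∑ z : V × V' with z.1 = v, X z) = p := by
  funext v
  rw [← h.sum_right v, Finset.sum_filter, Fintype.sum_prod_type]
  rw [Finset.sum_eq_single v] <;> simp +contextual

theorem IsWeightCoupling.map_snd [DecidableEq V'] (h : IsWeightCoupling p q X) :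
    (fun u => ∑ z : V × V' with z.2 = u, X z) = q := by
  funext u
  rw [← h.sum_left u, Finset.sum_filter, Fintype.sum_prod_type]
  simp

/-- Gluing two couplings along a common weight vector `q`. -/
theorem exists_glued_coupling {I : Type*} [Fintype I] {p' : V' → ℝ} {q : I → ℝ}
    (hq : ∀ i, 0 < q i) {ρ : V × I → ℝ} {ρ' : V' × I → ℝ} (hρ : IsWeightCoupling p q ρ)
    (hρ' : IsWeightCoupling p' q ρ') {A : V → V → ℝ} {A' : V' → V' → ℝ} {H : I → I → ℝ}
    {η η' : ℝ} (h : CutLE ρ (fun z w => A z.1 w.1 - H z.2 w.2) η)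
    (h' : CutLE ρ' (fun z w => A' z.1 w.1 - H z.2 w.2) η') :
    ∃ X : V × V' → ℝ, IsWeightCoupling p p' X ∧
      CutLE X (fun z w => A z.1 w.1 - A' z.2 w.2) (η + η') := by
  classical
  -- the joint distribution in which the two sides are conditionally independent given `i`
  set τ : (V × V') × I → ℝ := fun z => ρ (z.1.1, z.2) * ρ' (z.1.2, z.2) / q z.2 with hτ
  have hτ0 : ∀ z, 0 ≤ τ z := fun z =>
    div_nonneg (mul_nonneg (hρ.nonneg _) (hρ'.nonneg _)) (hq _).le
  have e1 : (fun z : V × I => ∑ x : (V × V') × I with (x.1.1, x.2) = z, τ x) = ρ := by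
    funext z
    obtain ⟨v, i⟩ := z
    rw [Finset.sum_filter, Fintype.sum_prod_type, Fintype.sum_prod_type]
    rw [Finset.sum_eq_single v]
    · simp only [Prod.mk.injEq, true_and, Finset.sum_ite_eq', Finset.mem_univ, if_true, hτ]
      rw [← Finset.sum_div, ← Finset.mul_sum, hρ'.sum_left, mul_div_assoc, div_self (hq i).ne',
        mul_one]
    · simp +contextual
    · simp
  have e2 : (fun z : V' × I => ∑ x : (V × V') × I with (x.1.2, x.2) = z, τ x) = ρ' := by
    funext z
    obtain ⟨v, i⟩ := z
    rw [Finset.sum_filter, Fintype.sum_prod_type, Fintype.sum_prod_type, Finset.sum_comm]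
    rw [Finset.sum_eq_single v]
    · simp only [Prod.mk.injEq, true_and, Finset.sum_ite_eq', Finset.mem_univ, if_true, hτ]
      rw [← Finset.sum_div, ← Finset.sum_mul, hρ.sum_left, mul_div_assoc, mul_comm,
        div_mul_cancel₀ _ (hq i).ne']
    · simp +contextual
    · simp
  have c1 : CutLE τ (fun z w => A z.1.1 w.1.1 - H z.2 w.2) η :=
    CutLE.comap (B := fun z w : V × I => A z.1 w.1 - H z.2 w.2)
      (fun x : (V × V') × I => (x.1.1, x.2)) (by rw [e1]; exact h)
  have c2 : CutLE τ (fun z w => A' z.1.2 w.1.2 - H z.2 w.2) η' :=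
    CutLE.comap (B := fun z w : V' × I => A' z.1 w.1 - H z.2 w.2)
      (fun x : (V × V') × I => (x.1.2, x.2)) (by rw [e2]; exact h')
  have c3 : CutLE τ (fun z w => A z.1.1 w.1.1 - A' z.1.2 w.1.2) (η + η') := by
    convert c1.add c2.neg using 3
    ring
  have e3 : (fun j => ∑ z : (V × V') × I with z.1 = j, τ z) = fun j => ∑ i, τ (j, i) := by
    funext j
    rw [Finset.sum_filter, Fintype.sum_prod_type, Finset.sum_eq_single j] <;> simp +contextual
  have c4 := CutLE.map (B := fun z w : V × V' => A z.1 w.1 - A' z.2 w.2) Prod.fst hτ0 c3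
  rw [e3] at c4
  refine ⟨_, ⟨fun z => Finset.sum_nonneg fun _ _ => hτ0 _, fun v => ?_, fun u => ?_⟩, c4⟩
  · rw [Finset.sum_comm, ← hρ.sum_right v]
    refine Finset.sum_congr rfl fun i _ => ?_
    simp only [hτ]
    rw [← Finset.sum_div, ← Finset.mul_sum, hρ'.sum_left, mul_div_assoc, div_self (hq i).ne',
      mul_one]
  · rw [Finset.sum_comm, ← hρ'.sum_right u]
    refine Finset.sum_congr rfl fun i _ => ?_
    simp only [hτ]
    rw [← Finset.sum_div, ← Finset.sum_mul, hρ.sum_left, mul_div_assoc, mul_comm,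
      div_mul_cancel₀ _ (hq i).ne']

/-- Two finite probability spaces with a colouring can be coupled so that the colours disagree
with probability at most the total difference between the two colour distributions. -/
theorem exists_coupling_of_colors {C : Type*} [Fintype C] [DecidableEq C]
    (hp : IsProbVec p) (hq : IsProbVec q) (χ : V → C) (ψ : V' → C) :
    ∃ ρ : V × V' → ℝ, IsWeightCoupling p q ρ ∧
      ∑ z, (if χ z.1 = ψ z.2 then 0 else ρ z) ≤
        ∑ c, |∑ v with χ v = c, p v - ∑ u with ψ u = c, q u| := by
  classical
  set α : C → ℝ := fun c => ∑ v with χ v = c, p v with hα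
  set β : C → ℝ := fun c => ∑ u with ψ u = c, q u with hβ
  set m : C → ℝ := fun c => min (α c) (β c) with hm
  have hα0 : ∀ c, 0 ≤ α c := fun c => Finset.sum_nonneg fun v _ => hp.nonneg v
  have hβ0 : ∀ c, 0 ≤ β c := fun c => Finset.sum_nonneg fun v _ => hq.nonneg v
  have hm0 : ∀ c, 0 ≤ m c := fun c => le_min (hα0 c) (hβ0 c)
  -- the weights left over after matching equal colours as far as possible
  set r : V → ℝ := fun v => p v - p v / α (χ v) * m (χ v) with hr
  set r' : V' → ℝ := fun u => q u - q u / β (ψ u) * m (ψ u) with hr'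
  have hr0 : ∀ v, 0 ≤ r v := by
    intro v
    have : p v / α (χ v) * m (χ v) ≤ p v / α (χ v) * α (χ v) :=
      mul_le_mul_of_nonneg_left (min_le_left _ _) (div_nonneg (hp.nonneg v) (hα0 _))
    have h2 : p v / α (χ v) * α (χ v) ≤ p v := by
      rw [div_mul_eq_mul_div, mul_div_assoc]
      exact mul_le_of_le_one_right (hp.nonneg v) (div_self_le_one _)
    exact sub_nonneg.2 (this.trans h2)
  have hr'0 : ∀ v, 0 ≤ r' v := by
    intro v
    have : q v / β (ψ v) * m (ψ v) ≤ q v / β (ψ v) * β (ψ v) :=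
      mul_le_mul_of_nonneg_left (min_le_right _ _) (div_nonneg (hq.nonneg v) (hβ0 _))
    have h2 : q v / β (ψ v) * β (ψ v) ≤ q v := by
      rw [div_mul_eq_mul_div, mul_div_assoc]
      exact mul_le_of_le_one_right (hq.nonneg v) (div_self_le_one _)
    exact sub_nonneg.2 (this.trans h2)
  have hcol : ∀ c, (∑ v with χ v = c, p v / α (χ v)) * m c = m c := by
    intro c
    have : ∀ v ∈ Finset.univ.filter (fun v => χ v = c), p v / α (χ v) = p v / α c :=
      fun v hv => by rw [(Finset.mem_filter.1 hv).2]
    rw [Finset.sum_congr rfl this, ← Finset.sum_div]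
    change α c / α c * m c = m c
    rcases (hα0 c).eq_or_lt with h | h
    · have : m c = 0 := le_antisymm ((min_le_left _ _).trans h.symm.le) (hm0 c)
      rw [this, mul_zero]
    · rw [div_self h.ne', one_mul]
  have hcol' : ∀ c, (∑ v with ψ v = c, q v / β (ψ v)) * m c = m c := by
    intro c
    have : ∀ v ∈ Finset.univ.filter (fun v => ψ v = c), q v / β (ψ v) = q v / β c :=
      fun v hv => by rw [(Finset.mem_filter.1 hv).2]
    rw [Finset.sum_congr rfl this, ← Finset.sum_div]
    change β c / β c * m c = m c
    rcases (hβ0 c).eq_or_lt with h | h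
    · have : m c = 0 := le_antisymm ((min_le_right _ _).trans h.symm.le) (hm0 c)
      rw [this, mul_zero]
    · rw [div_self h.ne', one_mul]
  set R : ℝ := 1 - ∑ c, m c with hR
  have hrR : ∑ v, r v = R := by
    simp only [hr, Finset.sum_sub_distrib, hp.sum_eq_one]
    rw [sum_fiberwise_mul χ (fun v => p v / α (χ v)) m]
    simp only [hcol, hR]
  have hr'R : ∑ v, r' v = R := by
    simp only [hr', Finset.sum_sub_distrib, hq.sum_eq_one]
    rw [sum_fiberwise_mul ψ (fun v => q v / β (ψ v)) m]
    simp only [hcol', hR]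
  have hR0 : 0 ≤ R := hrR ▸ Finset.sum_nonneg fun v _ => hr0 v
  have hαsum : ∑ c, α c = 1 := by
    rw [← hp.sum_eq_one]; exact Finset.sum_fiberwise Finset.univ χ p
  have hRle : R ≤ ∑ c, |α c - β c| := by
    rw [hR, ← hαsum, ← Finset.sum_sub_distrib]
    refine Finset.sum_le_sum fun c _ => ?_
    rcases min_cases (α c) (β c) with h | h
    · rw [hm]; simp only [h.1, sub_self]; exact abs_nonneg _
    · rw [hm]; simp only [h.1]; exact le_abs_self _
  -- if `R = 0` then `R / R = 0`, but then there is nothing left over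
  have hrdiv : ∀ v, r v * (R / R) = r v := by
    intro v
    rcases hR0.eq_or_lt with h | h
    · have := (Finset.sum_eq_zero_iff_of_nonneg (fun v _ => hr0 v)).1 (hrR.trans h.symm) v
        (Finset.mem_univ v)
      rw [this, zero_mul]
    · rw [div_self h.ne', mul_one]
  have hr'div : ∀ v, r' v * (R / R) = r' v := by
    intro v
    rcases hR0.eq_or_lt with h | h
    · have := (Finset.sum_eq_zero_iff_of_nonneg (fun v _ => hr'0 v)).1 (hr'R.trans h.symm) v
        (Finset.mem_univ v)
      rw [this, zero_mul]
    · rw [div_self h.ne', mul_one]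
  -- `σ` matches equal colours; the leftovers, of total weight `R`, are coupled independently
  set σ : V × V' → ℝ := fun z =>
    if ψ z.2 = χ z.1 then p z.1 / α (χ z.1) * (q z.2 / β (ψ z.2) * m (χ z.1)) else 0 with hσ
  have hσ0 : ∀ z, 0 ≤ σ z := by
    intro z
    simp only [hσ]
    split_ifs
    · exact mul_nonneg (div_nonneg (hp.nonneg _) (hα0 _))
        (mul_nonneg (div_nonneg (hq.nonneg _) (hβ0 _)) (hm0 _))
    · exact le_rfl
  have hres0 : ∀ z : V × V', 0 ≤ r z.1 * r' z.2 / R := fun z =>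
    div_nonneg (mul_nonneg (hr0 _) (hr'0 _)) hR0
  refine ⟨fun z => σ z + r z.1 * r' z.2 / R, ⟨fun z => add_nonneg (hσ0 z) (hres0 z), ?_, ?_⟩, ?_⟩
  · intro v
    rw [Finset.sum_add_distrib, ← Finset.sum_div]
    dsimp only
    rw [← Finset.mul_sum, hr'R, mul_div_assoc, hrdiv]
    simp only [hσ]
    rw [← Finset.sum_filter, ← Finset.mul_sum, ← Finset.sum_mul, hcol']
    simp only [hr]; ring
  · intro u
    rw [Finset.sum_add_distrib, ← Finset.sum_div]
    dsimp only
    rw [← Finset.sum_mul, hrR, mul_comm R, mul_div_assoc, hr'div]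
    have : ∀ v, σ (v, u) = if χ v = ψ u then
        p v / α (χ v) * (q u / β (ψ u) * m (ψ u)) else 0 := by
      intro v
      simp only [hσ, eq_comm (a := ψ u)]
      split_ifs with h
      · rw [h]
      · rfl
    simp only [this]
    rw [← Finset.sum_filter, ← Finset.sum_mul, mul_left_comm, hcol]
    simp only [hr']; ring
  · calc _ ≤ ∑ z : V × V', r z.1 * r' z.2 / R := by
          refine Finset.sum_le_sum fun z _ => ?_
          split_ifs with h
          · exact hres0 z
          · simp only [hσ]
            rw [if_neg (fun h' => h h'.symm), zero_add]
      _ = R := by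
          rw [Fintype.sum_prod_type]
          simp only [← Finset.sum_div, ← Finset.mul_sum, ← Finset.sum_mul, hrR, hr'R]
          rcases hR0.eq_or_lt with h | h
          · rw [← h]; simp
          · field_simp
      _ ≤ _ := hRle

end Coupling

/-! ### Random sign matrices -/

section RandomGraph

/-- The pairs `i < j`, that is, the potential edges of a graph on `Fin k`. -/
abbrev Edge (k : ℕ) : Type := {e : Fin k × Fin k // e.1 < e.2}

/-- The symmetric matrix with zero diagonal and signs `ω` off the diagonal: the `±1` adjacency
matrix of a graph on `Fin k`. -/
def signMatrix {k : ℕ} (ω : Edge k → Bool) (i j : Fin k) : ℝ :=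
  if h : i < j then sg (ω ⟨(i, j), h⟩) else if h : j < i then sg (ω ⟨(j, i), h⟩) else 0

/-- The probability of the sign pattern `ω` when the signs are independent and the sign of the
edge `ij` has mean `a i j`. -/
def edgeProb {k : ℕ} (a : Fin k → Fin k → ℝ) (ω : Edge k → Bool) : ℝ :=
  ∏ e : Edge k, (1 + sg (ω e) * a e.1.1 e.1.2) / 2

variable {k : ℕ}

theorem signMatrix_self (ω : Edge k → Bool) (i : Fin k) : signMatrix ω i i = 0 := by
  simp [signMatrix]

theorem signMatrix_fst_snd (ω : Edge k → Bool) (e : Edge k) :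
    signMatrix ω e.1.1 e.1.2 = sg (ω e) := by
  simp [signMatrix, e.2]

theorem signMatrix_snd_fst (ω : Edge k → Bool) (e : Edge k) :
    signMatrix ω e.1.2 e.1.1 = sg (ω e) := by
  simp [signMatrix, e.2, e.2.le]

theorem edgeProb_nonneg {a : Fin k → Fin k → ℝ} (ha : ∀ i j, |a i j| ≤ 1) (ω : Edge k → Bool) :
    0 ≤ edgeProb a ω := by
  refine Finset.prod_nonneg fun e _ => ?_
  have h := abs_le.1 (ha e.1.1 e.1.2)
  cases ω e <;> simp <;> linarith

theorem sum_edgeProb_mul_prod (a : Fin k → Fin k → ℝ) (f : Edge k → Bool → ℝ) :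
    ∑ ω, edgeProb a ω * ∏ e, f e (ω e) =
      ∏ e : Edge k, ∑ b, (1 + sg b * a e.1.1 e.1.2) / 2 * f e b := by
  rw [Finset.prod_univ_sum, Fintype.piFinset_univ]
  simp only [edgeProb, Finset.prod_mul_distrib]

theorem sum_edgeProb (a : Fin k → Fin k → ℝ) : ∑ ω, edgeProb a ω = 1 := by
  have := sum_edgeProb_mul_prod a (fun _ _ => 1)
  simp only [Finset.prod_const_one, mul_one] at this
  rw [this]
  refine Finset.prod_eq_one fun e _ => ?_
  simp only [Fintype.sum_bool, sg_true, sg_false]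
  ring

theorem sum_offDiag_eq_sum_edge (B : Fin k → Fin k → ℝ) :
    ∑ i, ∑ j, (if i = j then 0 else B i j) =
      ∑ e : Edge k, (B e.1.1 e.1.2 + B e.1.2 e.1.1) := by
  have h1 : ∑ e : Edge k, (B e.1.1 e.1.2 + B e.1.2 e.1.1) =
      ∑ z : Fin k × Fin k with z.1 < z.2, (B z.1 z.2 + B z.2 z.1) :=
    (Finset.sum_subtype _ (by simp) (fun z : Fin k × Fin k => B z.1 z.2 + B z.2 z.1)).symm
  rw [h1, Finset.sum_filter, Fintype.sum_prod_type]
  have h2 : ∀ i j : Fin k, (if i < j then B i j + B j i else 0) =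
      (if i < j then B i j else 0) + (if i < j then B j i else 0) := by
    intro i j; split_ifs <;> simp
  simp only [h2, Finset.sum_add_distrib]
  rw [Finset.sum_comm (f := fun i j => if i < j then B j i else 0), ← Finset.sum_add_distrib]
  refine Finset.sum_congr rfl fun i _ => ?_
  rw [← Finset.sum_add_distrib]
  refine Finset.sum_congr rfl fun j _ => ?_
  rcases lt_trichotomy i j with h | h | h
  · simp [h, h.ne, h.le]
  · simp [h]
  · simp [h, h.ne', h.le]

/-- The moment generating function of a centred sign. -/
theorem sum_sign_exp_le {a c : ℝ} (ha : |a| ≤ 1) (hc : |c| ≤ 1 / 2) :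
    ∑ b, (1 + sg b * a) / 2 * Real.exp (c * (sg b - a)) ≤ Real.exp (c ^ 2) := by
  have ha' := abs_le.1 ha
  have hexp : ∀ b, Real.exp (c * (sg b - a)) ≤ 1 + c * (sg b - a) + (c * (sg b - a)) ^ 2 := by
    intro b
    have h2 : |sg b - a| ≤ 2 := by
      have := abs_sub (sg b) a
      rw [abs_sg] at this
      linarith
    have h1 : |c * (sg b - a)| ≤ 1 := by
      rw [abs_mul]
      calc |c| * |sg b - a| ≤ 1 / 2 * 2 := by gcongr
        _ = 1 := by norm_num
    have := (abs_le.1 (Real.abs_exp_sub_one_sub_id_le h1)).2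
    linarith
  calc _ ≤ ∑ b, (1 + sg b * a) / 2 * (1 + c * (sg b - a) + (c * (sg b - a)) ^ 2) := by
        refine Finset.sum_le_sum fun b _ => mul_le_mul_of_nonneg_left (hexp b) ?_
        cases b <;> simp <;> linarith
    _ = 1 + c ^ 2 * (1 - a ^ 2) := by
        simp only [Fintype.sum_bool, sg_true, sg_false]; ring
    _ ≤ 1 + c ^ 2 := by nlinarith [mul_nonneg (sq_nonneg c) (sq_nonneg a)]
    _ ≤ _ := by linarith [Real.add_one_le_exp (c ^ 2)]

/-- The `∞ → 1` norm of a centred random sign matrix is of lower order. The maximum over the `4 ^ k`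
choices of signs is controlled by exponential moments. -/
theorem sum_edgeProb_iSup_le (hk : 16 ≤ k) (a : Fin k → Fin k → ℝ) (ha : ∀ i j, |a i j| ≤ 1)
    (hsymm : ∀ i j, a i j = a j i) :
    ∑ ω, edgeProb a ω * (⨆ st : (Fin k → Bool) × (Fin k → Bool), ∑ i, ∑ j,
      (if i = j then 0 else sg (st.1 i) * sg (st.2 j) * (signMatrix ω i j - a i j))) ≤
      7 * k * Real.sqrt k := by
  classical
  have hk0 : (16 : ℝ) ≤ k := by exact_mod_cast hk
  have hsk : 4 ≤ Real.sqrt k := by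
    rw [show (4 : ℝ) = Real.sqrt 16 by rw [show (16 : ℝ) = 4 ^ 2 by norm_num]; simp]
    exact Real.sqrt_le_sqrt hk0
  have hsq : Real.sqrt k * Real.sqrt k = k := Real.mul_self_sqrt (by linarith)
  set l : ℝ := 1 / Real.sqrt k with hl
  have hl0 : 0 < l := by positivity
  have hl4 : l ≤ 1 / 4 := by rw [hl]; gcongr
  have hlk : l ^ 2 * k = 1 := by
    rw [hl, div_pow, one_pow, Real.sq_sqrt (by linarith), one_div,
      inv_mul_cancel₀ (by linarith)]
  set Z : (Fin k → Bool) × (Fin k → Bool) → (Edge k → Bool) → ℝ := fun st ω => ∑ i, ∑ j,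
      (if i = j then 0 else sg (st.1 i) * sg (st.2 j) * (signMatrix ω i j - a i j)) with hZ
  set c : (Fin k → Bool) × (Fin k → Bool) → Edge k → ℝ := fun st e =>
    l * (sg (st.1 e.1.1) * sg (st.2 e.1.2) + sg (st.1 e.1.2) * sg (st.2 e.1.1)) with hc
  have hc2 : ∀ st e, |c st e| ≤ 2 * l := by
    intro st e
    simp only [hc]
    rw [abs_mul, abs_of_pos hl0, mul_comm]
    refine mul_le_mul_of_nonneg_right ((abs_add_le _ _).trans ?_) hl0.le
    rw [abs_mul, abs_mul, abs_sg, abs_sg, abs_sg, abs_sg]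
    norm_num
  have hZc : ∀ st ω, l * Z st ω = ∑ e, c st e * (sg (ω e) - a e.1.1 e.1.2) := by
    intro st ω
    simp only [hZ]
    rw [sum_offDiag_eq_sum_edge, Finset.mul_sum]
    refine Finset.sum_congr rfl fun e _ => ?_
    rw [signMatrix_fst_snd, signMatrix_snd_fst, hsymm e.1.2 e.1.1]
    simp only [hc]
    ring
  have hcard : (Fintype.card (Edge k) : ℝ) ≤ k ^ 2 := by
    have : Fintype.card (Edge k) ≤ Fintype.card (Fin k × Fin k) := Fintype.card_subtype_le _
    rw [Fintype.card_prod, Fintype.card_fin, ← sq] at this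
    exact_mod_cast this
  -- exponential moments of a single form; the scale `l = 1/√k` makes the exponent linear in `k`
  have hmgf : ∀ st, ∑ ω, edgeProb a ω * Real.exp (l * Z st ω) ≤ Real.exp (4 * k) := by
    intro st
    simp only [hZc, Real.exp_sum]
    rw [sum_edgeProb_mul_prod a (fun e b => Real.exp (c st e * (sg b - a e.1.1 e.1.2)))]
    calc _ ≤ ∏ e : Edge k, Real.exp (4 * l ^ 2) := by
          refine Finset.prod_le_prod (fun e _ => ?_) (fun e _ => ?_)
          · have h := abs_le.1 (ha e.1.1 e.1.2)
            refine Finset.sum_nonneg fun b _ => mul_nonneg ?_ (Real.exp_pos _).le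
            cases b <;> simp <;> linarith
          · refine (sum_sign_exp_le (ha _ _) ((hc2 st e).trans (by linarith))).trans ?_
            refine Real.exp_le_exp.2 ?_
            rw [← sq_abs]
            calc |c st e| ^ 2 ≤ (2 * l) ^ 2 := pow_le_pow_left₀ (abs_nonneg _) (hc2 st e) 2
              _ = _ := by ring
      _ = Real.exp (Fintype.card (Edge k) * (4 * l ^ 2)) := by
          rw [Finset.prod_const, ← Real.exp_nat_mul, Finset.card_univ]
      _ ≤ _ := by
          refine Real.exp_le_exp.2 ?_
          calc _ ≤ (k : ℝ) ^ 2 * (4 * l ^ 2) := by gcongr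
            _ = 4 * k * (l ^ 2 * k) := by ring
            _ = 4 * k := by rw [hlk, mul_one]
  have h4 : (4 : ℝ) ^ k ≤ Real.exp (2 * k) := by
    have h1 : (2 : ℝ) ≤ Real.exp 1 := by linarith [Real.add_one_le_exp 1]
    have h2 : (4 : ℝ) ≤ Real.exp 2 := by
      calc (4 : ℝ) = 2 * 2 := by norm_num
        _ ≤ Real.exp 1 * Real.exp 1 := by gcongr
        _ = Real.exp 2 := by rw [← Real.exp_add]; norm_num
    calc (4 : ℝ) ^ k ≤ Real.exp 2 ^ k := by gcongr
      _ = _ := by rw [← Real.exp_nat_mul, mul_comm]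
  -- the maximum is at most the threshold `6k/l`, which beats the `4 ^ k` choices of signs, plus an
  -- exponential excess, by `x ≤ exp x`
  have hmax : ∀ ω, (⨆ st, Z st ω) ≤
      6 * k / l + 1 / l * ∑ st, Real.exp (l * Z st ω) * Real.exp (-(6 * k)) := by
    intro ω
    refine ciSup_le fun st => ?_
    have h1 : Real.exp (l * Z st ω) * Real.exp (-(6 * k)) ≤
        ∑ st, Real.exp (l * Z st ω) * Real.exp (-(6 * k)) :=
      Finset.single_le_sum (f := fun st => Real.exp (l * Z st ω) * Real.exp (-(6 * k)))
        (fun _ _ => by positivity) (Finset.mem_univ st)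
    have h2 : l * Z st ω - 6 * k ≤ Real.exp (l * Z st ω) * Real.exp (-(6 * k)) := by
      rw [← Real.exp_add, ← sub_eq_add_neg]
      linarith [Real.add_one_le_exp (l * Z st ω - 6 * k)]
    have h3 : Z st ω = 6 * k / l + 1 / l * (l * Z st ω - 6 * k) := by
      field_simp; ring
    rw [h3]
    gcongr
    exact h2.trans h1
  calc _ ≤ ∑ ω, edgeProb a ω *
        (6 * k / l + 1 / l * ∑ st, Real.exp (l * Z st ω) * Real.exp (-(6 * k))) :=
        Finset.sum_le_sum fun ω _ =>
          mul_le_mul_of_nonneg_left (hmax ω) (edgeProb_nonneg ha ω)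
    _ = 6 * k / l + 1 / l * Real.exp (-(6 * k)) *
          ∑ st, ∑ ω, edgeProb a ω * Real.exp (l * Z st ω) := by
        simp only [mul_add, Finset.sum_add_distrib]
        rw [← Finset.sum_mul, sum_edgeProb, one_mul]
        congr 1
        rw [Finset.sum_comm, Finset.mul_sum]
        refine Finset.sum_congr rfl fun ω _ => ?_
        simp only [Finset.mul_sum]
        exact Finset.sum_congr rfl fun _ _ => by ring
    _ ≤ 6 * k / l + 1 / l * Real.exp (-(6 * k)) *
          ∑ st : (Fin k → Bool) × (Fin k → Bool), Real.exp (4 * k) := by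
        gcongr with st _
        exact hmgf st
    _ = 6 * k / l + 1 / l * (4 ^ k * Real.exp (-(2 * k))) := by
        rw [Finset.sum_const, Finset.card_univ, nsmul_eq_mul, Fintype.card_prod,
          Fintype.card_fun, Fintype.card_bool, Fintype.card_fin]
        have : Real.exp (-(6 * k : ℝ)) * Real.exp (4 * k) = Real.exp (-(2 * k)) := by
          rw [← Real.exp_add]; ring_nf
        rw [← this]
        push_cast
        rw [← mul_pow]
        norm_num
        ring
    _ ≤ 6 * k / l + 1 / l * (Real.exp (2 * k) * Real.exp (-(2 * k))) := by gcongr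
    _ = (6 * k + 1) * Real.sqrt k := by
        rw [← Real.exp_add, add_neg_cancel, Real.exp_zero, hl]
        field_simp
    _ ≤ _ := by nlinarith

end RandomGraph

section ColorCounts

variable {V : Type*} [Fintype V] {p : V → ℝ}

/-- The colour frequencies of a random sample are close to the colour distribution; `l` is a
free parameter. -/
theorem iidE_color_le (hp : IsProbVec p) {C : Type*} [Fintype C] [DecidableEq C] (χ : V → C)
    {k : ℕ} (hk : 0 < k) {l : ℝ} (hl : 0 < l) :
    iidE p k (fun y => ∑ c, |∑ v with χ v = c, p v - ∑ i with χ (y i) = c, 1 / (k : ℝ)|) ≤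
      (1 / l + Fintype.card C * l / k) / 2 := by
  have hk0 : (0 : ℝ) < k := by exact_mod_cast hk
  set α : C → ℝ := fun c => ∑ v with χ v = c, p v with hα
  have hαe : ∀ c, ∑ v, p v * (if χ v = c then 1 else 0) = α c := by
    intro c; simp [hα, Finset.sum_filter]
  have hone : ∀ c, iidE p k (fun y => |α c - ∑ i with χ (y i) = c, 1 / (k : ℝ)|) ≤
      1 / k * ((k * α c / l + l) / 2) := by
    intro c
    have h0 : ∑ v, p v * ((if χ v = c then 1 else 0) - α c) = 0 := by
      simp only [mul_sub, Finset.sum_sub_distrib, hαe, ← Finset.sum_mul, hp.sum_eq_one]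
      ring
    have h2 : ∑ v, p v * ((if χ v = c then 1 else 0) - α c) ^ 2 ≤ α c := by
      have : ∀ v, p v * ((if χ v = c then 1 else 0) - α c) ^ 2 =
          (1 - 2 * α c) * (p v * (if χ v = c then 1 else 0)) + α c ^ 2 * p v := by
        intro v; split_ifs <;> ring
      simp only [this, Finset.sum_add_distrib, ← Finset.mul_sum, hαe, hp.sum_eq_one]
      nlinarith [sq_nonneg (α c)]
    have h := iidE_abs_sum_le hp (fun v => (if χ v = c then 1 else 0) - α c) h0 h2 k hl
    calc _ = 1 / k * iidE p k (fun y => |∑ j, ((if χ (y j) = c then 1 else 0) - α c)|) := by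
          rw [← iidE_const_mul]
          congr 1
          funext y
          have : α c - ∑ i with χ (y i) = c, 1 / (k : ℝ) =
              -(1 / k * ∑ j, ((if χ (y j) = c then 1 else 0) - α c)) := by
            rw [Finset.sum_sub_distrib, Finset.sum_filter]
            simp only [Finset.sum_const, Finset.card_univ, Fintype.card_fin, nsmul_eq_mul]
            rw [mul_sub, Finset.mul_sum]
            simp only [mul_ite, mul_one, mul_zero]
            field_simp
            ring
          rw [this, abs_neg, abs_mul, abs_of_pos (by positivity)]
      _ ≤ _ := by gcongr
  rw [iidE_sum]
  refine (Finset.sum_le_sum fun c _ => hone c).trans (le_of_eq ?_)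
  have hαsum : ∑ c, α c = 1 := by
    rw [← hp.sum_eq_one]; exact Finset.sum_fiberwise Finset.univ χ p
  have : ∀ c, 1 / (k : ℝ) * ((k * α c / l + l) / 2) = 1 / (2 * l) * α c + l / (2 * k) := by
    intro c; field_simp
  simp only [this, Finset.sum_add_distrib, ← Finset.mul_sum, hαsum, Finset.sum_const,
    Finset.card_univ, nsmul_eq_mul]
  field_simp

end ColorCounts

/-! ### Overlaying a kernel with its random sample -/

section SampleOverlay

variable {V : Type*} [Fintype V] {p : V → ℝ} {k : ℕ}

/-- The `∞ → 1` norm of a matrix off the diagonal. -/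
def offDiagNorm (B : Fin k → Fin k → ℝ) : ℝ :=
  ⨆ st : (Fin k → Bool) × (Fin k → Bool),
    ∑ i, ∑ j, (if i = j then 0 else sg (st.1 i) * sg (st.2 j) * B i j)

theorem cutLE_offDiag (B : Fin k → Fin k → ℝ) :
    CutLE (fun _ => 1 / (k : ℝ)) (fun i j => if i = j then 0 else B i j)
      (1 / (k : ℝ) ^ 2 * offDiagNorm B) := by
  refine cutLE_of_signs fun s t => ?_
  calc _ = 1 / (k : ℝ) ^ 2 * ∑ i, ∑ j, (if i = j then 0 else sg (s i) * sg (t j) * B i j) := by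
        simp only [Finset.mul_sum]
        refine Finset.sum_congr rfl fun i _ => Finset.sum_congr rfl fun j _ => ?_
        split_ifs
        · simp
        · rw [sq]; field_simp
    _ ≤ _ := by
        gcongr
        exact le_ciSup_finite (fun st : (Fin k → Bool) × (Fin k → Bool) =>
          ∑ i, ∑ j, (if i = j then 0 else sg (st.1 i) * sg (st.2 j) * B i j)) (s, t)

theorem cutLE_diag (hk : 0 < k) {f : Fin k → Fin k → ℝ} {M : ℝ} (hf : ∀ i j, |f i j| ≤ M) :
    CutLE (fun _ => 1 / (k : ℝ)) (fun i j => if i = j then f i j else 0) (M / k) := by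
  have hk0 : (0 : ℝ) < k := by exact_mod_cast hk
  refine cutLE_of_sum_abs_le ?_
  calc _ = ∑ i : Fin k, 1 / (k : ℝ) * (1 / k) * |f i i| := by
        refine Finset.sum_congr rfl fun i _ => ?_
        rw [Finset.sum_eq_single i]
        · simp
        · intro j _ h; simp [h.symm]
        · simp
    _ ≤ ∑ i : Fin k, 1 / (k : ℝ) * (1 / k) * M := by
        gcongr with i _
        exact hf i i
    _ = _ := by
        rw [Finset.sum_const, Finset.card_univ, Fintype.card_fin, nsmul_eq_mul]
        field_simp

/-- The error in overlaying a kernel `A`, approximated by the step kernel `f` with colouring `χ`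
up to `N` in the `∞ → 1` norm, with the random graph `ω` on the sample `y`. The summands are the
errors of replacing `A` by `f`, of mismatched colours, of replacing `f` by `A` on the sample, of
rounding to the random graph, and of the diagonal. -/
def sampleError {C : Type*} [Fintype C] [DecidableEq C] (p : V → ℝ) (A f : V → V → ℝ)
    (χ : V → C) (M N : ℝ) (y : Fin k → V) (ω : Edge k → Bool) : ℝ :=
  N + 4 * M * (∑ c, |∑ v with χ v = c, p v - ∑ i with χ (y i) = c, 1 / (k : ℝ)|) +
    1 / (k : ℝ) ^ 2 * offDiagNorm (fun i j => A (y i) (y j) - f (y i) (y j)) +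
    1 / (k : ℝ) ^ 2 * offDiagNorm (fun i j => signMatrix ω i j - A (y i) (y j)) + M / k

theorem isProbVec_uniform (hk : 0 < k) : IsProbVec (fun _ : Fin k => 1 / (k : ℝ)) := by
  have hk0 : (0 : ℝ) < k := by exact_mod_cast hk
  refine ⟨fun _ => by positivity, ?_⟩
  rw [Finset.sum_const, Finset.card_univ, Fintype.card_fin, nsmul_eq_mul]
  field_simp

/-- Coupling the points of `V` with the sample points of the same colour overlays a kernel with a
random graph sampled from it. -/
theorem exists_sample_coupling (hp : IsProbVec p) {C : Type*} [Fintype C] [DecidableEq C]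
    {A f : V → V → ℝ} {χ : V → C}
    (hχ : ∀ v v' w w', χ v = χ v' → χ w = χ w' → f v w = f v' w') {M N : ℝ}
    (hf : ∀ v w, |f v w| ≤ M) (hN : CutLE p (fun v w => A v w - f v w) N) (hk : 0 < k)
    (y : Fin k → V) (ω : Edge k → Bool) :
    ∃ ρ : V × Fin k → ℝ, IsWeightCoupling p (fun _ => 1 / (k : ℝ)) ρ ∧
      CutLE ρ (fun z w => A z.1 w.1 - signMatrix ω z.2 w.2) (sampleError p A f χ M N y ω) := by
  classical
  obtain ⟨ρ, hρ, hmis⟩ := exists_coupling_of_colors hp (isProbVec_uniform hk) χ (fun i => χ (y i))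
  refine ⟨ρ, hρ, ?_⟩
  have hM0 : 0 ≤ M := (abs_nonneg _).trans (hf (y ⟨0, hk⟩) (y ⟨0, hk⟩))
  have hρ1 : ∑ z, ρ z = 1 := by
    rw [Fintype.sum_prod_type]
    simp only [hρ.sum_right, hp.sum_eq_one]
  -- along the chain `A`, `f`, `f` on the sample, `A` on the sample, random graph
  have c1 : CutLE ρ (fun z w => A z.1 w.1 - f z.1 w.1) N :=
    CutLE.comap (B := fun v w => A v w - f v w) Prod.fst (by rw [hρ.map_fst]; exact hN)
  have c2 : CutLE ρ (fun z w => f z.1 w.1 - f (y z.2) (y w.2))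
      (4 * M * (∑ c, |∑ v with χ v = c, p v - ∑ i with χ (y i) = c, 1 / (k : ℝ)|)) := by
    refine cutLE_of_sum_abs_le ?_
    set μ : V × Fin k → ℝ := fun z => if χ z.1 = χ (y z.2) then 0 else 1 with hμ
    have hμ0 : ∀ z, 0 ≤ μ z := fun z => by simp only [hμ]; split_ifs <;> simp
    have hpt : ∀ z w : V × Fin k, |f z.1 w.1 - f (y z.2) (y w.2)| ≤ 2 * M * (μ z + μ w) := by
      intro z w
      have h2 : |f z.1 w.1 - f (y z.2) (y w.2)| ≤ 2 * M := by
        have := abs_sub (f z.1 w.1) (f (y z.2) (y w.2))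
        linarith [hf z.1 w.1, hf (y z.2) (y w.2)]
      by_cases hz : χ z.1 = χ (y z.2)
      · by_cases hw : χ w.1 = χ (y w.2)
        · rw [hχ _ _ _ _ hz hw, sub_self, abs_zero]
          exact mul_nonneg (by positivity) (add_nonneg (hμ0 _) (hμ0 _))
        · have : μ w = 1 := by simp [hμ, hw]
          rw [this]; nlinarith [hμ0 z]
      · have : μ z = 1 := by simp [hμ, hz]
        rw [this]; nlinarith [hμ0 w]
    have hρμ : ∑ z, ρ z * μ z = ∑ z, (if χ z.1 = χ (y z.2) then 0 else ρ z) := by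
      refine Finset.sum_congr rfl fun z _ => ?_
      simp only [hμ]; split_ifs <;> simp
    calc _ ≤ ∑ z, ∑ w, ρ z * ρ w * (2 * M * (μ z + μ w)) := by
          refine Finset.sum_le_sum fun z _ => Finset.sum_le_sum fun w _ => ?_
          exact mul_le_mul_of_nonneg_left (hpt z w) (mul_nonneg (hρ.nonneg _) (hρ.nonneg _))
      _ = 4 * M * ∑ z, ρ z * μ z := by
          have : ∀ z w, ρ z * ρ w * (2 * M * (μ z + μ w)) =
              2 * M * (ρ z * μ z) * ρ w + 2 * M * ρ z * (ρ w * μ w) := fun z w => by ring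
          simp only [this, Finset.sum_add_distrib, ← Finset.mul_sum, hρ1, ← Finset.sum_mul]
          ring
      _ ≤ _ := by
          rw [hρμ]
          gcongr
  have cs : ∀ {B : Fin k → Fin k → ℝ} {η : ℝ}, CutLE (fun _ => 1 / (k : ℝ)) B η →
      CutLE ρ (fun z w => B z.2 w.2) η := fun {B η} h =>
    CutLE.comap (B := B) Prod.snd (by rw [hρ.map_snd]; exact h)
  have c3 := cs (cutLE_offDiag fun i j => A (y i) (y j) - f (y i) (y j)).neg
  have c4 := cs (cutLE_offDiag fun i j => signMatrix ω i j - A (y i) (y j)).neg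
  have c5 := cs (cutLE_diag hk (f := fun i j => f (y i) (y j)) fun i j => hf _ _)
  have := (((c1.add c2).add c3).add c4).add c5
  unfold sampleError
  convert this using 3 with z w
  by_cases h : z.2 = w.2
  · simp [h, signMatrix_self]
  · simp only [h, if_false]; ring

theorem sampleError_nonneg (hp : IsProbVec p) {C : Type*} [Fintype C] [DecidableEq C]
    {A f : V → V → ℝ} {χ : V → C}
    (hχ : ∀ v v' w w', χ v = χ v' → χ w = χ w' → f v w = f v' w') {M N : ℝ}
    (hf : ∀ v w, |f v w| ≤ M) (hN : CutLE p (fun v w => A v w - f v w) N) (hk : 0 < k)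
    (y : Fin k → V) (ω : Edge k → Bool) : 0 ≤ sampleError p A f χ M N y ω := by
  obtain ⟨ρ, hρ, h⟩ := exists_sample_coupling hp hχ hf hN hk y ω
  exact (abs_nonneg _).trans (h (fun _ => 0) (fun _ => 0) (fun z => by simpa using hρ.nonneg z)
    (fun z => by simpa using hρ.nonneg z))

theorem one_div_sq_mul_sqrt {x : ℝ} (hx : 0 < x) (c : ℝ) :
    1 / x ^ 2 * (c * x * Real.sqrt x) = c / Real.sqrt x := by
  have h := Real.mul_self_sqrt hx.le
  have h' := Real.sqrt_pos.2 hx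
  rw [div_mul_eq_mul_div, one_mul, div_eq_div_iff (by positivity) h'.ne']
  linear_combination c * x * h

/-- The expected overlay error of a random graph sampled from a kernel. -/
theorem iidE_sampleError_le (hp : IsProbVec p) {C : Type*} [Fintype C] [DecidableEq C]
    {A f : V → V → ℝ} (χ : V → C) {M N : ℝ} (hA : ∀ v w, |A v w| ≤ 1)
    (hsymm : ∀ v w, A v w = A w v)
    (hf : ∀ v w, |f v w| ≤ M) (hM : 0 ≤ M) (hN0 : 0 ≤ N)
    (hN : ∀ s t : V → Bool,
      ∑ v, ∑ w, p v * p w * (sg (s v) * sg (t w) * (A v w - f v w)) ≤ N)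
    (hk : 16 ≤ k) {l : ℝ} (hl : 0 < l) :
    iidE p k (fun y => ∑ ω, edgeProb (fun i j => A (y i) (y j)) ω *
      sampleError p A f χ M N y ω) ≤
      2 * N + 2 * M * (1 / l + Fintype.card C * l / k) + (16 * M + 23) / Real.sqrt k + M / k := by
  have hk0 : (16 : ℝ) ≤ k := by exact_mod_cast hk
  have hsq : Real.sqrt k * Real.sqrt k = k := Real.mul_self_sqrt (by linarith)
  have hsk : 0 < Real.sqrt k := Real.sqrt_pos.2 (by linarith)
  have hE : ∀ y : Fin k → V, ∑ ω, edgeProb (fun i j => A (y i) (y j)) ω *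
      sampleError p A f χ M N y ω ≤ (N + M / k + 7 / Real.sqrt k) +
      4 * M * (∑ c, |∑ v with χ v = c, p v - ∑ i with χ (y i) = c, 1 / (k : ℝ)|) +
      1 / (k : ℝ) ^ 2 * offDiagNorm (fun i j => A (y i) (y j) - f (y i) (y j)) := by
    intro y
    have h := sum_edgeProb_iSup_le hk (fun i j => A (y i) (y j)) (fun i j => hA _ _)
      (fun i j => hsymm _ _)
    have h2 : 1 / (k : ℝ) ^ 2 * ∑ ω, edgeProb (fun i j => A (y i) (y j)) ω *
        offDiagNorm (fun i j => signMatrix ω i j - A (y i) (y j)) ≤ 7 / Real.sqrt k := by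
      calc _ ≤ 1 / (k : ℝ) ^ 2 * (7 * k * Real.sqrt k) := by gcongr; exact h
        _ = _ := one_div_sq_mul_sqrt (by linarith) 7
    have h3 : ∀ ω, edgeProb (fun i j => A (y i) (y j)) ω * sampleError p A f χ M N y ω =
        edgeProb (fun i j => A (y i) (y j)) ω * ((N + M / k) +
        4 * M * (∑ c, |∑ v with χ v = c, p v - ∑ i with χ (y i) = c, 1 / (k : ℝ)|) +
        1 / (k : ℝ) ^ 2 * offDiagNorm (fun i j => A (y i) (y j) - f (y i) (y j))) +
        1 / (k : ℝ) ^ 2 * (edgeProb (fun i j => A (y i) (y j)) ω *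
        offDiagNorm (fun i j => signMatrix ω i j - A (y i) (y j))) := by
      intro ω
      unfold sampleError
      ring
    simp only [h3, Finset.sum_add_distrib, ← Finset.sum_mul, sum_edgeProb, one_mul,
      ← Finset.mul_sum]
    linarith
  have hD : ∀ v w, |A v w - f v w| ≤ M + 1 := fun v w => by
    have := abs_sub (A v w) (f v w)
    linarith [hA v w, hf v w]
  refine (iidE_mono hp.nonneg hE).trans ?_
  rw [iidE_add, iidE_add, iidE_const hp, iidE_const_mul, iidE_const_mul]
  have h1 := iidE_color_le hp χ (by omega : 0 < k) hl
  have h2 := iidE_offDiag_le hp (fun v w => A v w - f v w) (by linarith : 0 < M + 1) hN0 hD hN k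
  have h3 : 1 / (k : ℝ) ^ 2 * iidE p k (fun y =>
      offDiagNorm (fun i j => A (y i) (y j) - f (y i) (y j))) ≤
      N + 16 * (M + 1) / Real.sqrt k := by
    calc _ ≤ 1 / (k : ℝ) ^ 2 * (k ^ 2 * N + 16 * k * Real.sqrt k * (M + 1)) := by
          gcongr; exact h2
      _ = _ := by
        rw [mul_add]
        congr 1
        · field_simp
        · rw [← one_div_sq_mul_sqrt (by linarith : (0 : ℝ) < k) (16 * (M + 1))]
          ring
  have h4 := mul_le_mul_of_nonneg_left h1 (by positivity : 0 ≤ 4 * M)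
  have h5 : (16 * M + 23) / Real.sqrt k = 7 / Real.sqrt k + 16 * (M + 1) / Real.sqrt k := by
    rw [← add_div]; ring_nf
  rw [h5]
  linarith

end SampleOverlay

section Densities

variable {V : Type*} [Fintype V] {p : V → ℝ} {k : ℕ}

/-- The homomorphism density of the graph on `Fin k` with edge set `E`. -/
def edgeDensity (p : V → ℝ) (A : V → V → ℝ) (E : Finset (Edge k)) : ℝ :=
  iidE p k (fun y => ∏ e ∈ E, A (y e.1.1) (y e.1.2))

/-- The probability that the random graph sampled from `A` is `ω`. -/
def sampleProb (p : V → ℝ) (A : V → V → ℝ) (ω : Edge k → Bool) : ℝ :=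
  iidE p k (fun y => edgeProb (fun i j => A (y i) (y j)) ω)

/-- The sampling distribution is the Fourier transform of the densities: expand the product in
`edgeProb`. -/
theorem sampleProb_eq (A : V → V → ℝ) (ω : Edge k → Bool) :
    sampleProb p A ω = 1 / 2 ^ Fintype.card (Edge k) *
      ∑ E : Finset (Edge k), (∏ e ∈ E, sg (ω e)) * edgeDensity p A E := by
  have : ∀ y : Fin k → V, edgeProb (fun i j => A (y i) (y j)) ω =
      1 / 2 ^ Fintype.card (Edge k) *
      ∑ E : Finset (Edge k), (∏ e ∈ E, sg (ω e)) * ∏ e ∈ E, A (y e.1.1) (y e.1.2) := by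
    intro y
    unfold edgeProb
    rw [Finset.prod_div_distrib, Finset.prod_one_add, Finset.powerset_univ, Finset.prod_const,
      Finset.card_univ]
    simp only [Finset.prod_mul_distrib]
    ring
  unfold sampleProb
  simp only [this]
  rw [iidE_const_mul, iidE_sum]
  simp only [iidE_const_mul]
  rfl

theorem sum_sampleProb (hp : IsProbVec p) (A : V → V → ℝ) :
    ∑ ω : Edge k → Bool, sampleProb p A ω = 1 := by
  unfold sampleProb
  rw [← iidE_sum]
  simp only [sum_edgeProb, iidE_const hp]

/-- If the densities of all graphs on `k` nodes are close, so are the distributions of the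
sampled random graphs. -/
theorem sum_abs_sampleProb_sub_le {V' : Type*} [Fintype V'] {p' : V' → ℝ} {A : V → V → ℝ}
    {A' : V' → V' → ℝ} {δ : ℝ}
    (h : ∀ E : Finset (Edge k), |edgeDensity p A E - edgeDensity p' A' E| ≤ δ) :
    ∑ ω : Edge k → Bool, |sampleProb p A ω - sampleProb p' A' ω| ≤
      2 ^ Fintype.card (Edge k) * δ := by
  have : ∀ ω : Edge k → Bool, |sampleProb p A ω - sampleProb p' A' ω| ≤ δ := by
    intro ω
    rw [sampleProb_eq, sampleProb_eq, ← mul_sub, ← Finset.sum_sub_distrib, abs_mul,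
      abs_of_pos (by positivity)]
    calc _ ≤ 1 / 2 ^ Fintype.card (Edge k) * ∑ E : Finset (Edge k), δ := by
          gcongr
          refine (Finset.abs_sum_le_sum_abs _ _).trans (Finset.sum_le_sum fun E _ => ?_)
          rw [← mul_sub, abs_mul, Finset.abs_prod]
          simp only [abs_sg, Finset.prod_const_one, one_mul]
          exact h E
      _ = δ := by
          rw [Finset.sum_const, Finset.card_univ, Fintype.card_finset, nsmul_eq_mul]
          push_cast
          field_simp
  refine (Finset.sum_le_sum fun ω _ => this ω).trans (le_of_eq ?_)
  rw [Finset.sum_const, Finset.card_univ, Fintype.card_fun, Fintype.card_bool, nsmul_eq_mul]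
  push_cast
  rfl

end Densities

/-! ### Inverse counting on finite probability spaces -/

section FiniteInverse

variable {V V' : Type*} [Fintype V] [Fintype V'] {p : V → ℝ} {p' : V' → ℝ} {k : ℕ}

/-- A kernel bounded by `1` has overlays with its random samples whose average error is `2 / √n` up
to exponentially small terms, when `k ≥ 2 ^ (8 n)`: the approximation by `n` products of signs has
`4 ^ n` colours, far fewer than there are sample points. -/
theorem exists_overlay_error (hp : IsProbVec p) {A : V → V → ℝ} (hA : ∀ v w, |A v w| ≤ 1)
    (hsymm : ∀ v w, A v w = A w v) {n : ℕ} (hn : 1 ≤ n) (hk : 2 ^ (8 * n) ≤ k) :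
    ∃ b : (Edge k → Bool) → ℝ, (∀ ω, 0 ≤ b ω) ∧
      (∀ ω, ∃ ρ : V × Fin k → ℝ, IsWeightCoupling p (fun _ => 1 / (k : ℝ)) ρ ∧
        CutLE ρ (fun z w => A z.1 w.1 - signMatrix ω z.2 w.2) (b ω)) ∧
      ∑ ω, sampleProb p A ω * b ω ≤ 2 / Real.sqrt n + (21 * n + 23) * (1 / 8) ^ n := by
  classical
  have hV : Nonempty V := by
    by_contra h
    rw [not_nonempty_iff] at h
    simpa using hp.sum_eq_one
  have hk16 : 16 ≤ k := by
    calc 16 ≤ 2 ^ 8 := by norm_num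
      _ ≤ 2 ^ (8 * n) := Nat.pow_le_pow_right (by norm_num) (by omega)
      _ ≤ k := hk
  have hk0 : 0 < k := by omega
  obtain ⟨c, s, t, hc, hN⟩ := exists_weak_regularity hp A hA n hn
  set f : V → V → ℝ := fun v w => ∑ l, c l * (sg (s l v) * sg (t l w)) with hf
  set χ : V → (Fin n → Bool × Bool) := fun v l => (s l v, t l v) with hχ
  set N : ℝ := 1 / Real.sqrt n with hNdef
  have hN0 : 0 ≤ N := by positivity
  have hfχ : ∀ v v' w w', χ v = χ v' → χ w = χ w' → f v w = f v' w' := by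
    intro v v' w w' h h'
    refine Finset.sum_congr rfl fun l _ => ?_
    have h1 : s l v = s l v' := congrArg Prod.fst (congrFun h l)
    have h2 : t l w = t l w' := congrArg Prod.snd (congrFun h' l)
    rw [h1, h2]
  have hfn : ∀ v w, |f v w| ≤ n := by
    intro v w
    refine (Finset.abs_sum_le_sum_abs _ _).trans ?_
    calc _ ≤ ∑ l : Fin n, (1 : ℝ) := by
          refine Finset.sum_le_sum fun l _ => ?_
          rw [abs_mul, abs_mul, abs_sg, abs_sg, one_mul, mul_one]
          exact hc l
      _ = n := by simp
  have hcut : CutLE p (fun v w => A v w - f v w) N := cutLE_of_signs hN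
  -- for every graph, take the sample that fits it best
  have hb : ∀ ω, ∃ y : Fin k → V, ∀ y', sampleError p A f χ n N y ω ≤
      sampleError p A f χ n N y' ω := fun ω => Finite.exists_min _
  choose y hy using hb
  refine ⟨fun ω => sampleError p A f χ n N (y ω) ω,
    fun ω => sampleError_nonneg hp hfχ hfn hcut hk0 _ _,
    fun ω => exists_sample_coupling hp hfχ hfn hcut hk0 _ _, ?_⟩
  have hkR : (2 : ℝ) ^ (8 * n) ≤ k := by exact_mod_cast hk
  have hsk : (2 : ℝ) ^ (4 * n) ≤ Real.sqrt k := by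
    refine Real.le_sqrt_of_sq_le ?_
    rw [← pow_mul]
    calc (2 : ℝ) ^ (4 * n * 2) = 2 ^ (8 * n) := by congr 1; ring
      _ ≤ k := hkR
  have hsk0 : 0 < Real.sqrt k := lt_of_lt_of_le (by positivity) hsk
  have hsq : Real.sqrt k * Real.sqrt k = k := Real.mul_self_sqrt (Nat.cast_nonneg k)
  have h8 : (1 / 8 : ℝ) ^ n * 2 ^ (4 * n) = 2 ^ n := by
    rw [pow_mul, ← mul_pow]; norm_num
  have hinv : 1 / Real.sqrt k ≤ (1 / 8) ^ n := by
    rw [div_le_iff₀ hsk0]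
    calc (1 : ℝ) ≤ 2 ^ n := one_le_pow₀ (by norm_num)
      _ = (1 / 8) ^ n * 2 ^ (4 * n) := h8.symm
      _ ≤ _ := by gcongr
  have hinv2 : 2 ^ n / Real.sqrt k ≤ (1 / 8) ^ n := by
    rw [div_le_iff₀ hsk0, ← h8]
    gcongr
  calc _ ≤ iidE p k (fun y' => ∑ ω, edgeProb (fun i j => A (y' i) (y' j)) ω *
        sampleError p A f χ n N y' ω) := by
        rw [iidE_sum]
        refine Finset.sum_le_sum fun ω _ => ?_
        unfold sampleProb
        rw [mul_comm, ← iidE_const_mul]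
        refine iidE_mono hp.nonneg fun y' => ?_
        rw [mul_comm]
        exact mul_le_mul_of_nonneg_left (hy ω y') (edgeProb_nonneg (fun i j => hA _ _) ω)
    -- `l = √k / 2 ^ n` balances the two terms of the colour error, as there are `4 ^ n` colours
    _ ≤ 2 * N + 2 * n * (1 / (Real.sqrt k / 2 ^ n) +
          Fintype.card (Fin n → Bool × Bool) * (Real.sqrt k / 2 ^ n) / k) +
          (16 * n + 23) / Real.sqrt k + n / k :=
        iidE_sampleError_le hp χ hA hsymm hfn (Nat.cast_nonneg n) hN0 hN hk16 (by positivity)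
    _ = 2 / Real.sqrt n + 4 * n * (2 ^ n / Real.sqrt k) + (16 * n + 23) * (1 / Real.sqrt k) +
          n * (1 / Real.sqrt k * (1 / Real.sqrt k)) := by
        have h1 : (1 : ℝ) / (Real.sqrt k / 2 ^ n) = 2 ^ n / Real.sqrt k := by field_simp
        have h2 : (Fintype.card (Fin n → Bool × Bool) : ℝ) * (Real.sqrt k / 2 ^ n) / k =
            2 ^ n / Real.sqrt k := by
          rw [Fintype.card_fun, Fintype.card_prod, Fintype.card_bool, Fintype.card_fin]
          push_cast
          have h4 : (4 : ℝ) ^ n = 2 ^ n * 2 ^ n := by rw [← mul_pow]; norm_num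
          rw [div_eq_div_iff (by positivity) hsk0.ne', h4, mul_assoc, div_mul_eq_mul_div, hsq]
          field_simp
        have h3 : (n : ℝ) / k = n * (1 / Real.sqrt k * (1 / Real.sqrt k)) := by
          rw [div_mul_div_comm, hsq]; ring
        rw [h1, h2, h3, hNdef]
        ring
    _ ≤ 2 / Real.sqrt n + 4 * n * (1 / 8) ^ n + (16 * n + 23) * (1 / 8) ^ n +
          n * ((1 / 8) ^ n * 1) := by
        have h1 : 1 / Real.sqrt k ≤ 1 := hinv.trans (pow_le_one₀ (by norm_num) (by norm_num))
        gcongr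
    _ = _ := by ring

/-- Two kernels whose random samples have nearly the same distribution have a good overlay: some
graph `ω` is close to both, and the two overlays with `ω` can be glued. -/
theorem exists_overlay_of_sampleProb (hp : IsProbVec p) (hp' : IsProbVec p') {A : V → V → ℝ}
    {A' : V' → V' → ℝ} (hk : 0 < k)
    {b b' : (Edge k → Bool) → ℝ} (hb : ∀ ω, 0 ≤ b ω) (hb' : ∀ ω, 0 ≤ b' ω)
    (hρ : ∀ ω, ∃ ρ : V × Fin k → ℝ, IsWeightCoupling p (fun _ => 1 / (k : ℝ)) ρ ∧
        CutLE ρ (fun z w => A z.1 w.1 - signMatrix ω z.2 w.2) (b ω))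
    (hρ' : ∀ ω, ∃ ρ : V' × Fin k → ℝ, IsWeightCoupling p' (fun _ => 1 / (k : ℝ)) ρ ∧
        CutLE ρ (fun z w => A' z.1 w.1 - signMatrix ω z.2 w.2) (b' ω))
    {β β' θ B : ℝ} (hβ : ∑ ω, sampleProb p A ω * b ω ≤ β)
    (hβ' : ∑ ω, sampleProb p' A' ω * b' ω ≤ β')
    (hθ : ∑ ω : Edge k → Bool, |sampleProb p A ω - sampleProb p' A' ω| ≤ θ)
    (hA : ∀ v w, |A v w| ≤ 1) (hA' : ∀ v w, |A' v w| ≤ 1) (hB0 : 0 ≤ B)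
    (hB : β + β' < (1 - θ) * B) :
    ∃ X : V × V' → ℝ, IsWeightCoupling p p' X ∧
      CutLE X (fun z w => A z.1 w.1 - A' z.2 w.2) B := by
  have hkR : (0 : ℝ) < k := by exact_mod_cast hk
  have hω : ∃ ω, b ω + b' ω ≤ B := by
    by_contra! hcon
    -- compare the averages over the common part `min P P'` of the two distributions, of total mass
    -- at least `1 - θ`
    have hP : ∀ ω : Edge k → Bool, 0 ≤ sampleProb p A ω := fun ω =>
      Finset.sum_nonneg fun y _ => mul_nonneg (Finset.prod_nonneg fun _ _ => hp.nonneg _)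
        (edgeProb_nonneg (fun i j => hA _ _) ω)
    have hP' : ∀ ω : Edge k → Bool, 0 ≤ sampleProb p' A' ω := fun ω =>
      Finset.sum_nonneg fun y _ => mul_nonneg (Finset.prod_nonneg fun _ _ => hp'.nonneg _)
        (edgeProb_nonneg (fun i j => hA' _ _) ω)
    have h1 : ∀ ω, (sampleProb p A ω - |sampleProb p A ω - sampleProb p' A' ω|) * B ≤
        sampleProb p A ω * b ω + sampleProb p' A' ω * b' ω := by
      intro ω
      set P := sampleProb p A ω
      set P' := sampleProb p' A' ω
      set m := min P P' with hm
      have hm0 : 0 ≤ m := le_min (hP ω) (hP' ω)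
      have h2 : P - |P - P'| ≤ m := le_min (by linarith [abs_nonneg (P - P')])
        (by linarith [le_abs_self (P - P')])
      calc (P - |P - P'|) * B ≤ m * B := mul_le_mul_of_nonneg_right h2 hB0
        _ ≤ m * (b ω + b' ω) := mul_le_mul_of_nonneg_left (hcon ω).le hm0
        _ = m * b ω + m * b' ω := mul_add _ _ _
        _ ≤ _ := add_le_add (mul_le_mul_of_nonneg_right (min_le_left _ _) (hb ω))
            (mul_le_mul_of_nonneg_right (min_le_right _ _) (hb' ω))
    have h2 := Finset.sum_le_sum fun ω (_ : ω ∈ Finset.univ) => h1 ω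
    rw [← Finset.sum_mul, Finset.sum_sub_distrib, sum_sampleProb hp, Finset.sum_add_distrib] at h2
    have h3 := mul_le_mul_of_nonneg_right (sub_le_sub_left hθ 1) hB0
    linarith
  obtain ⟨ω, hω⟩ := hω
  obtain ⟨ρ, hρ1, hρ2⟩ := hρ ω
  obtain ⟨ρ', hρ1', hρ2'⟩ := hρ' ω
  obtain ⟨X, hX, hcut⟩ := exists_glued_coupling (fun _ => by positivity) hρ1 hρ1' hρ2 hρ2'
  exact ⟨X, hX, hcut.mono hω⟩

theorem isWeightCoupling_prod (hp : IsProbVec p) (hp' : IsProbVec p') :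
    IsWeightCoupling p p' (fun z => p z.1 * p' z.2) where
  nonneg z := mul_nonneg (hp.nonneg _) (hp'.nonneg _)
  sum_right v := by simp only [← Finset.mul_sum, hp'.sum_eq_one, mul_one]
  sum_left u := by simp only [← Finset.sum_mul, hp.sum_eq_one, one_mul]

theorem linear_mul_eighth_pow_le {n : ℕ} (hn : 15 ≤ n) :
    2 * (21 * n + 23) * (1 / 8 : ℝ) ^ n ≤ 1 / n := by
  have hn0 : (0 : ℝ) < n := by exact_mod_cast (by omega : 0 < n)
  have h : 2 * (21 * n + 23) * n ≤ 8 ^ n := by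
    have h2 : n ≤ 2 ^ n := Nat.lt_two_pow_self.le
    have h3 : 2 ^ 6 ≤ 2 ^ n := Nat.pow_le_pow_right (by norm_num) (by omega)
    calc 2 * (21 * n + 23) * n ≤ (2 ^ 6 * n) * n := Nat.mul_le_mul_right _ (by omega)
      _ ≤ (2 ^ n * 2 ^ n) * 2 ^ n := by gcongr
      _ = 8 ^ n := by rw [← mul_pow, ← mul_pow]; norm_num
  have h' : 2 * (21 * n + 23) * n ≤ (8 : ℝ) ^ n := by exact_mod_cast h
  rw [one_div_pow, mul_one_div, div_le_div_iff₀ (by positivity) hn0, one_mul]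
  exact h'

/-- The inverse counting lemma for kernels on finite probability spaces. The factor `2` in the
hypothesis leaves room for approximating arbitrary kernels by finite ones. -/
theorem exists_overlay_of_densities (hp : IsProbVec p) (hp' : IsProbVec p') {A : V → V → ℝ}
    {A' : V' → V' → ℝ} (hA : ∀ v w, |A v w| ≤ 1) (hA' : ∀ v w, |A' v w| ≤ 1)
    (hsymm : ∀ v w, A v w = A w v) (hsymm' : ∀ v w, A' v w = A' w v) (hk : 2 ≤ k)
    (h : ∀ E : Finset (Edge k),
      |edgeDensity p A E - edgeDensity p' A' E| ≤ 2 * (3 : ℝ) ^ (-((k : ℤ) ^ 2))) :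
    ∃ X : V × V' → ℝ, IsWeightCoupling p p' X ∧
      CutLE X (fun z w => A z.1 w.1 - A' z.2 w.2) (22 / Real.sqrt (Real.logb 2 k)) := by
  have hkR : (2 : ℝ) ≤ k := by exact_mod_cast hk
  have hL1 : 1 ≤ Real.logb 2 k := by
    rw [Real.le_logb_iff_rpow_le (by norm_num) (by linarith), Real.rpow_one]
    exact hkR
  have hsL : 0 < Real.sqrt (Real.logb 2 k) := Real.sqrt_pos.2 (by linarith)
  by_cases hbig : Real.logb 2 k ≤ 121
  · -- here the bound is at least `22 / 11 = 2`, which every overlay satisfies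
    have hX := isWeightCoupling_prod hp hp'
    refine ⟨_, hX, CutLE.mono (η := 2) (cutLE_of_sum_abs_le ?_) ?_⟩
    · have hX1 : ∑ z : V × V', p z.1 * p' z.2 = 1 := by
        rw [Fintype.sum_prod_type]
        simp only [← Finset.mul_sum, hp'.sum_eq_one, mul_one, hp.sum_eq_one]
      calc _ ≤ ∑ z : V × V', ∑ w : V × V', (p z.1 * p' z.2) * (p w.1 * p' w.2) * 2 := by
            refine Finset.sum_le_sum fun z _ => Finset.sum_le_sum fun w _ =>
              mul_le_mul_of_nonneg_left ?_ (mul_nonneg (hX.nonneg z) (hX.nonneg w))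
            linarith [abs_sub (A z.1 w.1) (A' z.2 w.2), hA z.1 w.1, hA' z.2 w.2]
        _ = 2 := by
            simp only [← Finset.sum_mul, ← Finset.mul_sum, hX1]
            norm_num
    · rw [le_div_iff₀ hsL]
      have : Real.sqrt (Real.logb 2 k) ≤ 11 := by
        rw [Real.sqrt_le_left (by norm_num)]
        linarith
      linarith
  · push Not at hbig
    -- the largest `n` with `2 ^ (8 n) ≤ k`, so that `logb 2 k ≤ 8 (n + 1)`, and `n ≥ 15`; then
    -- `√(logb 2 k) ≤ 2.93 √n`
    set n : ℕ := Nat.log 2 k / 8 with hn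
    have hk0 : k ≠ 0 := by omega
    have hkpow : 2 ^ (8 * n) ≤ k :=
      (Nat.pow_le_pow_right (by norm_num) (Nat.mul_div_le _ _)).trans (Nat.pow_log_le_self 2 hk0)
    have hlt : k < 2 ^ (8 * (n + 1)) := by
      refine (Nat.lt_pow_succ_log_self (by norm_num) k).trans_le
        (Nat.pow_le_pow_right (by norm_num) ?_)
      omega
    have hLn : Real.logb 2 k ≤ 8 * (n + 1) := by
      rw [Real.logb_le_iff_le_rpow (by norm_num) (by linarith)]
      have : (k : ℝ) ≤ 2 ^ (8 * (n + 1)) := by exact_mod_cast hlt.le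
      refine this.trans (le_of_eq ?_)
      rw [← Real.rpow_natCast]
      push_cast
      rfl
    have hn15 : 15 ≤ n := by
      have h1 : (121 : ℝ) < 8 * (n + 1) := hbig.trans_le hLn
      have h2 : 121 < 8 * (n + 1) := by exact_mod_cast h1
      omega
    have hn15R : (15 : ℝ) ≤ n := by exact_mod_cast hn15
    obtain ⟨b, hb, hρ, hβ⟩ := exists_overlay_error hp hA hsymm (by omega) hkpow
    obtain ⟨b', hb', hρ', hβ'⟩ := exists_overlay_error hp' hA' hsymm' (by omega) hkpow
    have hcard : Fintype.card (Edge k) ≤ k ^ 2 := by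
      have : Fintype.card (Edge k) ≤ Fintype.card (Fin k × Fin k) := Fintype.card_subtype_le _
      rwa [Fintype.card_prod, Fintype.card_fin, ← sq] at this
    have hθ : (2 : ℝ) ^ Fintype.card (Edge k) * (2 * (3 : ℝ) ^ (-((k : ℤ) ^ 2))) ≤ 1 / 4 := by
      have hk6 : 6 ≤ k ^ 2 := by
        have : 2 ^ 3 ≤ k := (Nat.pow_le_pow_right (by norm_num) (by omega)).trans hkpow
        nlinarith
      calc _ ≤ (2 : ℝ) ^ (k ^ 2) * (2 * (3 : ℝ) ^ (-((k : ℤ) ^ 2))) := by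
            gcongr
            norm_num
        _ = 2 * (2 / 3) ^ (k ^ 2) := by
            rw [zpow_neg, div_pow, ← Nat.cast_pow, zpow_natCast]
            ring
        _ ≤ 2 * (2 / 3) ^ 6 := by
            gcongr 2 * ?_
            exact pow_le_pow_of_le_one (by norm_num) (by norm_num) hk6
        _ ≤ 1 / 4 := by norm_num
    have hr : 1 ≤ Real.sqrt n := Real.one_le_sqrt.2 (by linarith)
    have hrr : Real.sqrt n * Real.sqrt n = n := Real.mul_self_sqrt (by linarith)
    have hsLr : Real.sqrt (Real.logb 2 k) ≤ 2.93 * Real.sqrt n := by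
      rw [Real.sqrt_le_left (by positivity)]
      nlinarith
    -- the sum `4 / √n` of the main error terms, divided by the common mass `3/4`, leaves room
    have hBr : 7.5 / Real.sqrt n ≤ 22 / Real.sqrt (Real.logb 2 k) := by
      rw [div_le_div_iff₀ (by linarith) hsL]
      nlinarith
    refine exists_overlay_of_sampleProb hp hp' (by omega) hb hb' hρ hρ' hβ hβ'
      ((sum_abs_sampleProb_sub_le h).trans hθ) hA hA' (by positivity) ?_
    have h1 := linear_mul_eighth_pow_le hn15
    have h2 : 1 / (n : ℝ) ≤ 1 / Real.sqrt n := by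
      refine one_div_le_one_div_of_le (by linarith) ?_
      nlinarith
    have h3 : 0 < 1 / Real.sqrt n := by positivity
    rw [← mul_one_div] at hBr
    have h4 : 2 / Real.sqrt n = 2 * (1 / Real.sqrt n) := (mul_one_div _ _).symm
    rw [h4]
    linarith

end FiniteInverse

/-! ### Counting -/

section EdgeVal

variable {Z V : Type*}

/-- The value of the kernel `K` on the edge `e` at the point `x`. For a symmetric kernel the
choice of an orientation of `e` is irrelevant. -/
def edgeVal (K : Z → Z → ℝ) (e : Sym2 V) (x : V → Z) : ℝ :=
  K (x (Quot.out e).1) (x (Quot.out e).2)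

theorem measurable_edgeVal [MeasurableSpace Z] {K : Z → Z → ℝ}
    (hK : Measurable fun p : Z × Z => K p.1 p.2) (e : Sym2 V) : Measurable (edgeVal K e) :=
  hK.comp (g := fun p : Z × Z => K p.1 p.2)
    (f := fun x : V → Z => (x (Quot.out e).1, x (Quot.out e).2))
    ((measurable_pi_apply _).prodMk (measurable_pi_apply _))

theorem sym2_mk_out (e : Sym2 V) : s((Quot.out e).1, (Quot.out e).2) = e := Quot.out_eq e

theorem sym2_out_mem (e : Sym2 V) : (Quot.out e).1 ∈ e ∧ (Quot.out e).2 ∈ e := by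
  have h : ∀ e' : Sym2 V, e' = e → s((Quot.out e).1, (Quot.out e).2) = e' →
      (Quot.out e).1 ∈ e' ∧ (Quot.out e).2 ∈ e' := by
    rintro e' - rfl
    exact ⟨Sym2.mem_mk_left _ _, Sym2.mem_mk_right _ _⟩
  exact h e rfl (sym2_mk_out e)

theorem abs_prod_edgeVal_le {K : Sym2 V → Z → Z → ℝ} {C : ℝ} (hC : ∀ e z w, |K e z w| ≤ C)
    (E : Finset (Sym2 V)) (x : V → Z) : |∏ e ∈ E, edgeVal (K e) e x| ≤ C ^ E.card := by
  rw [Finset.abs_prod, ← Finset.prod_const]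
  exact Finset.prod_le_prod (fun _ _ => abs_nonneg _) fun e _ => hC e _ _

end EdgeVal

section CountingLemma

variable {Z : Type*} [MeasurableSpace Z] {μ : Measure Z} [IsProbabilityMeasure μ]

theorem integrable_of_measurable_of_abs_le {Y : Type*} [MeasurableSpace Y] {ν : Measure Y}
    [IsFiniteMeasure ν] {f : Y → ℝ} (hf : Measurable f) {c : ℝ} (hc : ∀ y, |f y| ≤ c) :
    Integrable f ν :=
  Integrable.of_bound hf.aestronglyMeasurable c (Filter.Eventually.of_forall hc)

/-- Among the functions `f` with values in `[0,1]`, an indicator function maximizes the integral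
of `B (z, w) f z`. -/
theorem exists_set_integral_mul_le {B : Z × Z → ℝ} (hB : Measurable B) {c : ℝ}
    (hc : ∀ p, |B p| ≤ c) :
    ∃ S : Set Z, MeasurableSet S ∧ ∀ f : Z → ℝ, Measurable f → (∀ z, 0 ≤ f z ∧ f z ≤ 1) →
      ∫ p, B p * f p.1 ∂(μ.prod μ) ≤ ∫ p, B p * S.indicator 1 p.1 ∂(μ.prod μ) := by
  set h : Z → ℝ := fun z => ∫ w, B (z, w) ∂μ with hh
  have hm : Measurable h := hB.stronglyMeasurable.integral_prod_right'.measurable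
  have hle : ∀ z, |h z| ≤ c := fun z => by
    have := norm_integral_le_of_norm_le_const (μ := μ) (f := fun w => B (z, w)) (C := c)
      (Filter.Eventually.of_forall fun w => hc (z, w))
    simpa using this
  have hfub : ∀ f : Z → ℝ, Measurable f → (∀ z, 0 ≤ f z ∧ f z ≤ 1) →
      ∫ p, B p * f p.1 ∂(μ.prod μ) = ∫ z, h z * f z ∂μ := by
    intro f hf hf1
    rw [integral_prod]
    · simp only [integral_mul_const, hh]
    · refine integrable_of_measurable_of_abs_le (c := c) (by fun_prop) fun p => ?_
      rw [abs_mul, abs_of_nonneg (hf1 _).1]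
      exact mul_le_of_le_one_right (abs_nonneg _) (hf1 _).2 |>.trans (hc p)
  have hS : MeasurableSet {z | 0 ≤ h z} := measurableSet_le measurable_const hm
  have hind : Measurable ({z | 0 ≤ h z}.indicator (1 : Z → ℝ)) := measurable_one.indicator hS
  have hind1 : ∀ z, 0 ≤ {z | 0 ≤ h z}.indicator (1 : Z → ℝ) z ∧
      {z | 0 ≤ h z}.indicator (1 : Z → ℝ) z ≤ 1 := by
    intro z
    by_cases hz : z ∈ {z | 0 ≤ h z} <;> simp [hz]
  have hint : ∀ f : Z → ℝ, Measurable f → (∀ z, 0 ≤ f z ∧ f z ≤ 1) →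
      Integrable (fun z => h z * f z) μ := by
    intro f hf hf1
    refine integrable_of_measurable_of_abs_le (c := c) (by fun_prop) fun z => ?_
    rw [abs_mul, abs_of_nonneg (hf1 _).1]
    exact mul_le_of_le_one_right (abs_nonneg _) (hf1 _).2 |>.trans (hle z)
  refine ⟨{z | 0 ≤ h z}, hS, fun f hf hf1 => ?_⟩
  rw [hfub f hf hf1, hfub _ hind hind1]
  refine integral_mono (hint f hf hf1) (hint _ hind hind1) fun z => ?_
  by_cases hz : 0 ≤ h z
  · have : z ∈ {z | 0 ≤ h z} := hz
    simp only [Set.indicator_of_mem this, Pi.one_apply, mul_one]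
    exact mul_le_of_le_one_right hz (hf1 z).2
  · have : z ∉ {z | 0 ≤ h z} := hz
    simp only [Set.indicator_of_notMem this, mul_zero]
    exact mul_nonpos_of_nonpos_of_nonneg (not_le.1 hz).le (hf1 z).1

/-- `[0,1]`-valued test functions do no better than indicator functions. -/
theorem integral_mul_mul_le_of_sets {D : Z × Z → ℝ} (hD : Measurable D) {c κ : ℝ}
    (hc : ∀ p, |D p| ≤ c)
    (hκ : ∀ S T : Set Z, MeasurableSet S → MeasurableSet T →
      ∫ p in S ×ˢ T, D p ∂(μ.prod μ) ≤ κ)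
    {f g : Z → ℝ} (hf : Measurable f) (hg : Measurable g) (hf1 : ∀ z, 0 ≤ f z ∧ f z ≤ 1)
    (hg1 : ∀ z, 0 ≤ g z ∧ g z ≤ 1) :
    ∫ p, D p * f p.1 * g p.2 ∂(μ.prod μ) ≤ κ := by
  have hbd : ∀ (p : Z × Z) {x : ℝ}, 0 ≤ x ∧ x ≤ 1 → |D p * x| ≤ c := fun p x hx => by
    rw [abs_mul, abs_of_nonneg hx.1]
    exact mul_le_of_le_one_right (abs_nonneg _) hx.2 |>.trans (hc p)
  obtain ⟨S, hS, h1⟩ := exists_set_integral_mul_le (μ := μ) (B := fun p => D p * g p.2)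
    (by fun_prop) (fun p => hbd p (hg1 p.2))
  have hind : Measurable (S.indicator (1 : Z → ℝ)) := measurable_one.indicator hS
  have hind1 : ∀ z, 0 ≤ S.indicator (1 : Z → ℝ) z ∧ S.indicator (1 : Z → ℝ) z ≤ 1 := by
    intro z
    by_cases hz : z ∈ S <;> simp [hz]
  obtain ⟨T, hT, h2⟩ := exists_set_integral_mul_le (μ := μ)
    (B := fun p => D p.swap * S.indicator 1 p.2) (by fun_prop)
    (fun p => hbd p.swap (hind1 p.2))
  calc ∫ p, D p * f p.1 * g p.2 ∂(μ.prod μ) = ∫ p, D p * g p.2 * f p.1 ∂(μ.prod μ) := by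
        simp only [mul_right_comm]
    _ ≤ ∫ p, D p * g p.2 * S.indicator 1 p.1 ∂(μ.prod μ) := h1 f hf hf1
    _ = ∫ p, D p.swap * S.indicator 1 p.2 * g p.1 ∂(μ.prod μ) := by
        rw [← integral_prod_swap]
        simp only [Prod.fst_swap, Prod.snd_swap, mul_right_comm]
    _ ≤ ∫ p, D p.swap * S.indicator 1 p.2 * T.indicator 1 p.1 ∂(μ.prod μ) := h2 g hg hg1
    _ = ∫ p, (S ×ˢ T).indicator D p ∂(μ.prod μ) := by
        rw [← integral_prod_swap]
        refine integral_congr_ae (Filter.Eventually.of_forall fun p => ?_)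
        by_cases h1 : p.1 ∈ S <;> by_cases h2 : p.2 ∈ T <;>
          simp [h1, h2, Set.indicator, Set.mem_prod]
    _ = ∫ p in S ×ˢ T, D p ∂(μ.prod μ) := integral_indicator (hS.prod hT)
    _ ≤ κ := hκ S T hS hT

/-- The cut norm controls the pairing with bounded functions of arbitrary sign, at the cost of a
factor `4`. -/
theorem abs_integral_mul_mul_le_of_sets {D : Z × Z → ℝ} (hD : Measurable D) {c κ : ℝ}
    (hc : ∀ p, |D p| ≤ c)
    (hκ : ∀ S T : Set Z, MeasurableSet S → MeasurableSet T →
      |∫ p in S ×ˢ T, D p ∂(μ.prod μ)| ≤ κ)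
    {f g : Z → ℝ} (hf : Measurable f) (hg : Measurable g) {a b : ℝ} (ha : 0 < a) (hb : 0 < b)
    (hfa : ∀ z, |f z| ≤ a) (hgb : ∀ z, |g z| ≤ b) :
    |∫ p, D p * f p.1 * g p.2 ∂(μ.prod μ)| ≤ 4 * κ * (a * b) := by
  have hc0 : ∀ p, |-D p| ≤ c := fun p => by rw [abs_neg]; exact hc p
  have pos : ∀ {f g : Z → ℝ}, Measurable f → Measurable g → (∀ z, 0 ≤ f z ∧ f z ≤ 1) →
      (∀ z, 0 ≤ g z ∧ g z ≤ 1) → |∫ p, D p * f p.1 * g p.2 ∂(μ.prod μ)| ≤ κ := by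
    intro f g hf hg hf1 hg1
    rw [abs_le]
    constructor
    · have := integral_mul_mul_le_of_sets (μ := μ) (D := fun p => -D p) hD.neg hc0
        (fun S T hS hT => by rw [integral_neg]; exact (abs_le.1 (hκ S T hS hT)).1 |> neg_le.1)
        hf hg hf1 hg1
      simp only [neg_mul, integral_neg] at this
      linarith
    · exact integral_mul_mul_le_of_sets hD hc (fun S T hS hT => (abs_le.1 (hκ S T hS hT)).2)
        hf hg hf1 hg1
  have part : ∀ {f : Z → ℝ} {a : ℝ}, 0 < a → (∀ z, |f z| ≤ a) →
      (∀ z, 0 ≤ max (f z / a) 0 ∧ max (f z / a) 0 ≤ 1) ∧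
      (∀ z, 0 ≤ max (-(f z / a)) 0 ∧ max (-(f z / a)) 0 ≤ 1) := by
    intro f a ha hfa
    have h : ∀ z, |f z / a| ≤ 1 := fun z => by
      rw [abs_div, abs_of_pos ha]; exact div_le_one_of_le₀ (hfa z) ha.le
    exact ⟨fun z => ⟨le_max_right _ _, max_le (abs_le.1 (h z)).2 zero_le_one⟩,
      fun z => ⟨le_max_right _ _, max_le (neg_le.1 (abs_le.1 (h z)).1) zero_le_one⟩⟩
  obtain ⟨hf1, hf2⟩ := part ha hfa
  obtain ⟨hg1, hg2⟩ := part hb hgb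
  set f₁ : Z → ℝ := fun z => max (f z / a) 0
  set f₂ : Z → ℝ := fun z => max (-(f z / a)) 0
  set g₁ : Z → ℝ := fun z => max (g z / b) 0
  set g₂ : Z → ℝ := fun z => max (-(g z / b)) 0
  have mf₁ : Measurable f₁ := by fun_prop
  have mf₂ : Measurable f₂ := by fun_prop
  have mg₁ : Measurable g₁ := by fun_prop
  have mg₂ : Measurable g₂ := by fun_prop
  have hint : ∀ {f g : Z → ℝ}, Measurable f → Measurable g → (∀ z, 0 ≤ f z ∧ f z ≤ 1) →
      (∀ z, 0 ≤ g z ∧ g z ≤ 1) → Integrable (fun p => D p * f p.1 * g p.2) (μ.prod μ) := by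
    intro f g hf hg hf1 hg1
    refine integrable_of_measurable_of_abs_le (c := c) (by fun_prop) fun p => ?_
    rw [abs_mul, abs_mul, abs_of_nonneg (hf1 _).1, abs_of_nonneg (hg1 _).1]
    exact mul_le_of_le_one_right (mul_nonneg (abs_nonneg _) (hf1 _).1) (hg1 _).2 |>.trans
      (mul_le_of_le_one_right (abs_nonneg _) (hf1 _).2 |>.trans (hc p))
  have hdec : ∀ x y : ℝ, 0 < y → x = y * (max (x / y) 0 - max (-(x / y)) 0) := by
    intro x y hy
    rw [max_zero_sub_max_neg_zero_eq_self, mul_div_cancel₀ _ hy.ne']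
  have heq : ∫ p, D p * f p.1 * g p.2 ∂(μ.prod μ) = a * b *
      (((∫ p, D p * f₁ p.1 * g₁ p.2 ∂(μ.prod μ)) - ∫ p, D p * f₁ p.1 * g₂ p.2 ∂(μ.prod μ)) -
      ((∫ p, D p * f₂ p.1 * g₁ p.2 ∂(μ.prod μ)) - ∫ p, D p * f₂ p.1 * g₂ p.2 ∂(μ.prod μ))) := by
    rw [← integral_sub (hint mf₁ mg₁ hf1 hg1) (hint mf₁ mg₂ hf1 hg2),
      ← integral_sub (hint mf₂ mg₁ hf2 hg1) (hint mf₂ mg₂ hf2 hg2), ← integral_sub,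
      ← integral_const_mul]
    · refine integral_congr_ae (Filter.Eventually.of_forall fun p => ?_)
      have e1 : f p.1 = a * (f₁ p.1 - f₂ p.1) := hdec _ _ ha
      have e2 : g p.2 = b * (g₁ p.2 - g₂ p.2) := hdec _ _ hb
      simp only [e1, e2]
      ring
    · exact (hint mf₁ mg₁ hf1 hg1).sub (hint mf₁ mg₂ hf1 hg2)
    · exact (hint mf₂ mg₁ hf2 hg1).sub (hint mf₂ mg₂ hf2 hg2)
  have h11 := abs_le.1 (pos mf₁ mg₁ hf1 hg1)
  have h12 := abs_le.1 (pos mf₁ mg₂ hf1 hg2)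
  have h21 := abs_le.1 (pos mf₂ mg₁ hf2 hg1)
  have h22 := abs_le.1 (pos mf₂ mg₂ hf2 hg2)
  rw [heq, abs_mul, abs_of_pos (by positivity), mul_comm]
  refine mul_le_mul_of_nonneg_right (abs_le.2 ⟨?_, ?_⟩) (by positivity) <;> linarith

variable {V : Type*} [Fintype V]

/-- Resampling two coordinates preserves a product measure. -/
theorem measurePreserving_update_update [DecidableEq V] {i j : V} (hij : i ≠ j) :
    MeasurePreserving (fun q : (V → Z) × (Z × Z) =>
      Function.update (Function.update q.1 i q.2.1) j q.2.2)
      ((Measure.pi fun _ => μ).prod (μ.prod μ)) (Measure.pi fun _ => μ) := by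
  have hm : Measurable (fun q : (V → Z) × (Z × Z) =>
      Function.update (Function.update q.1 i q.2.1) j q.2.2) := by
    refine measurable_pi_iff.2 fun l => ?_
    by_cases h : l = j
    · subst h
      simp only [Function.update_self]; fun_prop
    · by_cases h' : l = i
      · subst h'
        simp only [Function.update_of_ne h, Function.update_self]; fun_prop
      · simp only [Function.update_of_ne h, Function.update_of_ne h']; fun_prop
  refine ⟨hm, ?_⟩
  symm
  refine Measure.pi_eq fun s hs => ?_
  rw [Measure.map_apply hm (MeasurableSet.univ_pi hs)]
  have hpre : (fun q : (V → Z) × (Z × Z) =>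
      Function.update (Function.update q.1 i q.2.1) j q.2.2) ⁻¹' (Set.univ.pi s) =
      (Set.univ.pi (Function.update (Function.update s i Set.univ) j Set.univ)) ×ˢ
        (s i ×ˢ s j) := by
    ext ⟨x, z, w⟩
    simp only [Set.mem_preimage, Set.mem_univ_pi, Set.mem_prod]
    constructor
    · intro h
      refine ⟨fun l => ?_, ?_, ?_⟩
      · by_cases hl : l = j
        · subst hl; simp
        · by_cases hl' : l = i
          · subst hl'; simp [Function.update_of_ne hl]
          · simpa [Function.update_of_ne hl, Function.update_of_ne hl'] using h l
      · simpa [Function.update_of_ne hij] using h i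
      · simpa using h j
    · rintro ⟨h, h1, h2⟩ l
      by_cases hl : l = j
      · subst hl; simpa using h2
      · by_cases hl' : l = i
        · subst hl'; simpa [Function.update_of_ne hl] using h1
        · simpa [Function.update_of_ne hl, Function.update_of_ne hl'] using h l
  rw [hpre, Measure.prod_prod, Measure.prod_prod, Measure.pi_pi]
  rw [← Finset.mul_prod_erase _ _ (Finset.mem_univ j),
    ← Finset.mul_prod_erase _ _ (Finset.mem_erase.2 ⟨hij, Finset.mem_univ i⟩),
    ← Finset.mul_prod_erase Finset.univ (fun l => μ (s l)) (Finset.mem_univ j),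
    ← Finset.mul_prod_erase _ (fun l => μ (s l)) (Finset.mem_erase.2 ⟨hij, Finset.mem_univ i⟩)]
  have : ∏ l ∈ (Finset.univ.erase j).erase i,
      μ (Function.update (Function.update s i Set.univ) j Set.univ l) =
      ∏ l ∈ (Finset.univ.erase j).erase i, μ (s l) := by
    refine Finset.prod_congr rfl fun l hl => ?_
    rw [Finset.mem_erase, Finset.mem_erase] at hl
    rw [Function.update_of_ne hl.2.1, Function.update_of_ne hl.1]
  rw [this]
  simp only [Function.update_self, Function.update_of_ne hij, measure_univ, one_mul]
  ring

/-- The effect of changing the kernel on a single edge `e = ij` by `D`. With all coordinates but the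
`i`-th and the `j`-th fixed, each of the remaining edges depends on at most one of these two, so the
product is a product of a function of `x i` and a function of `x j`. -/
theorem abs_integral_edgeVal_mul_prod_le {D : Z → Z → ℝ}
    (hD : Measurable fun p : Z × Z => D p.1 p.2) {c κ : ℝ} (hc : ∀ z w, |D z w| ≤ c)
    (hκ : ∀ S T : Set Z, MeasurableSet S → MeasurableSet T →
      |∫ p in S ×ˢ T, D p.1 p.2 ∂(μ.prod μ)| ≤ κ)
    {K : Sym2 V → Z → Z → ℝ} (hK : ∀ e, Measurable fun p : Z × Z => K e p.1 p.2) {C : ℝ}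
    (hC0 : 0 < C) (hC : ∀ e z w, |K e z w| ≤ C) (E : Finset (Sym2 V)) {e : Sym2 V}
    (he : ¬ e.IsDiag) (heE : e ∉ E) :
    |∫ x, edgeVal D e x * ∏ e' ∈ E, edgeVal (K e') e' x ∂(Measure.pi fun _ : V => μ)| ≤
      4 * κ * C ^ E.card := by
  classical
  set i := (Quot.out e).1 with hi
  set j := (Quot.out e).2 with hj
  have hij : i ≠ j := by
    intro h
    apply he
    rw [← sym2_mk_out e]
    exact h
  have hmem : ∀ e' ∈ E, ¬ (i ∈ e' ∧ j ∈ e') := by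
    intro e' he' h
    rw [Sym2.mem_and_mem_iff hij] at h
    exact heE (by rwa [← sym2_mk_out e, ← h])
  set EA := E.filter (fun e' => i ∈ e') with hEA
  set EB := E.filter (fun e' => ¬ i ∈ e') with hEB
  have hcard : EA.card + EB.card = E.card := Finset.card_filter_add_card_filter_not _
  set F : (V → Z) → ℝ := fun x => edgeVal D e x * ∏ e' ∈ E, edgeVal (K e') e' x with hF
  have hFm : Measurable F := (measurable_edgeVal hD e).mul
    (Finset.measurable_prod _ fun e' _ => measurable_edgeVal (hK e') e')
  have hFb : ∀ x, |F x| ≤ c * C ^ E.card := by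
    intro x
    rw [hF, abs_mul]
    exact mul_le_mul (hc _ _) (abs_prod_edgeVal_le hC E x) (abs_nonneg _)
      ((abs_nonneg _).trans (hc (x i) (x j)))
  have hmp := measurePreserving_update_update (Z := Z) (μ := μ) hij
  rw [← hmp.map_eq, integral_map hmp.measurable.aemeasurable hFm.aestronglyMeasurable,
    integral_prod]
  · have hinner : ∀ x : V → Z, |∫ p : Z × Z, F (Function.update (Function.update x i p.1) j p.2)
        ∂(μ.prod μ)| ≤ 4 * κ * C ^ E.card := by
      intro x
      set f : Z → ℝ := fun z => ∏ e' ∈ EA, edgeVal (K e') e' (Function.update x i z) with hf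
      set g : Z → ℝ := fun w => ∏ e' ∈ EB, edgeVal (K e') e' (Function.update x j w) with hg
      have hfm : Measurable f := Finset.measurable_prod _ fun e' _ =>
        (measurable_edgeVal (hK e') e').comp (measurable_update x)
      have hgm : Measurable g := Finset.measurable_prod _ fun e' _ =>
        (measurable_edgeVal (hK e') e').comp (measurable_update x)
      have hval : ∀ p : Z × Z, F (Function.update (Function.update x i p.1) j p.2) =
          D p.1 p.2 * f p.1 * g p.2 := by
        intro p
        have h1 : edgeVal D e (Function.update (Function.update x i p.1) j p.2) = D p.1 p.2 := by
          unfold edgeVal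
          rw [← hi, ← hj, Function.update_of_ne hij, Function.update_self, Function.update_self]
        have h2 : ∏ e' ∈ EA, edgeVal (K e') e' (Function.update (Function.update x i p.1) j p.2) =
            f p.1 := by
          refine Finset.prod_congr rfl fun e' he' => ?_
          rw [hEA, Finset.mem_filter] at he'
          have hje : j ∉ e' := fun h => hmem e' he'.1 ⟨he'.2, h⟩
          have h3 : (Quot.out e').1 ≠ j := fun h => hje (h ▸ (sym2_out_mem e').1)
          have h4 : (Quot.out e').2 ≠ j := fun h => hje (h ▸ (sym2_out_mem e').2)
          unfold edgeVal
          rw [Function.update_of_ne h3, Function.update_of_ne h4]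
        have h3 : ∏ e' ∈ EB, edgeVal (K e') e' (Function.update (Function.update x i p.1) j p.2) =
            g p.2 := by
          refine Finset.prod_congr rfl fun e' he' => ?_
          rw [hEB, Finset.mem_filter] at he'
          have h3 : (Quot.out e').1 ≠ i := fun h => he'.2 (h ▸ (sym2_out_mem e').1)
          have h4 : (Quot.out e').2 ≠ i := fun h => he'.2 (h ▸ (sym2_out_mem e').2)
          unfold edgeVal
          rw [Function.update_comm hij, Function.update_of_ne h3, Function.update_of_ne h4]
        simp only [hF]
        rw [h1, ← Finset.prod_filter_mul_prod_filter_not E (fun e' => i ∈ e'), h2, h3, mul_assoc]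
      simp only [hval]
      rw [← hcard, pow_add]
      exact abs_integral_mul_mul_le_of_sets (D := fun p => D p.1 p.2) hD (fun p => hc _ _) hκ hfm
        hgm (by positivity) (by positivity) (fun z => abs_prod_edgeVal_le hC _ _)
        (fun z => abs_prod_edgeVal_le hC _ _)
    have := norm_integral_le_of_norm_le_const (μ := Measure.pi fun _ : V => μ)
      (f := fun x => ∫ p : Z × Z, F (Function.update (Function.update x i p.1) j p.2) ∂(μ.prod μ))
      (C := 4 * κ * C ^ E.card) (Filter.Eventually.of_forall hinner)
    simpa using this
  · exact integrable_of_measurable_of_abs_le (hFm.comp hmp.measurable) fun q => hFb _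

/-- The counting lemma: homomorphism densities are Lipschitz in the cut norm. -/
theorem abs_integral_prod_edgeVal_sub_le {U U' : Z → Z → ℝ}
    (hU : Measurable fun p : Z × Z => U p.1 p.2) (hU' : Measurable fun p : Z × Z => U' p.1 p.2)
    {C : ℝ} (hC0 : 0 < C) (hUC : ∀ z w, |U z w| ≤ C) (hUC' : ∀ z w, |U' z w| ≤ C) {κ : ℝ}
    (hκ : ∀ S T : Set Z, MeasurableSet S → MeasurableSet T →
      |∫ p in S ×ˢ T, (U p.1 p.2 - U' p.1 p.2) ∂(μ.prod μ)| ≤ κ)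
    (E : Finset (Sym2 V)) (hE : ∀ e ∈ E, ¬ e.IsDiag) :
    |(∫ x, ∏ e ∈ E, edgeVal U e x ∂(Measure.pi fun _ : V => μ)) -
      ∫ x, ∏ e ∈ E, edgeVal U' e x ∂(Measure.pi fun _ : V => μ)| ≤
      4 * E.card * C ^ (E.card - 1) * κ := by
  classical
  -- interpolate by using `U` on the edges in `T` and `U'` on the others
  obtain ⟨K, hK⟩ : ∃ K : Finset (Sym2 V) → Sym2 V → Z → Z → ℝ,
    ∀ T e, K T e = if e ∈ T then U else U' := ⟨_, fun _ _ => rfl⟩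
  have hKm : ∀ T e, Measurable fun p : Z × Z => K T e p.1 p.2 := by
    intro T e; rw [hK]; split_ifs <;> assumption
  have hKC : ∀ T e z w, |K T e z w| ≤ C := by
    intro T e; rw [hK]; split_ifs <;> assumption
  have key : ∀ T ⊆ E, |(∫ x, ∏ e ∈ E, edgeVal (K T e) e x ∂(Measure.pi fun _ : V => μ)) -
      ∫ x, ∏ e ∈ E, edgeVal U' e x ∂(Measure.pi fun _ : V => μ)| ≤
      T.card * (4 * κ * C ^ (E.card - 1)) := by
    intro T
    induction T using Finset.induction_on with
    | empty => intro _; simp [hK]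
    | insert e T heT ih =>
      intro hT
      have heE : e ∈ E := hT (Finset.mem_insert_self _ _)
      have ih' := ih ((Finset.subset_insert _ _).trans hT)
      have hint : ∀ T, Integrable (fun x => ∏ e ∈ E, edgeVal (K T e) e x)
          (Measure.pi fun _ : V => μ) := fun T => integrable_of_measurable_of_abs_le
        (Finset.measurable_prod _ fun e' _ => measurable_edgeVal (hKm T e') e')
        (fun x => abs_prod_edgeVal_le (hKC T) E x)
      have hdiff : (∫ x, ∏ e' ∈ E, edgeVal (K (insert e T) e') e' x ∂(Measure.pi fun _ : V => μ)) -
          (∫ x, ∏ e ∈ E, edgeVal (K T e) e x ∂(Measure.pi fun _ : V => μ)) =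
          ∫ x, edgeVal (fun z w => U z w - U' z w) e x *
            ∏ e' ∈ E.erase e, edgeVal (K T e') e' x ∂(Measure.pi fun _ : V => μ) := by
        rw [← integral_sub (hint (insert e T)) (hint T)]
        refine integral_congr_ae (Filter.Eventually.of_forall fun x => ?_)
        simp only
        rw [← Finset.mul_prod_erase E _ heE, ← Finset.mul_prod_erase E _ heE]
        have : ∏ e' ∈ E.erase e, edgeVal (K (insert e T) e') e' x =
            ∏ e' ∈ E.erase e, edgeVal (K T e') e' x := by
          refine Finset.prod_congr rfl fun e' he' => ?_
          have hne := (Finset.mem_erase.1 he').1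
          simp [hK, hne]
        rw [this, ← sub_mul]
        simp [hK, heT, edgeVal]
      have hstep := abs_integral_edgeVal_mul_prod_le (μ := μ)
        (D := fun z w => U z w - U' z w) (hU.sub hU')
        (c := 2 * C) (fun z w => by linarith [abs_sub (U z w) (U' z w), hUC z w, hUC' z w])
        hκ (hKm T) hC0 (hKC T) (E.erase e) (hE e heE) (Finset.notMem_erase e E)
      rw [← hdiff, Finset.card_erase_of_mem heE] at hstep
      rw [Finset.card_insert_of_notMem heT]
      push_cast
      refine (abs_sub_le _ _ _).trans ((add_le_add hstep ih').trans (le_of_eq ?_))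
      ring
  have := key E subset_rfl
  have hKE : ∀ x : V → Z, ∏ e ∈ E, edgeVal (K E e) e x = ∏ e ∈ E, edgeVal U e x := fun x =>
    Finset.prod_congr rfl fun e he => by simp [hK, he]
  simp only [hKE] at this
  refine this.trans (le_of_eq ?_)
  ring

end CountingLemma

/-! ### Weighted graphs -/

section DiscreteMeasure

variable {V : Type*} [Fintype V] [MeasurableSpace V] {p : V → ℝ}

/-- The measure on a finite set with point masses `p`. -/
def weightMeasure (p : V → ℝ) : Measure V := ∑ v, ENNReal.ofReal (p v) • Measure.dirac v

theorem isProbabilityMeasure_weightMeasure (hp : IsProbVec p) :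
    IsProbabilityMeasure (weightMeasure p) := by
  refine ⟨?_⟩
  simp only [weightMeasure, Measure.finsetSum_apply, Measure.smul_apply, measure_univ,
    smul_eq_mul, mul_one]
  rw [← ENNReal.ofReal_sum_of_nonneg (fun v _ => hp.nonneg v), hp.sum_eq_one, ENNReal.ofReal_one]

variable [MeasurableSingletonClass V]

theorem weightMeasure_singleton (v : V) : weightMeasure p {v} = ENNReal.ofReal (p v) := by
  classical
  simp [weightMeasure, Measure.finsetSum_apply, Set.indicator_apply]

theorem integral_pi_weightMeasure (hp : IsProbVec p) {U : Type*} [Fintype U] [DecidableEq U]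
    (f : (U → V) → ℝ) :
    ∫ φ, f φ ∂(Measure.pi fun _ : U => weightMeasure p) =
      ∑ φ : U → V, (∏ i, p (φ i)) * f φ := by
  classical
  have := isProbabilityMeasure_weightMeasure hp
  rw [integral_fintype .of_finite]
  refine Finset.sum_congr rfl fun φ _ => ?_
  rw [measureReal_def, Measure.pi_singleton, ENNReal.toReal_prod, smul_eq_mul]
  congr 1
  refine Finset.prod_congr rfl fun i _ => ?_
  rw [weightMeasure_singleton, ENNReal.toReal_ofReal (hp.nonneg _)]

theorem setIntegral_prod_weightMeasure (hp : IsProbVec p) (D : V × V → ℝ) (S T : Finset V) :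
    ∫ q in (S : Set V) ×ˢ (T : Set V), D q ∂((weightMeasure p).prod (weightMeasure p)) =
      ∑ v ∈ S, ∑ w ∈ T, p v * p w * D (v, w) := by
  classical
  have := isProbabilityMeasure_weightMeasure hp
  rw [← integral_indicator (S.measurableSet.prod T.measurableSet), integral_fintype .of_finite,
    Fintype.sum_prod_type, ← Finset.sum_subset (Finset.subset_univ S)]
  · refine Finset.sum_congr rfl fun v hv => ?_
    rw [← Finset.sum_subset (Finset.subset_univ T)]
    · refine Finset.sum_congr rfl fun w hw => ?_
      rw [Set.indicator_of_mem (by simp [hv, hw]), measureReal_def, ← Set.singleton_prod_singleton,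
        Measure.prod_prod, weightMeasure_singleton, weightMeasure_singleton, ENNReal.toReal_mul,
        ENNReal.toReal_ofReal (hp.nonneg _), ENNReal.toReal_ofReal (hp.nonneg _), smul_eq_mul]
    · intro w _ hw
      rw [Set.indicator_of_notMem (by simp [hw]), smul_zero]
  · intro v _ hv
    refine Finset.sum_eq_zero fun w _ => ?_
    rw [Set.indicator_of_notMem (by simp [hv]), smul_zero]

end DiscreteMeasure

section GraphOfEdges

variable {k : ℕ}

/-- The simple graph on `Fin k` with edge set `E`. -/
def graphOfEdges (E : Finset (Edge k)) : SimpleGraph (Fin k) :=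
  SimpleGraph.fromEdgeSet ((fun e : Edge k => s(e.1.1, e.1.2)) '' E)

theorem prod_edgeFinset_graphOfEdges (E : Finset (Edge k)) [Fintype (graphOfEdges E).edgeSet]
    (f : Sym2 (Fin k) → ℝ) :
    ∏ e ∈ (graphOfEdges E).edgeFinset, f e = ∏ e ∈ E, f s(e.1.1, e.1.2) := by
  classical
  have hinj : Function.Injective (fun e : Edge k => s(e.1.1, e.1.2)) := by
    rintro ⟨⟨a, b⟩, h⟩ ⟨⟨c, d⟩, h'⟩ heq
    rcases Sym2.eq_iff.1 heq with ⟨h1, h2⟩ | ⟨h1, h2⟩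
    · simp_all
    · simp only at h h' h1 h2
      subst h1 h2
      exact absurd h (not_lt.2 h'.le)
  have : (graphOfEdges E).edgeFinset = E.image (fun e : Edge k => s(e.1.1, e.1.2)) := by
    ext e
    rw [SimpleGraph.mem_edgeFinset, graphOfEdges, SimpleGraph.edgeSet_fromEdgeSet]
    simp only [Set.mem_sdiff, Set.mem_image, Finset.mem_coe, Finset.mem_image, and_iff_left_iff_imp]
    rintro ⟨e', _, rfl⟩
    simpa using e'.2.ne
  rw [this, Finset.prod_image (fun a _ b _ h => hinj h)]

theorem sym2_lift_eq_edgeVal {Z V : Type*} (K : Z → Z → ℝ) (x : V → Z)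
    (h : ∀ i j, K (x i) (x j) = K (x j) (x i)) (e : Sym2 V) :
    Sym2.lift ⟨fun i j => K (x i) (x j), h⟩ e = edgeVal K e x := by
  conv_lhs => rw [← sym2_mk_out e]
  rfl

theorem not_isDiag_of_mem_edgeFinset {V : Type*} {F : SimpleGraph V} [Fintype F.edgeSet]
    (e : Sym2 V) (he : e ∈ F.edgeFinset) : ¬ e.IsDiag :=
  F.not_isDiag_of_mem_edgeSet (SimpleGraph.mem_edgeFinset.1 he)

end GraphOfEdges

namespace WeightedGraph

variable {V V' : Type*} [Fintype V] [Fintype V'] {G : WeightedGraph V} {G' : WeightedGraph V'}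

/-- The nodeweights, normalized to total weight `1`. -/
def nodeProb (G : WeightedGraph V) (i : V) : ℝ := G.α i / G.totalWeight

theorem totalWeight_pos [Nonempty V] (G : WeightedGraph V) : 0 < G.totalWeight :=
  Finset.sum_pos (fun i _ => G.α_pos i) Finset.univ_nonempty

theorem isProbVec_nodeProb [Nonempty V] (G : WeightedGraph V) : IsProbVec G.nodeProb := by
  refine ⟨fun i => div_nonneg (G.α_pos i).le G.totalWeight_pos.le, ?_⟩
  unfold nodeProb
  rw [← Finset.sum_div]
  exact div_self G.totalWeight_pos.ne'

open Classical in
theorem t_eq_sum {U : Type*} [Fintype U] (F : SimpleGraph U) (G : WeightedGraph V) :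
    t F G = ∑ φ : U → V, (∏ i, G.nodeProb (φ i)) * ∏ e ∈ F.edgeFinset, edgeVal G.β e φ := by
  unfold t hom
  rw [Finset.sum_div]
  refine Finset.sum_congr rfl fun φ _ => ?_
  unfold nodeProb
  rw [Finset.prod_div_distrib, Finset.prod_const, Finset.card_univ, mul_div_right_comm]
  congr 1
  exact Finset.prod_congr rfl fun e _ => sym2_lift_eq_edgeVal _ _ _ e

theorem isOverlay_iff {X : V → V' → ℝ} : IsOverlay G G' X ↔
    IsWeightCoupling G.nodeProb G'.nodeProb (fun z => X z.1 z.2) :=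
  ⟨fun h => ⟨fun z => h.1 z.1 z.2, h.2.1, h.2.2⟩,
    fun h => ⟨fun i u => h.nonneg (i, u), h.sum_right, h.sum_left⟩⟩

theorem IsOverlay.isProbVec [Nonempty V] {X : V → V' → ℝ} (h : IsOverlay G G' X) :
    IsProbVec (fun z : V × V' => X z.1 z.2) := by
  refine ⟨fun z => h.1 z.1 z.2, ?_⟩
  rw [Fintype.sum_prod_type]
  simp only [h.2.1]
  exact G.isProbVec_nodeProb.sum_eq_one

theorem edgeWeight_sub_edgeWeight {V : Type*} (α : V → ℝ) (β β' : V → V → ℝ) (S T : Finset V) :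
    edgeWeight α β S T - edgeWeight α β' S T =
      ∑ i ∈ S, ∑ j ∈ T, α i * α j * (β i j - β' i j) := by
  simp only [edgeWeight, ← Finset.sum_sub_distrib, mul_sub]

theorem le_labeledCutDist {α : V → ℝ} (hα : ∑ i, α i = 1) (β β' : V → V → ℝ) (S T : Finset V) :
    |∑ i ∈ S, ∑ j ∈ T, α i * α j * (β i j - β' i j)| ≤ labeledCutDist α β β' := by
  have := le_ciSup_finite (fun ST : Finset V × Finset V => 1 / (∑ i, α i) ^ 2 *
    |edgeWeight α β ST.1 ST.2 - edgeWeight α β' ST.1 ST.2|) (S, T)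
  unfold labeledCutDist
  simpa only [hα, one_pow, div_one, one_mul, edgeWeight_sub_edgeWeight] using this

theorem labeledCutDist_le_of_cutLE {α : V → ℝ} (hα : IsProbVec α) {β β' : V → V → ℝ} {η : ℝ}
    (h : CutLE α (fun i j => β i j - β' i j) η) : labeledCutDist α β β' ≤ η := by
  classical
  refine ciSup_le fun ST => ?_
  rw [hα.sum_eq_one, one_pow, div_one, one_mul, edgeWeight_sub_edgeWeight]
  have hind : ∀ (S : Finset V) (z : V), |if z ∈ S then α z else 0| ≤ α z := by
    intro S z
    split_ifs
    · rw [abs_of_nonneg (hα.nonneg z)]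
    · simpa using hα.nonneg z
  refine le_trans (le_of_eq ?_) (h _ _ (hind ST.1) (hind ST.2))
  congr 1
  rw [← Finset.sum_subset (Finset.subset_univ ST.1) fun i _ hi => by simp [hi]]
  refine Finset.sum_congr rfl fun i hi => ?_
  rw [← Finset.sum_subset (Finset.subset_univ ST.2) fun j _ hj => by simp [hj]]
  exact Finset.sum_congr rfl fun j hj => by rw [if_pos hi, if_pos hj]

theorem sum_arrow_prod_fst {U : Type*} [Fintype U] [DecidableEq U] {p : V → ℝ} {X : V × V' → ℝ}
    (hX : ∀ v, ∑ u, X (v, u) = p v) (f : (U → V) → ℝ) :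
    ∑ φ : U → V × V', (∏ i, X (φ i)) * f (fun i => (φ i).1) =
      ∑ φ : U → V, (∏ i, p (φ i)) * f φ := by
  rw [← (Equiv.arrowProdEquivProdArrow U (fun _ => V) (fun _ => V')).symm.sum_comp,
    Fintype.sum_prod_type]
  refine Finset.sum_congr rfl fun φ _ => ?_
  simp only [Equiv.arrowProdEquivProdArrow, Equiv.coe_fn_symm_mk]
  rw [← Finset.sum_mul]
  congr 1
  simp only [← hX]
  rw [Finset.prod_univ_sum, Fintype.piFinset_univ]

theorem sum_arrow_prod_snd {U : Type*} [Fintype U] [DecidableEq U] {q : V' → ℝ} {X : V × V' → ℝ}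
    (hX : ∀ u, ∑ v, X (v, u) = q u) (f : (U → V') → ℝ) :
    ∑ φ : U → V × V', (∏ i, X (φ i)) * f (fun i => (φ i).2) =
      ∑ φ : U → V', (∏ i, q (φ i)) * f φ := by
  rw [← sum_arrow_prod_fst (X := fun z : V' × V => X (z.2, z.1)) hX f,
    ← ((Equiv.refl U).arrowCongr (Equiv.prodComm V' V)).sum_comp]
  rfl

theorem exists_isOverlay [Nonempty V] [Nonempty V'] (G : WeightedGraph V)
    (G' : WeightedGraph V') : Nonempty {X : V → V' → ℝ // IsOverlay G G' X} :=
  ⟨⟨fun v u => G.nodeProb v * G'.nodeProb u,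
    isOverlay_iff.2 (isWeightCoupling_prod G.isProbVec_nodeProb G'.isProbVec_nodeProb)⟩⟩

theorem labeledCutDist_nonneg {α : V → ℝ} (β β' : V → V → ℝ) : 0 ≤ labeledCutDist α β β' :=
  Real.iSup_nonneg fun _ => by positivity

/-- The counting lemma for weighted graphs. -/
theorem abs_t_sub_t_le_cutDist [Nonempty V] [Nonempty V'] (hG : ∀ i j, |G.β i j| ≤ 1)
    (hG' : ∀ i j, |G'.β i j| ≤ 1) {U : Type*} [Fintype U] (F : SimpleGraph U) :
    |t F G - t F G'| ≤ 4 * (F.edgeSet.ncard : ℝ) * cutDist G G' := by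
  classical
  have hne := exists_isOverlay G G'
  unfold cutDist
  rw [Real.mul_iInf_of_nonneg (by positivity)]
  refine le_ciInf fun X => ?_
  obtain ⟨X, hX⟩ := X
  let : MeasurableSpace V := ⊤
  let : MeasurableSpace V' := ⊤
  have hXp := hX.isProbVec
  have := isProbabilityMeasure_weightMeasure hXp
  have h := abs_integral_prod_edgeVal_sub_le (μ := weightMeasure fun z : V × V' => X z.1 z.2)
    (U := fun z w => G.β z.1 w.1) (U' := fun z w => G'.β z.2 w.2)
    (measurable_of_finite _) (measurable_of_finite _) one_pos (fun z w => hG _ _)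
    (fun z w => hG' _ _)
    (κ := labeledCutDist (fun p : V × V' => X p.1 p.2)
      (fun p q => G.β p.1 q.1) (fun p q => G'.β p.2 q.2)) ?_ F.edgeFinset
    (fun e he => not_isDiag_of_mem_edgeFinset e he)
  · rw [integral_pi_weightMeasure hXp, integral_pi_weightMeasure hXp] at h
    have e1 := sum_arrow_prod_fst (U := U) (X := fun z : V × V' => X z.1 z.2) hX.2.1
      (fun φ => ∏ e ∈ F.edgeFinset, edgeVal G.β e φ)
    have e2 := sum_arrow_prod_snd (U := U) (X := fun z : V × V' => X z.1 z.2) hX.2.2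
      (fun φ => ∏ e ∈ F.edgeFinset, edgeVal G'.β e φ)
    rw [t_eq_sum, t_eq_sum]
    have hcard : F.edgeSet.ncard = F.edgeFinset.card := by
      rw [Set.ncard_eq_toFinset_card']; rfl
    rw [hcard]
    rw [one_pow, mul_one] at h
    refine le_trans (le_of_eq ?_) h
    congr 1
    exact congrArg₂ (· - ·) e1.symm e2.symm
  · intro S T _ _
    have := setIntegral_prod_weightMeasure hXp
      (fun q : (V × V') × (V × V') => G.β q.1.1 q.2.1 - G'.β q.1.2 q.2.2) S.toFinset T.toFinset
    rw [Set.coe_toFinset, Set.coe_toFinset] at this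
    rw [this]
    exact le_labeledCutDist hXp.sum_eq_one _ _ _ _

theorem edgeDensity_nodeProb {k : ℕ} (G : WeightedGraph V) (E : Finset (Edge k)) :
    edgeDensity G.nodeProb G.β E = t (graphOfEdges E) G := by
  unfold t hom edgeDensity iidE
  rw [Finset.sum_div]
  refine Finset.sum_congr (by ext; simp) fun φ _ => ?_
  unfold nodeProb
  rw [Finset.prod_div_distrib, Finset.prod_const, Finset.card_univ, mul_div_right_comm,
    prod_edgeFinset_graphOfEdges]
  rfl

/-- The inverse counting lemma for weighted graphs. -/
theorem cutDist_le_of_abs_t_sub_t_le [Nonempty V] [Nonempty V'] (hG : ∀ i j, |G.β i j| ≤ 1)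
    (hG' : ∀ i j, |G'.β i j| ≤ 1) {k : ℕ} (hk : 2 ≤ k)
    (h : ∀ F : SimpleGraph (Fin k), |t F G - t F G'| ≤ (3 : ℝ) ^ (-((k : ℤ) ^ 2))) :
    cutDist G G' ≤ 22 / Real.sqrt (Real.logb 2 (k : ℝ)) := by
  classical
  obtain ⟨X, hX, hcut⟩ := exists_overlay_of_densities G.isProbVec_nodeProb
    G'.isProbVec_nodeProb hG hG' G.β_symm G'.β_symm hk (fun E => by
      rw [edgeDensity_nodeProb, edgeDensity_nodeProb]
      have : (0 : ℝ) < (3 : ℝ) ^ (-((k : ℤ) ^ 2)) := by positivity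
      linarith [h (graphOfEdges E)])
  have hX' : IsOverlay G G' (fun v u => X (v, u)) := isOverlay_iff.2 hX
  refine (ciInf_le ⟨0, ?_⟩ (⟨_, hX'⟩ : {X : V → V' → ℝ // IsOverlay G G' X})).trans ?_
  · rintro _ ⟨Y, rfl⟩
    exact labeledCutDist_nonneg _ _
  · exact labeledCutDist_le_of_cutLE hX'.isProbVec hcut

end WeightedGraph

/-! ### Partitions, lifted couplings and graphons -/

section EvalPair

variable {Z : Type*} [MeasurableSpace Z] {μ : Measure Z} {V : Type*} [Fintype V]

theorem measurePreserving_eval_pair [IsProbabilityMeasure μ] {i j : V} (hij : i ≠ j) :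
    MeasurePreserving (fun x : V → Z => (x i, x j)) (Measure.pi fun _ => μ) (μ.prod μ) := by
  classical
  have hm : Measurable (fun x : V → Z => (x i, x j)) :=
    (measurable_pi_apply i).prodMk (measurable_pi_apply j)
  have h := measurePreserving_update_update (Z := Z) (μ := μ) hij
  refine ⟨hm, ?_⟩
  rw [← h.map_eq, Measure.map_map hm h.measurable]
  have : (fun x : V → Z => (x i, x j)) ∘ (fun q : (V → Z) × (Z × Z) =>
      Function.update (Function.update q.1 i q.2.1) j q.2.2) = Prod.snd := by
    funext q
    simp [Function.update_of_ne hij]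
  rw [this]
  exact measurePreserving_snd.map_eq

/-- Homomorphism densities are invariant under measure preserving maps. -/
theorem integral_prod_edgeVal_comp {Z' : Type*} [MeasurableSpace Z'] {ν : Measure Z'}
    [SigmaFinite μ] [SigmaFinite ν] {π : Z → Z'} (hπ : MeasurePreserving π μ ν) {K : Z' → Z' → ℝ}
    (hK : Measurable fun p : Z' × Z' => K p.1 p.2) (E : Finset (Sym2 V)) :
    ∫ x, ∏ e ∈ E, edgeVal (fun z w => K (π z) (π w)) e x ∂(Measure.pi fun _ : V => μ) =
      ∫ x, ∏ e ∈ E, edgeVal K e x ∂(Measure.pi fun _ : V => ν) := by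
  have hpi := measurePreserving_pi (fun _ : V => μ) (fun _ : V => ν) (fun _ => hπ)
  rw [← hpi.map_eq, integral_map hpi.measurable.aemeasurable
    (Finset.measurable_prod _ fun e _ => measurable_edgeVal hK e).aestronglyMeasurable]
  rfl

end EvalPair

section Partition

variable {Ω : Type*} [MeasurableSpace Ω] {P : Measure Ω} {J : Type*} {c : Ω → J}

/-- The probabilities of the cells of the partition `c`. -/
def cellProb (P : Measure Ω) (c : Ω → J) (j : J) : ℝ := P.real (c ⁻¹' {j})

/-- The measure `P` conditioned on the cell `j`; it is zero on null cells. -/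
def cellMeasure (P : Measure Ω) (c : Ω → J) (j : J) : Measure Ω :=
  ProbabilityTheory.cond P (c ⁻¹' {j})

instance (j : J) : IsZeroOrProbabilityMeasure (cellMeasure P c j) :=
  inferInstanceAs (IsZeroOrProbabilityMeasure (ProbabilityTheory.cond P (c ⁻¹' {j})))

theorem ofReal_mul_cellMeasure_univ [IsFiniteMeasure P] {x : ℝ} {j : J}
    (hx : x ≤ cellProb P c j) :
    ENNReal.ofReal x * cellMeasure P c j Set.univ = ENNReal.ofReal x := by
  by_cases h : P (c ⁻¹' {j}) = 0
  · have : x ≤ 0 := by simpa [cellProb, measureReal_def, h] using hx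
    rw [ENNReal.ofReal_of_nonpos this, zero_mul]
  · have := ProbabilityTheory.cond_isProbabilityMeasure h
    rw [cellMeasure, measure_univ, mul_one]

variable [MeasurableSpace J] [MeasurableSingletonClass J]

theorem cellMeasure_preimage (hc : Measurable c) {i j : J} (hij : i ≠ j) :
    cellMeasure P c i (c ⁻¹' {j}) = 0 := by
  rw [cellMeasure, ProbabilityTheory.cond_apply (hc (measurableSet_singleton i))]
  have : c ⁻¹' {i} ∩ c ⁻¹' {j} = ∅ := by
    ext x
    simp only [Set.mem_inter_iff, Set.mem_preimage, Set.mem_singleton_iff, Set.mem_empty_iff_false,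
      iff_false, not_and]
    rintro rfl
    exact hij
  rw [this, measure_empty, mul_zero]

variable [Fintype J]

theorem map_eq_weightMeasure [IsFiniteMeasure P] (hc : Measurable c) :
    P.map c = weightMeasure (cellProb P c) := by
  refine Measure.ext_of_singleton fun j => ?_
  rw [weightMeasure_singleton, Measure.map_apply hc (measurableSet_singleton j), cellProb,
    ofReal_measureReal]

theorem isProbVec_cellProb [IsProbabilityMeasure P] (hc : Measurable c) :
    IsProbVec (cellProb P c) := by
  refine ⟨fun j => measureReal_nonneg, ?_⟩
  have h1 : ∑ j, ENNReal.ofReal (cellProb P c j) = 1 := by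
    have : (weightMeasure (cellProb P c)) Set.univ = 1 := by
      rw [← map_eq_weightMeasure hc, Measure.map_apply hc MeasurableSet.univ]
      simp
    rw [← this]
    simp [weightMeasure]
  rw [← ENNReal.ofReal_sum_of_nonneg (fun j _ => by exact measureReal_nonneg)] at h1
  simpa using h1

theorem sum_cellProb_mul_cellMeasure [IsFiniteMeasure P] (hc : Measurable c) (A : Set Ω) :
    ∑ j, ENNReal.ofReal (cellProb P c j) * cellMeasure P c j A = P A := by
  have h1 : ∀ j, ENNReal.ofReal (cellProb P c j) * cellMeasure P c j A =
      P.restrict A (c ⁻¹' {j}) := by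
    intro j
    rw [cellProb, ofReal_measureReal, cellMeasure, mul_comm,
      ProbabilityTheory.cond_mul_eq_inter (hc (measurableSet_singleton j)),
      Measure.restrict_apply (hc (measurableSet_singleton j))]
  simp only [h1]
  rw [sum_measure_preimage_singleton _ fun j _ => hc (measurableSet_singleton j)]
  simp

end Partition

section LiftCoupling

variable {Ω Ω' J J' : Type*} [MeasurableSpace Ω] [MeasurableSpace Ω'] [Fintype J] [Fintype J']
  {P : Measure Ω} {P' : Measure Ω'} {c : Ω → J} {c' : Ω' → J'}

/-- The coupling of `P` and `P'` obtained from a coupling `X` of the cell probabilities by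
choosing points of the cells independently. -/
def liftCoupling (P : Measure Ω) (c : Ω → J) (P' : Measure Ω') (c' : Ω' → J')
    (X : J × J' → ℝ) : Measure (Ω × Ω') :=
  ∑ z, ENNReal.ofReal (X z) • (cellMeasure P c z.1).prod (cellMeasure P' c' z.2)

variable {X : J × J' → ℝ}

theorem liftCoupling_preimage_le [MeasurableSpace J] [MeasurableSingletonClass J]
    [MeasurableSpace J'] [MeasurableSingletonClass J'] (hc : Measurable c) (hc' : Measurable c')
    (z : J × J') :
    liftCoupling P c P' c' X (Prod.map c c' ⁻¹' {z}) ≤ ENNReal.ofReal (X z) := by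
  obtain ⟨j, u⟩ := z
  have hpre : Prod.map c c' ⁻¹' {(j, u)} = (c ⁻¹' {j}) ×ˢ (c' ⁻¹' {u}) := by
    ext x
    simp [Prod.ext_iff]
  rw [hpre]
  simp only [liftCoupling, Measure.finsetSum_apply, Measure.smul_apply, Measure.prod_prod,
    smul_eq_mul]
  rw [Finset.sum_eq_single (j, u)]
  · exact mul_le_of_le_one_right' (mul_le_one' prob_le_one prob_le_one)
  · rintro ⟨j', u'⟩ - hne
    by_cases h : j' = j
    · have h' : u' ≠ u := fun h' => hne (by rw [h, h'])
      rw [cellMeasure_preimage hc' h', mul_zero, mul_zero]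
    · rw [cellMeasure_preimage hc h, zero_mul, mul_zero]
  · simp

variable [IsProbabilityMeasure P] [IsProbabilityMeasure P']

theorem liftCoupling_fst [MeasurableSpace J] [MeasurableSingletonClass J] (hc : Measurable c)
    (hX : IsWeightCoupling (cellProb P c) (cellProb P' c') X) :
    (liftCoupling P c P' c' X).fst = P := by
  ext A hA
  rw [Measure.fst_apply hA, ← Set.prod_univ, ← sum_cellProb_mul_cellMeasure (P := P) hc A]
  simp only [liftCoupling, Measure.finsetSum_apply, Measure.smul_apply, Measure.prod_prod,
    smul_eq_mul]
  rw [Fintype.sum_prod_type]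
  refine Finset.sum_congr rfl fun j _ => ?_
  rw [← hX.sum_right j, ENNReal.ofReal_sum_of_nonneg fun u _ => hX.nonneg _, Finset.sum_mul]
  refine Finset.sum_congr rfl fun u _ => ?_
  rw [mul_left_comm, ofReal_mul_cellMeasure_univ, mul_comm]
  rw [← hX.sum_left u]
  exact Finset.single_le_sum (f := fun v => X (v, u)) (fun v _ => hX.nonneg _) (Finset.mem_univ j)

theorem liftCoupling_snd [MeasurableSpace J'] [MeasurableSingletonClass J'] (hc' : Measurable c')
    (hX : IsWeightCoupling (cellProb P c) (cellProb P' c') X) :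
    (liftCoupling P c P' c' X).snd = P' := by
  ext A hA
  rw [Measure.snd_apply hA, ← Set.univ_prod, ← sum_cellProb_mul_cellMeasure (P := P') hc' A]
  simp only [liftCoupling, Measure.finsetSum_apply, Measure.smul_apply, Measure.prod_prod,
    smul_eq_mul]
  rw [Fintype.sum_prod_type_right]
  refine Finset.sum_congr rfl fun u _ => ?_
  rw [← hX.sum_left u, ENNReal.ofReal_sum_of_nonneg fun v _ => hX.nonneg _, Finset.sum_mul]
  refine Finset.sum_congr rfl fun v _ => ?_
  rw [← mul_assoc, ofReal_mul_cellMeasure_univ]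
  rw [← hX.sum_right v]
  exact Finset.single_le_sum (f := fun u => X (v, u)) (fun v _ => hX.nonneg _) (Finset.mem_univ u)

end LiftCoupling

section StepKernel

variable {Z : Type*} [MeasurableSpace Z] {μ : Measure Z} [IsFiniteMeasure μ]
  {J : Type*} [Fintype J] [MeasurableSpace J] [MeasurableSingletonClass J]

/-- The cut norm of a step kernel is at most the `∞ → 1` norm of its matrix. -/
theorem abs_setIntegral_step_le {π : Z → J} (hπ : Measurable π) {ρ : J → ℝ}
    (hρ0 : ∀ j, 0 ≤ ρ j) (hρ : ∀ j, μ (π ⁻¹' {j}) ≤ ENNReal.ofReal (ρ j)) {B : J → J → ℝ} {η : ℝ}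
    (hB : CutLE ρ B η) (S T : Set Z) :
    |∫ q in S ×ˢ T, B (π q.1) (π q.2) ∂(μ.prod μ)| ≤ η := by
  have hbound : ∀ (S : Set Z) (j : J), |((μ.restrict S).map π).real {j}| ≤ ρ j := by
    intro S j
    rw [abs_of_nonneg measureReal_nonneg, measureReal_def,
      Measure.map_apply hπ (measurableSet_singleton j)]
    exact ENNReal.toReal_le_of_le_ofReal (hρ0 j) ((Measure.restrict_apply_le _ _).trans (hρ j))
  have heq : ∫ q in S ×ˢ T, B (π q.1) (π q.2) ∂(μ.prod μ) =
      ∑ z, ∑ w, ((μ.restrict S).map π).real {z} * ((μ.restrict T).map π).real {w} * B z w := by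
    rw [← Measure.prod_restrict]
    have h1 : ∫ q, B (π q.1) (π q.2) ∂((μ.restrict S).prod (μ.restrict T)) =
        ∫ q, B q.1 q.2 ∂(((μ.restrict S).map π).prod ((μ.restrict T).map π)) := by
      rw [Measure.map_prod_map _ _ hπ hπ, integral_map (hπ.prodMap hπ).aemeasurable
        (measurable_of_finite _).aestronglyMeasurable]
      rfl
    rw [h1, integral_fintype .of_finite, Fintype.sum_prod_type]
    refine Finset.sum_congr rfl fun z _ => Finset.sum_congr rfl fun w _ => ?_
    rw [← Set.singleton_prod_singleton, measureReal_prod_prod, smul_eq_mul]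
  rw [heq]
  exact hB _ _ (hbound S) (hbound T)

end StepKernel

namespace Graphon

theorem ae_abs_le_supNorm (W : Graphon) :
    ∀ᵐ p : unitInterval × unitInterval, |W p.1 p.2| ≤ W.supNorm := by
  obtain ⟨B, hB⟩ := W.bounded'
  have hfin : eLpNorm (fun p : unitInterval × unitInterval => W p.1 p.2) ⊤ volume ≠ ⊤ := by
    rw [eLpNorm_exponent_top]
    exact (eLpNormEssSup_lt_top_of_ae_bound (C := B)
      (Filter.Eventually.of_forall fun p => hB p.1 p.2)).ne
  have h := ae_le_eLpNormEssSup (μ := (volume : Measure (unitInterval × unitInterval)))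
    (f := fun p => W p.1 p.2)
  filter_upwards [h] with p hp
  rw [← eLpNorm_exponent_top] at hp
  have := ENNReal.toReal_mono hfin hp
  rwa [toReal_enorm, Real.norm_eq_abs] at this

/-- Every graphon agrees almost everywhere with a Borel measurable symmetric kernel that is
bounded everywhere. -/
theorem exists_kernel (W : Graphon) {C : ℝ} (hC0 : 0 ≤ C) (hC : W.supNorm ≤ C) :
    ∃ K : unitInterval → unitInterval → ℝ,
      (Measurable fun p : unitInterval × unitInterval => K p.1 p.2) ∧
      (∀ x y, K x y = K y x) ∧ (∀ x y, |K x y| ≤ C) ∧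
      ∀ᵐ p : unitInterval × unitInterval, W p.1 p.2 = K p.1 p.2 := by
  set f := W.aemeasurable'.mk _ with hf
  have hfm : Measurable f := W.aemeasurable'.measurable_mk
  have hfW : ∀ᵐ p : unitInterval × unitInterval, W p.1 p.2 = f p := W.aemeasurable'.ae_eq_mk
  set g : unitInterval × unitInterval → ℝ := fun p => max (-C) (min C (f p)) with hg
  have hgm : Measurable g := by fun_prop
  have hgC : ∀ p, |g p| ≤ C := fun p =>
    abs_le.2 ⟨le_max_left _ _, max_le (by linarith) (min_le_left _ _)⟩
  have hgW : ∀ᵐ p : unitInterval × unitInterval, W p.1 p.2 = g p := by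
    filter_upwards [hfW, W.ae_abs_le_supNorm] with p h1 h2
    rw [h1] at h2 ⊢
    have h3 := abs_le.1 (h2.trans hC)
    simp only [hg]
    rw [min_eq_right h3.2, max_eq_right h3.1]
  have hgW' : ∀ᵐ p : unitInterval × unitInterval, W p.2 p.1 = g p.swap :=
    (Measure.measurePreserving_swap (μ := (volume : Measure unitInterval))
      (ν := (volume : Measure unitInterval))).quasiMeasurePreserving.ae hgW
  refine ⟨fun x y => (g (x, y) + g (y, x)) / 2, by fun_prop, fun x y => by
    simp only [add_comm],
    fun x y => ?_, ?_⟩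
  · rw [abs_div, abs_two, div_le_iff₀ two_pos]
    linarith [abs_add_le (g (x, y)) (g (y, x)), hgC (x, y), hgC (y, x)]
  · filter_upwards [hgW, hgW'] with p h1 h2
    have h3 : g (p.1, p.2) = W p.1 p.2 := h1.symm
    have h4 : g (p.2, p.1) = W p.1 p.2 := by rw [W.symm' p.1 p.2]; exact h2.symm
    rw [h3, h4]; ring

variable {W W' : Graphon} {K K' : unitInterval → unitInterval → ℝ}

open Classical in
theorem t_eq_integral (hK : ∀ᵐ p : unitInterval × unitInterval, W p.1 p.2 = K p.1 p.2)
    {V : Type*} [Fintype V] (F : SimpleGraph V) :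
    t F W = ∫ x, ∏ e ∈ F.edgeFinset, edgeVal K e x
      ∂(Measure.pi fun _ : V => (volume : Measure unitInterval)) := by
  unfold t
  refine integral_congr_ae ?_
  have h : ∀ e ∈ F.edgeFinset, ∀ᵐ x ∂(Measure.pi fun _ : V => (volume : Measure unitInterval)),
      edgeVal W.toFun e x = edgeVal K e x := by
    intro e he
    have hne : (Quot.out e).1 ≠ (Quot.out e).2 := by
      intro h
      apply not_isDiag_of_mem_edgeFinset e he
      rw [← sym2_mk_out e]
      exact h
    exact (measurePreserving_eval_pair (Z := unitInterval) (μ := volume)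
      hne).quasiMeasurePreserving.ae hK
  have h' := (Filter.eventually_all_finset F.edgeFinset).2 h
  filter_upwards [h'] with x hx
  refine Finset.prod_congr rfl fun e he => ?_
  rw [sym2_lift_eq_edgeVal, hx e he]

theorem IsCoupling.isProbabilityMeasure {μ : Measure (unitInterval × unitInterval)}
    (h : IsCoupling μ) : IsProbabilityMeasure μ := by
  refine ⟨?_⟩
  rw [← Measure.fst_univ, h.1, measure_univ]

theorem IsCoupling.measurePreserving_fst {μ : Measure (unitInterval × unitInterval)}
    (h : IsCoupling μ) : MeasurePreserving Prod.fst μ volume := ⟨measurable_fst, h.1⟩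

theorem IsCoupling.measurePreserving_snd {μ : Measure (unitInterval × unitInterval)}
    (h : IsCoupling μ) : MeasurePreserving Prod.snd μ volume := ⟨measurable_snd, h.2⟩

theorem isCoupling_prod :
    IsCoupling ((volume : Measure unitInterval).prod (volume : Measure unitInterval)) :=
  ⟨Measure.fst_prod, Measure.snd_prod⟩

theorem setIntegral_overlay_eq {μ : Measure (unitInterval × unitInterval)} (hμ : IsCoupling μ)
    (hK : ∀ᵐ p : unitInterval × unitInterval, W p.1 p.2 = K p.1 p.2)
    (hK' : ∀ᵐ p : unitInterval × unitInterval, W' p.1 p.2 = K' p.1 p.2)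
    (A : Set ((unitInterval × unitInterval) × (unitInterval × unitInterval))) :
    ∫ p in A, (W p.1.1 p.2.1 - W' p.1.2 p.2.2) ∂(μ.prod μ) =
      ∫ p in A, (K p.1.1 p.2.1 - K' p.1.2 p.2.2) ∂(μ.prod μ) := by
  have := hμ.isProbabilityMeasure
  have h1 := (hμ.measurePreserving_fst.prod
    hμ.measurePreserving_fst).quasiMeasurePreserving.ae hK
  have h2 := (hμ.measurePreserving_snd.prod
    hμ.measurePreserving_snd).quasiMeasurePreserving.ae hK'
  refine integral_congr_ae (ae_restrict_of_ae ?_)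
  filter_upwards [h1, h2] with p hp hp'
  exact congrArg₂ (· - ·) hp hp'

/-- The value of an overlay bounds the discrepancy over every pair of measurable sets. -/
theorem abs_setIntegral_le_overlayCut {μ : Measure (unitInterval × unitInterval)}
    (hμ : IsCoupling μ) {S T : Set (unitInterval × unitInterval)} (hS : MeasurableSet S)
    (hT : MeasurableSet T) :
    |∫ p in S ×ˢ T, (W p.1.1 p.2.1 - W' p.1.2 p.2.2) ∂(μ.prod μ)| ≤ overlayCut W W' μ := by
  have := hμ.isProbabilityMeasure
  obtain ⟨B, hB⟩ := W.bounded'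
  obtain ⟨B', hB'⟩ := W'.bounded'
  have hB0 : 0 ≤ B + B' :=
    add_nonneg ((abs_nonneg _).trans (hB 0 0)) ((abs_nonneg _).trans (hB' 0 0))
  refine le_ciSup (f := fun ST : {S : Set (unitInterval × unitInterval) // MeasurableSet S} ×
      {T : Set (unitInterval × unitInterval) // MeasurableSet T} =>
    |∫ p in (ST.1 : Set (unitInterval × unitInterval)) ×ˢ
        (ST.2 : Set (unitInterval × unitInterval)),
      (W p.1.1 p.2.1 - W' p.1.2 p.2.2) ∂(μ.prod μ)|) ⟨B + B', ?_⟩ (⟨S, hS⟩, ⟨T, hT⟩)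
  rintro _ ⟨ST, rfl⟩
  have h := norm_setIntegral_le_of_norm_le_const
    (μ := μ.prod μ) (s := (ST.1 : Set (unitInterval × unitInterval)) ×ˢ
        (ST.2 : Set (unitInterval × unitInterval)))
    (f := fun p => W p.1.1 p.2.1 - W' p.1.2 p.2.2) (C := B + B') (measure_lt_top _ _)
    (fun p _ => (abs_sub _ _).trans (add_le_add (hB _ _) (hB' _ _)))
  exact h.trans (mul_le_of_le_one_right hB0 measureReal_le_one)

theorem overlayCut_nonneg (μ : Measure (unitInterval × unitInterval)) :
    0 ≤ overlayCut W W' μ := Real.iSup_nonneg fun _ => abs_nonneg _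

theorem cutDist_le {μ : Measure (unitInterval × unitInterval)} (hμ : IsCoupling μ) {B : ℝ}
    (h : ∀ S T : Set (unitInterval × unitInterval), MeasurableSet S → MeasurableSet T →
      |∫ p in S ×ˢ T, (W p.1.1 p.2.1 - W' p.1.2 p.2.2) ∂(μ.prod μ)| ≤ B) :
    cutDist W W' ≤ B := by
  have : Nonempty {S : Set (unitInterval × unitInterval) // MeasurableSet S} :=
    ⟨⟨∅, MeasurableSet.empty⟩⟩
  refine (ciInf_le ⟨0, ?_⟩ (⟨μ, hμ⟩ : {μ : Measure (unitInterval × unitInterval) //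
    IsCoupling μ})).trans (ciSup_le fun ST => h _ _ ST.1.2 ST.2.2)
  rintro _ ⟨ν, rfl⟩
  exact overlayCut_nonneg _

open Classical in
/-- Graphons at small cut distance have close homomorphism densities. -/
theorem abs_t_sub_t_le_cutDist {C : ℝ} (hC1 : 1 ≤ C) (hC : W.supNorm ≤ C) (hC' : W'.supNorm ≤ C)
    {V : Type*} [Fintype V] (F : SimpleGraph V) :
    |t F W - t F W'| ≤
      4 * (F.edgeSet.ncard : ℝ) * C ^ (F.edgeSet.ncard - 1) * cutDist W W' := by
  have hC0 : 0 < C := one_pos.trans_le hC1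
  obtain ⟨K, hKm, hKs, hKC, hK⟩ := W.exists_kernel hC0.le hC
  obtain ⟨K', hKm', hKs', hKC', hK'⟩ := W'.exists_kernel hC0.le hC'
  have hne : Nonempty {μ : Measure (unitInterval × unitInterval) // IsCoupling μ} :=
    ⟨⟨_, isCoupling_prod⟩⟩
  rw [cutDist, Real.mul_iInf_of_nonneg (by positivity)]
  refine le_ciInf fun ⟨μ, hμ⟩ => ?_
  have := hμ.isProbabilityMeasure
  have hcard : F.edgeSet.ncard = F.edgeFinset.card := by
    rw [Set.ncard_eq_toFinset_card', SimpleGraph.edgeFinset]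
  rw [t_eq_integral hK, t_eq_integral hK', hcard,
    ← integral_prod_edgeVal_comp hμ.measurePreserving_fst hKm,
    ← integral_prod_edgeVal_comp hμ.measurePreserving_snd hKm']
  have hm : Measurable fun q : (unitInterval × unitInterval) × (unitInterval × unitInterval) =>
      K q.1.1 q.2.1 := hKm.comp (measurable_fst.prodMap measurable_fst)
  have hm' : Measurable fun q : (unitInterval × unitInterval) × (unitInterval × unitInterval) =>
      K' q.1.2 q.2.2 := hKm'.comp (measurable_snd.prodMap measurable_snd)
  refine abs_integral_prod_edgeVal_sub_le (Z := unitInterval × unitInterval)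
    (U := fun z w => K z.1 w.1) (U' := fun z w => K' z.2 w.2) hm hm' hC0
    (fun z w => hKC _ _) (fun z w => hKC' _ _)
    (fun S T hS hT => ?_) _ fun e he => not_isDiag_of_mem_edgeFinset e he
  rw [← setIntegral_overlay_eq hμ hK hK']
  exact abs_setIntegral_le_overlayCut hμ hS hT

end Graphon

/-! ### Approximation by step kernels -/

/-- The index of the cell of `x` in the partition of the unit interval into the intervals
`[j/N, (j+1)/N)` with `j < N` and the point `1`. -/
def gridCell (N : ℕ) (x : unitInterval) : Fin (N + 1) :=
  ⟨⌊(N : ℝ) * x⌋₊, Nat.lt_succ_of_le (Nat.floor_le_of_le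
    (mul_le_of_le_one_right N.cast_nonneg x.2.2))⟩

/-- The left end point of a cell, for `N ≠ 0`. -/
def gridPoint (N : ℕ) (j : Fin (N + 1)) : unitInterval :=
  ⟨(j : ℝ) / N, by positivity, div_le_one_of_le₀ (by exact_mod_cast Nat.lt_succ_iff.1 j.2)
    N.cast_nonneg⟩

theorem measurable_gridCell (N : ℕ) : Measurable (gridCell N) := by
  refine measurable_to_countable' fun j => ?_
  have : gridCell N ⁻¹' {j} = (fun x : unitInterval => ⌊(N : ℝ) * x⌋₊) ⁻¹' {(j : ℕ)} := by
    ext x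
    simp [gridCell, Fin.ext_iff]
  rw [this]
  exact (Nat.measurable_floor.comp (by fun_prop)) (measurableSet_singleton _)

theorem dist_gridPoint_le {N : ℕ} (hN : 0 < N) (x : unitInterval) :
    dist x (gridPoint N (gridCell N x)) ≤ 1 / N := by
  have hN' : (0 : ℝ) < N := by exact_mod_cast hN
  have h0 : (0 : ℝ) ≤ N * x := mul_nonneg hN'.le x.2.1
  have h1 := Nat.floor_le h0
  have h2 := Nat.lt_floor_add_one ((N : ℝ) * x)
  rw [Subtype.dist_eq, Real.dist_eq]
  simp only [gridPoint, gridCell]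
  rw [abs_le]
  constructor
  · have : (⌊(N : ℝ) * x⌋₊ : ℝ) / N ≤ x := by rw [div_le_iff₀ hN']; linarith
    have : (0 : ℝ) < 1 / N := by positivity
    linarith
  · rw [sub_le_iff_le_add, ← add_div, le_div_iff₀ hN']
    linarith

/-- Every kernel is close in `L¹` to a continuous kernel. -/
theorem exists_continuous_approx {g : unitInterval × unitInterval → ℝ} (hg : Measurable g)
    (hsymm : ∀ p, g p.swap = g p) (hg1 : ∀ p, |g p| ≤ 1) {η : ℝ} (hη : 0 < η) :
    ∃ F : unitInterval × unitInterval → ℝ, Continuous F ∧ (∀ p, F p.swap = F p) ∧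
      (∀ p, |F p| ≤ 1) ∧ ∫ p, |g p - F p| ≤ η := by
  have hgi : Integrable g volume := integrable_of_measurable_of_abs_le hg hg1
  obtain ⟨f, hf, hfi⟩ := hgi.exists_boundedContinuous_integral_sub_le hη
  -- clamping and symmetrizing `f` does not move it away from `g`
  obtain ⟨f₁, hf₁⟩ : ∃ f₁ : unitInterval × unitInterval → ℝ,
    ∀ p, f₁ p = max (-1) (min 1 (f p)) := ⟨_, fun _ => rfl⟩
  have hf₁c : Continuous f₁ := by
    rw [funext hf₁]
    exact continuous_const.max (continuous_const.min f.continuous)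
  have hf₁1 : ∀ p, |f₁ p| ≤ 1 := fun p => by
    rw [hf₁]
    exact abs_le.2 ⟨le_max_left _ _, max_le (by norm_num) (min_le_left _ _)⟩
  have hclose : ∀ p, |g p - f₁ p| ≤ |g p - f p| := by
    intro p
    have h := abs_le.1 (hg1 p)
    have h2 : g p = max (-1) (min 1 (g p)) := by
      rw [min_eq_right h.2, max_eq_right h.1]
    rw [hf₁]
    conv_lhs => rw [h2]
    refine (abs_max_sub_max_le_max _ _ _ _).trans ?_
    rw [sub_self, abs_zero, max_eq_right (abs_nonneg _)]
    refine (abs_min_sub_min_le_max _ _ _ _).trans ?_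
    rw [sub_self, abs_zero, max_eq_right (abs_nonneg _)]
  have hi1 : Integrable (fun p => |g p - f₁ p|) volume :=
    (hgi.sub (integrable_of_measurable_of_abs_le hf₁c.measurable hf₁1)).abs
  have h1 : ∫ p, |g p - f₁ p| ≤ η :=
    (integral_mono hi1 (hgi.sub hfi).abs hclose).trans hf
  have hmp : MeasurePreserving (Prod.swap : unitInterval × unitInterval → _) volume volume :=
    Measure.measurePreserving_swap
  have hi2 : Integrable (fun p => |g p - f₁ p.swap|) volume := by
    have := hmp.integrable_comp_of_integrable hi1
    refine this.congr (Filter.Eventually.of_forall fun p => ?_)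
    simp only [Function.comp_apply, hsymm]
  have hswap : ∫ p, |g p - f₁ p.swap| = ∫ p, |g p - f₁ p| := by
    rw [← hmp.integral_comp MeasurableEquiv.prodComm.measurableEmbedding]
    simp only [hsymm, Prod.swap_swap]
  refine ⟨fun p => (f₁ p + f₁ p.swap) / 2,
    (hf₁c.add (hf₁c.comp continuous_swap)).div_const 2, fun p => ?_, fun p => ?_, ?_⟩
  · simp only [Prod.swap_swap, add_comm]
  · rw [abs_div, abs_two, div_le_iff₀ two_pos]
    linarith [abs_add_le (f₁ p) (f₁ p.swap), hf₁1 p, hf₁1 p.swap]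
  · have hle : ∀ p, |g p - (f₁ p + f₁ p.swap) / 2| ≤ (|g p - f₁ p| + |g p - f₁ p.swap|) / 2 := by
      intro p
      have : g p - (f₁ p + f₁ p.swap) / 2 = ((g p - f₁ p) + (g p - f₁ p.swap)) / 2 := by ring
      rw [this, abs_div, abs_two]
      exact div_le_div_of_nonneg_right (abs_add_le _ _) zero_le_two
    refine (integral_mono_of_nonneg (Filter.Eventually.of_forall fun p => abs_nonneg _)
      ((hi1.add hi2).div_const 2) (Filter.Eventually.of_forall hle)).trans ?_
    rw [integral_div]
    simp only [Pi.add_apply]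
    rw [integral_add hi1 hi2, hswap]
    linarith

/-- Every kernel is close in `L¹` to a step kernel. -/
theorem exists_step_approx {g : unitInterval × unitInterval → ℝ} (hg : Measurable g)
    (hsymm : ∀ p, g p.swap = g p) (hg1 : ∀ p, |g p| ≤ 1) {η : ℝ} (hη : 0 < η) :
    ∃ (N : ℕ) (M : Fin (N + 1) → Fin (N + 1) → ℝ), (∀ i j, M i j = M j i) ∧
      (∀ i j, |M i j| ≤ 1) ∧
      ∫ p : unitInterval × unitInterval, |g p - M (gridCell N p.1) (gridCell N p.2)| ≤ η := by
  obtain ⟨F, hFc, hFs, hF1, hF⟩ := exists_continuous_approx hg hsymm hg1 (half_pos hη)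
  -- uniform continuity lets one evaluate at grid points
  have huc := CompactSpace.uniformContinuous_of_continuous hFc
  obtain ⟨δ, hδ, hδF⟩ := Metric.uniformContinuous_iff.1 huc (η / 2) (half_pos hη)
  obtain ⟨n, hn⟩ := exists_nat_one_div_lt hδ
  have hstep : ∀ p : unitInterval × unitInterval,
      |F p - F (gridPoint (n + 1) (gridCell (n + 1) p.1),
        gridPoint (n + 1) (gridCell (n + 1) p.2))| ≤ η / 2 := by
    intro p
    refine (hδF ?_).le
    rw [Prod.dist_eq]
    refine (max_le (dist_gridPoint_le n.succ_pos p.1)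
      (dist_gridPoint_le n.succ_pos p.2)).trans_lt ?_
    push_cast
    exact hn
  have hi : Integrable (fun p => |g p - F p|) volume :=
    ((integrable_of_measurable_of_abs_le hg hg1).sub
      (integrable_of_measurable_of_abs_le hFc.measurable hF1)).abs
  refine ⟨n + 1, fun i j => F (gridPoint (n + 1) i, gridPoint (n + 1) j), fun i j => ?_,
    fun i j => hF1 _, ?_⟩
  · exact hFs (gridPoint (n + 1) j, gridPoint (n + 1) i)
  · refine (integral_mono_of_nonneg (Filter.Eventually.of_forall fun p => abs_nonneg _)
      (hi.add (integrable_const (η / 2))) (Filter.Eventually.of_forall fun p =>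
        (abs_sub_le _ (F p) _).trans (add_le_add le_rfl (hstep p)))).trans ?_
    simp only [Pi.add_apply]
    rw [integral_add hi (integrable_const _), integral_const, probReal_univ, one_smul]
    linarith

/-! ### Inverse counting for graphons -/

section Step

variable {k : ℕ}

open Classical in
/-- The edge densities of a step kernel are those of its matrix. -/
theorem edgeDensity_cellProb {Ω : Type*} [MeasurableSpace Ω] {P : Measure Ω}
    [IsProbabilityMeasure P] {J : Type*} [Fintype J] [MeasurableSpace J]
    [MeasurableSingletonClass J] {c : Ω → J} (hc : Measurable c) {M : J → J → ℝ}
    (hM : ∀ i j, M i j = M j i) (E : Finset (Edge k)) :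
    edgeDensity (cellProb P c) M E =
      ∫ x, ∏ e ∈ (graphOfEdges E).edgeFinset, edgeVal (fun z w => M (c z) (c w)) e x
        ∂(Measure.pi fun _ : Fin k => P) := by
  have hp := isProbVec_cellProb (P := P) hc
  have := isProbabilityMeasure_weightMeasure hp
  rw [integral_prod_edgeVal_comp (π := c) ⟨hc, map_eq_weightMeasure hc⟩ (measurable_of_finite _),
    integral_pi_weightMeasure hp, edgeDensity, iidE]
  refine Finset.sum_congr rfl fun y _ => ?_
  rw [prod_edgeFinset_graphOfEdges]
  refine congrArg _ (Finset.prod_congr rfl fun e _ => ?_)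
  rw [← sym2_lift_eq_edgeVal M y (fun i j => hM _ _)]
  rfl

theorem abs_setIntegral_le_of_integral_abs_le {Z : Type*} [MeasurableSpace Z] {μ : Measure Z}
    {f : Z → ℝ} (hf : Integrable f μ) {η : ℝ} (h : ∫ z, |f z| ∂μ ≤ η) (S : Set Z) :
    |∫ z in S, f z ∂μ| ≤ η :=
  (abs_integral_le_integral_abs.trans (setIntegral_le_integral hf.abs
    (Filter.Eventually.of_forall fun _ => abs_nonneg _))).trans h

open Classical in
/-- Passing from a kernel to a sufficiently close step kernel changes the homomorphism densities
of graphs on `k` nodes by little. -/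
theorem abs_integral_sub_edgeDensity_le {g : unitInterval × unitInterval → ℝ} (hg : Measurable g)
    (hg1 : ∀ p, |g p| ≤ 1) {N : ℕ} {M : Fin (N + 1) → Fin (N + 1) → ℝ}
    (hM : ∀ i j, M i j = M j i) (hM1 : ∀ i j, |M i j| ≤ 1) {η : ℝ}
    (h : ∫ p : unitInterval × unitInterval, |g p - M (gridCell N p.1) (gridCell N p.2)| ≤ η)
    (E : Finset (Edge k)) :
    |(∫ x, ∏ e ∈ (graphOfEdges E).edgeFinset, edgeVal (fun z w => g (z, w)) e x
        ∂(Measure.pi fun _ : Fin k => (volume : Measure unitInterval))) -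
      edgeDensity (cellProb volume (gridCell N)) M E| ≤ 4 * (k : ℝ) ^ 2 * η := by
  have hη : 0 ≤ η := (integral_nonneg fun _ => abs_nonneg _).trans h
  have hMm : Measurable fun p : unitInterval × unitInterval =>
      M (gridCell N p.1) (gridCell N p.2) :=
    (measurable_of_finite fun q : Fin (N + 1) × Fin (N + 1) => M q.1 q.2).comp
      ((measurable_gridCell N).prodMap (measurable_gridCell N))
  have hcard : ((graphOfEdges E).edgeFinset.card : ℝ) ≤ (k : ℝ) ^ 2 := by
    have h1 := (graphOfEdges E).card_edgeFinset_le_card_choose_two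
    rw [Fintype.card_fin] at h1
    exact_mod_cast h1.trans (Nat.choose_le_pow k 2)
  rw [edgeDensity_cellProb (measurable_gridCell N) hM]
  refine (abs_integral_prod_edgeVal_sub_le (μ := (volume : Measure unitInterval))
    (U := fun z w => g (z, w)) hg hMm one_pos (fun z w => hg1 _) (fun z w => hM1 _ _)
    (fun S T _ _ => abs_setIntegral_le_of_integral_abs_le
      ((integrable_of_measurable_of_abs_le hg hg1).sub
        (integrable_of_measurable_of_abs_le hMm fun p => hM1 _ _)) h _)
    _ fun e he => not_isDiag_of_mem_edgeFinset e he).trans ?_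
  rw [one_pow, mul_one]
  gcongr

end Step

namespace Graphon

open Classical in
/-- Kernels with close densities of all graphs on `k` nodes have an overlay of small cut norm. -/
theorem exists_coupling_of_integral_close {g g' : unitInterval × unitInterval → ℝ}
    (hg : Measurable g) (hg' : Measurable g') (hs : ∀ p, g p.swap = g p)
    (hs' : ∀ p, g' p.swap = g' p) (hg1 : ∀ p, |g p| ≤ 1) (hg1' : ∀ p, |g' p| ≤ 1) {k : ℕ}
    (hk : 2 ≤ k)
    (h : ∀ F : SimpleGraph (Fin k),
      |(∫ x, ∏ e ∈ F.edgeFinset, edgeVal (fun z w => g (z, w)) e x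
          ∂(Measure.pi fun _ : Fin k => (volume : Measure unitInterval))) -
        ∫ x, ∏ e ∈ F.edgeFinset, edgeVal (fun z w => g' (z, w)) e x
          ∂(Measure.pi fun _ : Fin k => (volume : Measure unitInterval))| ≤
        (3 : ℝ) ^ (-((k : ℤ) ^ 2))) {η : ℝ} (hη : 0 < η) :
    ∃ μ : Measure (unitInterval × unitInterval), IsCoupling μ ∧
      ∀ S T : Set (unitInterval × unitInterval), MeasurableSet S → MeasurableSet T →
        |∫ p in S ×ˢ T, (g (p.1.1, p.2.1) - g' (p.1.2, p.2.2)) ∂(μ.prod μ)| ≤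
          22 / Real.sqrt (Real.logb 2 k) + η := by
  have hk0 : (0 : ℝ) < k := by exact_mod_cast two_pos.trans_le hk
  obtain ⟨τ, hτ⟩ : ∃ τ : ℝ, τ = (3 : ℝ) ^ (-((k : ℤ) ^ 2)) := ⟨_, rfl⟩
  have hτ0 : 0 < τ := by rw [hτ]; positivity
  rw [← hτ] at h
  obtain ⟨ε, hε0, hε1, hε2⟩ : ∃ ε : ℝ, 0 < ε ∧ ε ≤ η / 2 ∧ 4 * (k : ℝ) ^ 2 * ε ≤ τ / 2 := by
    refine ⟨min (η / 2) (τ / (8 * (k : ℝ) ^ 2)), by positivity, min_le_left _ _, ?_⟩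
    calc 4 * (k : ℝ) ^ 2 * min (η / 2) (τ / (8 * (k : ℝ) ^ 2))
        ≤ 4 * (k : ℝ) ^ 2 * (τ / (8 * (k : ℝ) ^ 2)) := by gcongr; exact min_le_right _ _
      _ = τ / 2 := by field_simp; norm_num
  -- both kernels may be replaced by step kernels: this spends the factor `2` in the hypothesis of
  -- `exists_overlay_of_densities`
  obtain ⟨N, M, hM, hM1, hgM⟩ := exists_step_approx hg hs hg1 hε0
  obtain ⟨N', M', hM', hM1', hgM'⟩ := exists_step_approx hg' hs' hg1' hε0
  have hc := measurable_gridCell N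
  have hc' := measurable_gridCell N'
  obtain ⟨X, hX, hcut⟩ := exists_overlay_of_densities (isProbVec_cellProb (P := volume) hc)
    (isProbVec_cellProb (P := volume) hc') hM1 hM1' hM hM' hk (fun E => by
      rw [← hτ]
      have h1 := abs_le.1 (abs_integral_sub_edgeDensity_le hg hg1 hM hM1 hgM E)
      have h2 := abs_le.1 (abs_integral_sub_edgeDensity_le hg' hg1' hM' hM1' hgM' E)
      have h3 := abs_le.1 (h (graphOfEdges E))
      rw [abs_le]
      constructor <;> linarith)
  obtain ⟨μ, hμ⟩ : ∃ μ, μ = liftCoupling volume (gridCell N) volume (gridCell N') X := ⟨_, rfl⟩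
  have hμc : IsCoupling μ := by
    rw [hμ]
    exact ⟨liftCoupling_fst hc hX, liftCoupling_snd hc' hX⟩
  have hμX : ∀ z, μ (Prod.map (gridCell N) (gridCell N') ⁻¹' {z}) ≤ ENNReal.ofReal (X z) := by
    rw [hμ]
    exact liftCoupling_preimage_le hc hc'
  have := hμc.isProbabilityMeasure
  refine ⟨μ, hμc, fun S T _ _ => ?_⟩
  have hfst := hμc.measurePreserving_fst.prod hμc.measurePreserving_fst
  have hsnd := hμc.measurePreserving_snd.prod hμc.measurePreserving_snd
  have hMm := (measurable_of_finite fun q : Fin (N + 1) × Fin (N + 1) => M q.1 q.2).comp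
    (hc.prodMap hc)
  have hMm' := (measurable_of_finite fun q : Fin (N' + 1) × Fin (N' + 1) => M' q.1 q.2).comp
    (hc'.prodMap hc')
  have hd : Integrable (fun p => g p - M (gridCell N p.1) (gridCell N p.2))
      ((volume : Measure unitInterval).prod volume) :=
    (integrable_of_measurable_of_abs_le hg hg1).sub
      (integrable_of_measurable_of_abs_le hMm fun p => hM1 _ _)
  have hd' : Integrable (fun p => g' p - M' (gridCell N' p.1) (gridCell N' p.2))
      ((volume : Measure unitInterval).prod volume) :=
    (integrable_of_measurable_of_abs_le hg' hg1').sub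
      (integrable_of_measurable_of_abs_le hMm' fun p => hM1' _ _)
  have hD := hfst.integrable_comp_of_integrable hd
  have hD' := hsnd.integrable_comp_of_integrable hd'
  have hB := hfst.integrable_comp_of_integrable (integrable_of_measurable_of_abs_le
    (ν := (volume : Measure unitInterval).prod volume) hMm (fun p => hM1 _ _))
  have hB' := hsnd.integrable_comp_of_integrable (integrable_of_measurable_of_abs_le
    (ν := (volume : Measure unitInterval).prod volume) hMm' (fun p => hM1' _ _))
  have e1 : |∫ p in S ×ˢ T, _ ∂(μ.prod μ)| ≤ ε := abs_setIntegral_le_of_integral_abs_le hD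
    (by
      have := integral_map (μ := μ.prod μ) hfst.measurable.aemeasurable
        (f := fun p => |g p - M (gridCell N p.1) (gridCell N p.2)|)
        (by rw [hfst.map_eq]; exact hd.abs.aestronglyMeasurable)
      rw [hfst.map_eq] at this
      exact this.symm.trans_le hgM) (S ×ˢ T)
  have e2 : |∫ p in S ×ˢ T, _ ∂(μ.prod μ)| ≤ ε := abs_setIntegral_le_of_integral_abs_le hD'
    (by
      have := integral_map (μ := μ.prod μ) hsnd.measurable.aemeasurable
        (f := fun p => |g' p - M' (gridCell N' p.1) (gridCell N' p.2)|)
        (by rw [hsnd.map_eq]; exact hd'.abs.aestronglyMeasurable)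
      rw [hsnd.map_eq] at this
      exact this.symm.trans_le hgM') (S ×ˢ T)
  have e3 := abs_setIntegral_step_le (hc.prodMap hc') hX.nonneg hμX hcut S T
  have hsplit : ∀ {f f₁ f₂ f₃ : (unitInterval × unitInterval) × (unitInterval × unitInterval) → ℝ},
      Integrable f₁ (μ.prod μ) → Integrable f₂ (μ.prod μ) → Integrable f₃ (μ.prod μ) →
      (∀ p, f p = f₁ p - f₂ p + f₃ p) →
      ∫ p in S ×ˢ T, f p ∂(μ.prod μ) = (∫ p in S ×ˢ T, f₁ p ∂(μ.prod μ)) -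
        (∫ p in S ×ˢ T, f₂ p ∂(μ.prod μ)) + ∫ p in S ×ˢ T, f₃ p ∂(μ.prod μ) := by
    intro f f₁ f₂ f₃ h₁ h₂ h₃ hf
    have h₁₂ := integral_sub h₁.integrableOn (h₂.integrableOn (s := S ×ˢ T))
    rw [← h₁₂]
    exact (integral_congr_ae (Filter.Eventually.of_forall hf)).trans
      (integral_add (h₁.sub h₂).integrableOn h₃.integrableOn)
  rw [hsplit (f := fun p => g (p.1.1, p.2.1) - g' (p.1.2, p.2.2)) hD hD' (hB.sub hB') fun p =>
    ((sub_add_sub_comm _ _ _ _).trans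
      (congrArg₂ (· - ·) (sub_add_cancel _ _) (sub_add_cancel _ _))).symm]
  refine (abs_add_le _ _).trans ?_
  refine (add_le_add ((abs_sub _ _).trans (add_le_add e1 e2)) e3).trans ?_
  linarith

open Classical in
/-- Graphons with close densities of all graphs on `k` nodes are close in cut distance. -/
theorem cutDist_le_of_abs_t_sub_t_le {W W' : Graphon} {C : ℝ} (hC1 : 1 ≤ C) (hC : W.supNorm ≤ C)
    (hC' : W'.supNorm ≤ C) {k : ℕ} (hk : 2 ≤ k)
    (h : ∀ F : SimpleGraph (Fin k), |t F W - t F W'| ≤ (3 : ℝ) ^ (-((k : ℤ) ^ 2))) :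
    cutDist W W' ≤ 22 * C / Real.sqrt (Real.logb 2 (k : ℝ)) := by
  have hC0 : 0 < C := one_pos.trans_le hC1
  obtain ⟨K, hKm, hKs, hKC, hK⟩ := W.exists_kernel hC0.le hC
  obtain ⟨K', hKm', hKs', hKC', hK'⟩ := W'.exists_kernel hC0.le hC'
  -- the inverse counting lemma is applied to `K / C`, which is bounded by `1`; dividing by `C ≥ 1`
  -- only decreases the differences of densities
  have hscale : ∀ (L : unitInterval → unitInterval → ℝ) (F : SimpleGraph (Fin k)),
      ∫ x, ∏ e ∈ F.edgeFinset, edgeVal (fun z w => L z w / C) e x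
          ∂(Measure.pi fun _ : Fin k => (volume : Measure unitInterval)) =
        (∫ x, ∏ e ∈ F.edgeFinset, edgeVal L e x
          ∂(Measure.pi fun _ : Fin k => (volume : Measure unitInterval))) /
          C ^ F.edgeFinset.card := by
    intro L F
    simp only [edgeVal, Finset.prod_div_distrib, Finset.prod_const]
    rw [integral_div]
  have hdiv : ∀ {L : unitInterval → unitInterval → ℝ}, (∀ x y, |L x y| ≤ C) →
      ∀ p : unitInterval × unitInterval, |L p.1 p.2 / C| ≤ 1 := by
    intro L hL p
    rw [abs_div, abs_of_pos hC0, div_le_one hC0]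
    exact hL _ _
  refine le_of_forall_pos_le_add fun η hη => ?_
  obtain ⟨μ, hμ, hcut⟩ := exists_coupling_of_integral_close
    (g := fun p => K p.1 p.2 / C) (g' := fun p => K' p.1 p.2 / C) (hKm.div_const C)
    (hKm'.div_const C) (fun p => by simp only [Prod.fst_swap, Prod.snd_swap]; rw [hKs])
    (fun p => by simp only [Prod.fst_swap, Prod.snd_swap]; rw [hKs']) (hdiv hKC) (hdiv hKC') hk
    (fun F => by
      rw [hscale, hscale, ← t_eq_integral hK, ← t_eq_integral hK', ← sub_div, abs_div,
        abs_of_pos (pow_pos hC0 _)]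
      exact (div_le_self (abs_nonneg _) (one_le_pow₀ hC1)).trans (h F)) (div_pos hη hC0)
  refine cutDist_le hμ fun S T hS hT => ?_
  have := hcut S T hS hT
  simp only [← sub_div] at this
  rw [integral_div, abs_div, abs_of_pos hC0, div_le_iff₀ hC0] at this
  rw [setIntegral_overlay_eq hμ hK hK']
  refine this.trans_eq ?_
  field_simp

end Graphon

end DenseGraph

end

theorem theorem3p7 :
    (∀ (W W' : DenseGraph.Graphon) (C : ℝ), C = max 1 (max W.supNorm W'.supNorm) →
      (∀ (V : Type*) [Fintype V] (F : SimpleGraph V) (m : ℕ), F.edgeSet.ncard = m →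
        |DenseGraph.Graphon.t F W - DenseGraph.Graphon.t F W'| ≤
          4 * (m : ℝ) * C ^ (m - 1) * DenseGraph.Graphon.cutDist W W') ∧
      (∀ k : ℕ, 2 ≤ k →
        (∀ F : SimpleGraph (Fin k),
          |DenseGraph.Graphon.t F W - DenseGraph.Graphon.t F W'| ≤
            (3 : ℝ) ^ (-((k : ℤ) ^ 2))) →
        DenseGraph.Graphon.cutDist W W' ≤ 22 * C / Real.sqrt (Real.logb 2 (k : ℝ)))) ∧
    (∀ (V₁ : Type*) (V₂ : Type*) [Fintype V₁] [Nonempty V₁] [Fintype V₂] [Nonempty V₂]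
      (G₁ : DenseGraph.WeightedGraph V₁) (G₂ : DenseGraph.WeightedGraph V₂),
      (∀ i j, G₁.β i j ∈ Set.Icc (-1 : ℝ) 1) → (∀ i j, G₂.β i j ∈ Set.Icc (-1 : ℝ) 1) →
      (∀ (V : Type*) [Fintype V] (F : SimpleGraph V),
        |DenseGraph.WeightedGraph.t F G₁ - DenseGraph.WeightedGraph.t F G₂| ≤
          4 * (F.edgeSet.ncard : ℝ) * DenseGraph.WeightedGraph.cutDist G₁ G₂) ∧
      (∀ k : ℕ, 2 ≤ k →
        (∀ F : SimpleGraph (Fin k),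
          |DenseGraph.WeightedGraph.t F G₁ - DenseGraph.WeightedGraph.t F G₂| ≤
            (3 : ℝ) ^ (-((k : ℤ) ^ 2))) →
        DenseGraph.WeightedGraph.cutDist G₁ G₂ ≤ 22 / Real.sqrt (Real.logb 2 (k : ℝ)))) := by
  refine ⟨fun W W' C hC => ?_, fun V₁ V₂ _ _ _ _ G₁ G₂ h₁ h₂ => ?_⟩
  · have hC1 : 1 ≤ C := hC ▸ le_max_left _ _
    have hCW : W.supNorm ≤ C := hC ▸ (le_max_left _ _).trans (le_max_right _ _)
    have hCW' : W'.supNorm ≤ C := hC ▸ (le_max_right _ _).trans (le_max_right _ _)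
    refine ⟨fun V _ F m hm => ?_, fun k hk h => ?_⟩
    · subst hm
      exact DenseGraph.Graphon.abs_t_sub_t_le_cutDist hC1 hCW hCW' F
    · exact DenseGraph.Graphon.cutDist_le_of_abs_t_sub_t_le hC1 hCW hCW' hk h
  · have hβ₁ : ∀ i j, |G₁.β i j| ≤ 1 := fun i j => abs_le.2 (h₁ i j)
    have hβ₂ : ∀ i j, |G₂.β i j| ≤ 1 := fun i j => abs_le.2 (h₂ i j)
    exact ⟨fun V _ F => DenseGraph.WeightedGraph.abs_t_sub_t_le_cutDist hβ₁ hβ₂ F,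
      fun k hk h => DenseGraph.WeightedGraph.cutDist_le_of_abs_t_sub_t_le hβ₁ hβ₂ hk h⟩
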